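/- **Setting.** Let $d\in\{2,3\}$, let $\Omega\subset\mathbb R^d$ be a nonempty bounded convex polytopal open set, and let $\mathscr A,\mathscr B$ be nonempty compact metric spaces. Let $a$ (symmetric $d\times d$ matrix-valued), $b$ ($\mathbb R^d$-valued), $c$ and $f$ (real-valued) be continuous on $\overline\Omega\times\mathscr A\times\mathscr B$, and write $a^{\alpha\beta}=a(\cdot,\alpha,\beta)$, etc. Assume $c\ge 0$ in $\Omega$ and that $a^{\alpha\beta}$ is uniformly elliptic in $\Omega$, uniformly in $(\alpha,\beta)$. Let $\nu\in(0,1]$ and $\lambda\ge 0$ be such that, with $|\cdot|$ the Frobenius/Euclidean norm, one of the following (Cordes) conditions holds in $\Omega$ for all $(\alpha,\beta)$: either $b\equiv0$, $c\equiv0$, $\lambda=0$ and $$\frac{|a^{\alpha\beta}|^2}{(\operatorname{Tr}a^{\alpha\beta})^2}\le\frac1{d-1+\nu},$$ or $b,c$ do not both vanish identically, $\lambda>0$ and $$\frac{|a^{\alpha\beta}|^2+|b^{\alpha\beta}|^2/(2\lambda)+(c^{\alpha\beta}/\lambda)^2}{(\operatorname{Tr}a^{\alpha\beta}+c^{\alpha\beta}/\lambda)^2}\le\frac1{d+\nu}.$$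 Let $\gamma^{\alpha\beta}=\operatorname{Tr}a^{\alpha\beta}/|a^{\alpha\beta}|^2$ in the first case and $\gamma^{\alpha\beta}=(\operatorname{Tr}a^{\alpha\beta}+c^{\alpha\beta}/\lambda)\big/(|a^{\alpha\beta}|^2+|b^{\alpha\beta}|^2/(2\lambda)+|c^{\alpha\beta}|^2/\lambda^2)$ in the second, and $$F_\gamma[v]=\inf_{\alpha\in\mathscr A}\sup_{\beta\in\mathscr B}\gamma^{\alpha\beta}\big(a^{\alpha\beta}:\nabla^2v+b^{\alpha\beta}\cdot\nabla v-c^{\alpha\beta}v-f^{\alpha\beta}\big).$$ **Discretization.** Let $\mathcal T$ be a finite conforming partition of $\Omega$ into closed simplices, $\vartheta_{\mathcal T}=\max_{K\in\mathcal T}\operatorname{diam}K/\rho_K$ with $\rho_K$ the diameter of the largest ball contained in $K$, and $\mathcal F=\mathcal F^I\cup\mathcal F^B$ the set of its $(d-1)$-dimensional faces (interior and boundary). For each face $F$ let $h_F=(\mathcal H^{d-1}(F))^{1/(d-1)}$, and let $n=n_F$ be a fixed unit normal, outward to $\Omega$ if $F\in\mathcal F^B$. For piecewise smooth $v$, on an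 interior face $F=K\cap K'$ with $n_F$ outward to $K$ set $[v]=v|_K-v|_{K'}$ and $\{v\}=\tfrac12(v|_K+v|_{K'})$; on boundary faces $[v]=\{v\}=v|_K$. Derivatives of piecewise polynomials are taken elementwise; $\nabla_T$ and $\Delta_T$ are the tangential gradient and Laplacian on faces; $\int_{\mathcal G}=\sum_{F\in\mathcal G}\int_F$ with respect to $\mathcal H^{d-1}$, and $h=h_F$ on $F$. Let $p\ge2$ and $q\ge p-2$ be integers, let $V^0$ be the space of piecewise polynomials over $\mathcal T$ of total degree at most $p$, let $V^1=V^0\cap H^1_0(\Omega)$, and set $$|v|_J^2=\int_{\mathcal F^I}h^{-1}|[\nabla v]|^2+\int_{\mathcal F}h^{-3}|[v]|^2,\qquad \|v\|_{\mathcal T}^2=\int_\Omega\big(|\nabla^2v|^2+|\nabla v|^2+|v|^2\big)+|v|_J^2 .$$ Call $C$ a Poincaré–Friedrichs constant for $(\mathcal T,p)$ if $$\|v\|_{\mathcal T}\le C\Big(\int_\Omega|\nabla^2v|^2+|v|_J^2\Big)^{1/2}\qquad\text{for all }v\in V^s,\ s\in\{0,1\}.$$ Let $r(v)=\sum_{F\in\mathcal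 F^I}r_F([\nabla v\cdot n])$, where $r_F(w)$ is the piecewise polynomial of degree at most $q$ with $\int_\Omega r_F(w)\varphi=\int_Fw\{\varphi\}$ for all piecewise polynomials $\varphi$ of degree at most $q$. For $\chi\in\{0,1\}$, $\theta\in[0,1]$ and $\sigma,\rho>0$ let $$A_{\mathcal T}(w;v)=\int_\Omega F_\gamma[w]\,(\Delta v-\chi r(v)-\lambda v)+\theta S(w,v)+J(w,v),$$ where $$\begin{aligned}S(w,v)=&\int_\Omega[\nabla^2w:\nabla^2v-\Delta w\Delta v]-\int_{\mathcal F}\big[\nabla_T\{\nabla w\cdot n\}\cdot[\nabla_Tv]+\nabla_T\{\nabla v\cdot n\}\cdot[\nabla_Tw]\big]\\&+\int_{\mathcal F^I}\big[\{\Delta_Tw\}[\nabla v\cdot n]+\{\Delta_Tv\}[\nabla w\cdot n]\big],\\ J(w,v)=&\int_{\mathcal F^I}\sigma h^{-1}[\nabla w]\cdot[\nabla v]+\int_{\mathcal F^B}\sigma h^{-1}[\nabla_Tw]\cdot[\nabla_Tv]+\int_{\mathcal F}\rho h^{-3}[w][v].\end{aligned}$$ **Theorem.** (i) There is a Poincaré–Friedrichs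 constant $C_{\mathrm{PF}}$ for $(\mathcal T,p)$ that depends only on $d$, $\vartheta_{\mathcal T}$, $p$ and $\operatorname{diam}\Omega$. (ii) Suppose that $$\theta\in\Big(\frac{1-\sqrt\nu}2,\frac{1+\sqrt\nu}2\Big),\qquad \mu:=\theta-\frac{1-\nu}{4(1-\theta)} .$$ Then $\mu>0$, and there are $\sigma_{\min}>0$ and $\rho_{\min}>0$ depending only on $d$, $\vartheta_{\mathcal T}$, $\lambda$, $p$, $q$, $\theta$ and $\mu$ (in particular, not on $\Omega$) such that, for every $s\in\{0,1\}$, all $\sigma\ge\sigma_{\min}$, $\rho\ge\rho_{\min}$ and every Poincaré–Friedrichs constant $C_{\mathrm{PF}}$ for $(\mathcal T,p)$, $$C_{\mathrm{mon}}^{-1}\,\|w-v\|_{\mathcal T}^2\le A_{\mathcal T}(w;w-v)-A_{\mathcal T}(v;w-v)\qquad\text{for all }w,v\in V^s,$$ with a constant $C_{\mathrm{mon}}>0$ that depends only on $\mu$ and $C_{\mathrm{PF}}$. -/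

import Mathlib

open scoped BigOperators

noncomputable section

namespace IsaacsDG

/-- `ℝ^d` with its Euclidean norm. -/
abbrev E (d : ℕ) : Type := EuclideanSpace ℝ (Fin d)

/-- The Euclidean inner product `x · y`. -/
def dot {d : ℕ} (x y : E d) : ℝ := ∑ i, x i * y i

/-! ### Domains and coefficients -/

/-- Nonempty bounded convex polytopal open subsets of `ℝ^d`
(the closure is the convex hull of finitely many points). -/
structure IsConvexPolytopalDomain {d : ℕ} (Ω : Set (E d)) : Prop where
  isOpen : IsOpen Ω
  nonempty : Ω.Nonempty
  isBounded : Bornology.IsBounded Ω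
  convex : Convex ℝ Ω
  polytopal : ∃ S : Finset (E d), closure Ω = convexHull ℝ (S : Set (E d))

/-- The coefficients `a^{αβ}(x)`, `b^{αβ}(x)`, `c^{αβ}(x)`, `f^{αβ}(x)` of an Isaacs operator. -/
structure Coefficients (d : ℕ) (𝒜 ℬ : Type*) where
  a : E d → 𝒜 → ℬ → Matrix (Fin d) (Fin d) ℝ
  b : E d → 𝒜 → ℬ → E d
  c : E d → 𝒜 → ℬ → ℝ
  f : E d → 𝒜 → ℬ → ℝ

/-- Squared Frobenius norm `|M|²` of a matrix. -/
def frobSq {d : ℕ} (M : Matrix (Fin d) (Fin d) ℝ) : ℝ := ∑ i, ∑ j, (M i j) ^ 2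

/-- Frobenius inner product `M : N`. -/
def frobInner {d : ℕ} (M N : Matrix (Fin d) (Fin d) ℝ) : ℝ := ∑ i, ∑ j, M i j * N i j

namespace Coefficients

variable {d : ℕ} {𝒜 ℬ : Type*}

/-- The lower-order coefficients `b` and `c` vanish identically on `closure Ω × 𝒜 × ℬ`. -/
def LowerOrderVanish (D : Coefficients d 𝒜 ℬ) (Ω : Set (E d)) : Prop :=
  ∀ x ∈ closure Ω, ∀ α β, D.b x α β = 0 ∧ D.c x α β = 0

/-- The Cordes condition in the absence of lower-order terms. -/
def CordesPure (D : Coefficients d 𝒜 ℬ) (Ω : Set (E d)) (ν : ℝ) : Prop :=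
  ∀ x ∈ Ω, ∀ α β, frobSq (D.a x α β) / (D.a x α β).trace ^ 2 ≤ 1 / ((d : ℝ) - 1 + ν)

/-- The Cordes condition in the presence of lower-order terms. -/
def CordesGeneral (D : Coefficients d 𝒜 ℬ) (Ω : Set (E d)) (lam ν : ℝ) : Prop :=
  ∀ x ∈ Ω, ∀ α β,
    (frobSq (D.a x α β) + ‖D.b x α β‖ ^ 2 / (2 * lam) + (D.c x α β / lam) ^ 2) /
      ((D.a x α β).trace + D.c x α β / lam) ^ 2 ≤ 1 / ((d : ℝ) + ν)

/-- The standing assumptions on the data of the Isaacs operator: continuity, symmetry and uniform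
ellipticity of `a`, nonnegativity of `c`, and the Cordes condition with constant `ν ∈ (0,1]`.
The parameter is `lam = 0` if `b` and `c` vanish identically, and `lam > 0` otherwise. -/
structure Admissible [TopologicalSpace 𝒜] [TopologicalSpace ℬ]
    (D : Coefficients d 𝒜 ℬ) (Ω : Set (E d)) (lam ν : ℝ) : Prop where
  continuous_a : ContinuousOn (fun z : E d × 𝒜 × ℬ => D.a z.1 z.2.1 z.2.2)
    (closure Ω ×ˢ Set.univ)
  continuous_b : ContinuousOn (fun z : E d × 𝒜 × ℬ => D.b z.1 z.2.1 z.2.2)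
    (closure Ω ×ˢ Set.univ)
  continuous_c : ContinuousOn (fun z : E d × 𝒜 × ℬ => D.c z.1 z.2.1 z.2.2)
    (closure Ω ×ˢ Set.univ)
  continuous_f : ContinuousOn (fun z : E d × 𝒜 × ℬ => D.f z.1 z.2.1 z.2.2)
    (closure Ω ×ˢ Set.univ)
  symm : ∀ x ∈ closure Ω, ∀ α β, (D.a x α β).IsSymm
  elliptic : ∃ lo hi : ℝ, 0 < lo ∧ 0 < hi ∧ ∀ x ∈ Ω, ∀ α β, ∀ ξ : E d,
    lo * ‖ξ‖ ^ 2 ≤ ∑ i, ∑ j, ξ i * D.a x α β i j * ξ j ∧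
      ∑ i, ∑ j, ξ i * D.a x α β i j * ξ j ≤ hi * ‖ξ‖ ^ 2
  c_nonneg : ∀ x ∈ Ω, ∀ α β, 0 ≤ D.c x α β
  nu_pos : 0 < ν
  nu_le_one : ν ≤ 1
  cordes : (D.LowerOrderVanish Ω ∧ lam = 0 ∧ D.CordesPure Ω ν) ∨
    (¬ D.LowerOrderVanish Ω ∧ 0 < lam ∧ D.CordesGeneral Ω lam ν)

/-- The renormalization function `γ^{αβ}`; for admissible data, `lam = 0` is the case in which `b`
and `c` vanish identically. -/
def gamma (D : Coefficients d 𝒜 ℬ) (lam : ℝ) (x : E d) (α : 𝒜) (β : ℬ) : ℝ :=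
  open Classical in
  if lam = 0 then (D.a x α β).trace / frobSq (D.a x α β)
  else ((D.a x α β).trace + D.c x α β / lam) /
    (frobSq (D.a x α β) + ‖D.b x α β‖ ^ 2 / (2 * lam) + |D.c x α β| ^ 2 / lam ^ 2)

/-- The renormalized Isaacs operator `F_γ` at the point `x`, for a function with Hessian `M`,
gradient `g` and value `r` at `x`:
`inf_α sup_β γ^{αβ} (a^{αβ} : M + b^{αβ} · g - c^{αβ} r - f^{αβ})`. -/
def Fgamma (D : Coefficients d 𝒜 ℬ) (lam : ℝ) (x : E d)
    (M : Matrix (Fin d) (Fin d) ℝ) (g : E d) (r : ℝ) : ℝ :=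
  ⨅ α : 𝒜, ⨆ β : ℬ, D.gamma lam x α β *
    (frobInner (D.a x α β) M + dot (D.b x α β) g - D.c x α β * r - D.f x α β)

end Coefficients

/-! ### Calculus of polynomials on `ℝ^d` -/

/-- Real polynomials in `d` variables. -/
abbrev Poly (d : ℕ) : Type := MvPolynomial (Fin d) ℝ

/-- The value of a polynomial at a point. -/
def ev {d : ℕ} (P : Poly d) (x : E d) : ℝ := MvPolynomial.eval (fun i => x i) P

/-- `∂_i P`. -/
def pd {d : ℕ} (i : Fin d) (P : Poly d) : Poly d := MvPolynomial.pderiv i P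

/-- `∇P` as a vector of polynomials. -/
def gradP {d : ℕ} (P : Poly d) : Fin d → Poly d := fun i => pd i P

/-- `(∇²P)_{ij} = ∂_j ∂_i P`. -/
def hessP {d : ℕ} (P : Poly d) : Fin d → Fin d → Poly d := fun i j => pd j (pd i P)

/-- `ΔP`, the trace of the Hessian. -/
def lapP {d : ℕ} (P : Poly d) : Poly d := ∑ i, hessP P i i

/-- The directional derivative `∇P · n` for a constant vector `n`. -/
def normalD {d : ℕ} (n : E d) (P : Poly d) : Poly d := ∑ i, MvPolynomial.C (n i) * pd i P

/-- The tangential gradient `∇_T P = ∇P - (∇P · n) n` on a flat face with unit normal `n`. -/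
def gradT {d : ℕ} (n : E d) (P : Poly d) : Fin d → Poly d :=
  fun i => pd i P - MvPolynomial.C (n i) * normalD n P

/-- The tangential Laplacian `Δ_T P = div_T (∇_T P)` on a flat face with unit normal `n`. -/
def lapT {d : ℕ} (n : E d) (P : Poly d) : Poly d := ∑ i, gradT n (gradT n P i) i

/-! ### Meshes -/

/-- A finite conforming partition of (the closure of) `Ω` into closed simplices, given by the
simplicial complex of all its `d`-simplices and their subsimplices. A simplex is represented by its
set of vertices. -/
structure Mesh {d : ℕ} (Ω : Set (E d)) extends Geometry.SimplicialComplex ℝ (E d) where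
  finite_faces : faces.Finite
  pure_dim : ∀ s ∈ faces, ∃ t ∈ faces, s ⊆ t ∧ t.card = d + 1
  space_eq : toSimplicialComplex.space = closure Ω

/-- The closed simplex with given vertices. -/
def hull {d : ℕ} (s : Finset (E d)) : Set (E d) := convexHull ℝ (s : Set (E d))

/-- The diameter of the largest ball contained in the simplex with vertices `K`. -/
def inscribedDiam {d : ℕ} (K : Finset (E d)) : ℝ :=
  sSup {δ : ℝ | ∃ (z : E d) (r : ℝ), 0 ≤ r ∧ Metric.closedBall z r ⊆ hull K ∧ δ = 2 * r}

/-- `h_F = (H^{d-1}(F))^{1/(d-1)}`, with the Hausdorff measure normalized as surface measure. -/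
def hFace {d : ℕ} (F : Finset (E d)) : ℝ :=
  ((MeasureTheory.Measure.euclideanHausdorffMeasure (d - 1)).real (hull F)) ^
    (1 / ((d : ℝ) - 1))

/-- `∫_F g`, with respect to the `(d-1)`-dimensional Hausdorff measure. -/
def faceInt {d : ℕ} (F : Finset (E d)) (g : E d → ℝ) : ℝ :=
  ∫ x in hull F, g x ∂(MeasureTheory.Measure.euclideanHausdorffMeasure (d - 1))

namespace Mesh

variable {d : ℕ} {Ω : Set (E d)}

open Classical in
/-- The elements `K ∈ 𝒯`, i.e. the `d`-dimensional simplices of the mesh. -/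
def elems (T : Mesh Ω) : Finset (Finset (E d)) :=
  T.finite_faces.toFinset.filter (fun s => s.card = d + 1)

open Classical in
/-- The set `ℱ` of all `(d-1)`-dimensional faces. -/
def facets (T : Mesh Ω) : Finset (Finset (E d)) :=
  T.finite_faces.toFinset.filter (fun s => s.card = d)

open Classical in
/-- The elements that contain the face `F`. -/
def adj (T : Mesh Ω) (F : Finset (E d)) : Finset T.elems :=
  Finset.univ.filter (fun K => F ⊆ K.1)

open Classical in
/-- The set `ℱ^I` of interior faces: those shared by two elements. -/
def facetsI (T : Mesh Ω) : Finset (Finset (E d)) :=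
  T.facets.filter (fun F => (T.adj F).card = 2)

open Classical in
/-- The set `ℱ^B` of boundary faces: those contained in only one element. -/
def facetsB (T : Mesh Ω) : Finset (Finset (E d)) :=
  T.facets.filter (fun F => (T.adj F).card = 1)

/-- The shape-regularity parameter `max_K diam K / ρ_K`. -/
def shapeReg (T : Mesh Ω) : ℝ :=
  ⨆ K : T.elems, Metric.diam (hull K.1) / inscribedDiam K.1

/-- `n` is a choice of unit normals `n_F` for all faces `F`, which is the outward unit normal to `Ω`
if `F` is a boundary face. -/
structure IsNormalField (T : Mesh Ω) (n : Finset (E d) → E d) : Prop where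
  norm_eq_one : ∀ F ∈ T.facets, ‖n F‖ = 1
  orthogonal : ∀ F ∈ T.facets, ∀ x ∈ F, ∀ y ∈ F, dot (n F) (y - x) = 0
  outward : ∀ F ∈ T.facetsB, ∀ x ∈ F, ∀ y ∈ Ω, dot (n F) (y - x) ≤ 0

/-! ### Piecewise polynomials, jumps and averages -/

/-- Piecewise polynomials over the mesh, represented by their restriction to each element (elements
of `L²(Ω)` are only defined almost everywhere, so that a piecewise polynomial is the same thing as
the family of its restrictions to the elements). The trace on the boundary of an element is the
value of the corresponding polynomial. -/
abbrev PwPoly (T : Mesh Ω) : Type := T.elems → Poly d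

/-- Piecewise polynomials of total degree at most `p`; this is the space `V_𝒯^0`, and also the space
`V_{𝒯,q}` for `p = q`. -/
def V0 (T : Mesh Ω) (p : ℕ) : Set T.PwPoly := {v | ∀ K, (v K).totalDegree ≤ p}

open Classical in
/-- The function on `ℝ^d` that coincides with `v|_K` in the interior of each element `K`. -/
def toFun (T : Mesh Ω) (v : T.PwPoly) (x : E d) : ℝ :=
  ∑ K : T.elems, Set.indicator (interior (hull K.1)) (ev (v K)) x

end Mesh

/-- `u ∈ H^1_0(Ω)`: there are smooth functions with compact support in `Ω` that converge to `u` in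
`L²(Ω)` and whose gradients converge in `L²(Ω)` to some vector field. -/
def MemH10 {d : ℕ} (Ω : Set (E d)) (u : E d → ℝ) : Prop :=
  MeasureTheory.MemLp u 2 (MeasureTheory.volume.restrict Ω) ∧
  ∃ g : E d → E d, MeasureTheory.MemLp g 2 (MeasureTheory.volume.restrict Ω) ∧
    ∃ φ : ℕ → E d → ℝ,
      (∀ k, ContDiff ℝ (⊤ : ℕ∞) (φ k) ∧ HasCompactSupport (φ k) ∧ tsupport (φ k) ⊆ Ω) ∧
      Filter.Tendsto (fun k => MeasureTheory.eLpNorm (fun x => φ k x - u x) 2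
        (MeasureTheory.volume.restrict Ω)) Filter.atTop (nhds 0) ∧
      Filter.Tendsto (fun k => MeasureTheory.eLpNorm (fun x => gradient (φ k) x - g x) 2
        (MeasureTheory.volume.restrict Ω)) Filter.atTop (nhds 0)

namespace Mesh

variable {d : ℕ} {Ω : Set (E d)}

/-- The finite element spaces: `V_𝒯^0` (discontinuous Galerkin) and
`V_𝒯^1 = V_𝒯^0 ∩ H^1_0(Ω)` (`C^0` interior penalty). -/
def V (T : Mesh Ω) (p : ℕ) (s : Fin 2) : Set T.PwPoly :=
  {v | v ∈ T.V0 p ∧ (s = 1 → MemH10 Ω (T.toFun v))}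

/-- `∫_Ω g` for a function `g` given elementwise, as the sum of the integrals over the elements. -/
def elemInt (T : Mesh Ω) (g : T.elems → E d → ℝ) : ℝ :=
  ∑ K : T.elems, ∫ x in hull K.1, g K x

/-- `∑_{F ∈ 𝒢} ∫_F g_F`. -/
def facesInt (𝒢 : Finset (Finset (E d))) (g : Finset (E d) → E d → ℝ) : ℝ :=
  ∑ F ∈ 𝒢, faceInt F (g F)

open Classical in
/-- `+1` if `n_F` is the outward normal to the element `K` on its face `F`, and `-1` if it is the
inward normal. -/
def side (n : Finset (E d) → E d) (F K : Finset (E d)) : ℝ :=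
  if ∀ x ∈ F, ∀ y ∈ K, dot (n F) (y - x) ≤ 0 then 1 else -1

/-- The jump on the face `F` of a piecewise polynomial: `v|_K - v|_{K'}` if `F` is shared by `K` and
`K'`, with `n_F` outward to `K` and inward to `K'`; `v|_K` on boundary faces. -/
def jump (T : Mesh Ω) (n : Finset (E d) → E d) (F : Finset (E d)) (v : T.PwPoly) : Poly d :=
  ∑ K ∈ T.adj F, MvPolynomial.C (side n F K.1) * v K

/-- The average on the face `F` of a piecewise polynomial: `(v|_K + v|_{K'})/2` on interior faces,
`v|_K` on boundary faces. -/
def avg (T : Mesh Ω) (F : Finset (E d)) (v : T.PwPoly) : Poly d :=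
  MvPolynomial.C (((T.adj F).card : ℝ)⁻¹) * ∑ K ∈ T.adj F, v K

/-! ### Norms -/

/-- The square of the jump seminorm `|v|_{J,𝒯}`. -/
def jumpSq (T : Mesh Ω) (n : Finset (E d) → E d) (v : T.PwPoly) : ℝ :=
  facesInt T.facetsI (fun F x =>
      (hFace F)⁻¹ * ∑ i, (ev (T.jump n F (fun K => gradP (v K) i)) x) ^ 2) +
    facesInt T.facets (fun F x => (hFace F ^ 3)⁻¹ * (ev (T.jump n F v) x) ^ 2)

/-- `∫_Ω |∇²v|²`. -/
def hessSq (T : Mesh Ω) (v : T.PwPoly) : ℝ :=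
  T.elemInt (fun K x => ∑ i, ∑ j, (ev (hessP (v K) i j) x) ^ 2)

/-- The square of the norm `‖v‖_𝒯`. -/
def normSq (T : Mesh Ω) (n : Finset (E d) → E d) (v : T.PwPoly) : ℝ :=
  T.elemInt (fun K x => (∑ i, ∑ j, (ev (hessP (v K) i j) x) ^ 2) +
    (∑ i, (ev (gradP (v K) i) x) ^ 2) + (ev (v K) x) ^ 2) + T.jumpSq n v

/-- `C` is a constant for which the discrete Poincaré--Friedrichs inequality holds on `V_𝒯^s`,
`s ∈ {0,1}`, with polynomial degree `p`. -/
def IsPoincareConst (T : Mesh Ω) (n : Finset (E d) → E d) (p : ℕ) (C : ℝ) : Prop :=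
  ∀ s : Fin 2, ∀ v ∈ T.V p s,
    Real.sqrt (T.normSq n v) ≤ C * Real.sqrt (T.hessSq v + T.jumpSq n v)

/-! ### The numerical method -/

open Classical in
/-- The lifting operator `r_𝒯^F`: `r_𝒯^F(w)` is the unique piecewise polynomial of degree at most `q`
with `∫_Ω r_𝒯^F(w) φ = ∫_F w {φ}` for all piecewise polynomials `φ` of degree at most `q`. -/
def lift (T : Mesh Ω) (q : ℕ) (F : Finset (E d)) (w : E d → ℝ) : T.PwPoly :=
  if h : ∃ r ∈ T.V0 q, ∀ φ ∈ T.V0 q,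
      T.elemInt (fun K x => ev (r K) x * ev (φ K) x) =
        faceInt F (fun x => w x * ev (T.avg F φ) x)
  then h.choose else 0

/-- `r_𝒯([∇v · n]) = ∑_{F ∈ ℱ^I} r_𝒯^F([∇v · n_F])`. -/
def liftTotal (T : Mesh Ω) (n : Finset (E d) → E d) (q : ℕ) (v : T.PwPoly) : T.PwPoly :=
  ∑ F ∈ T.facetsI, T.lift q F (ev (T.jump n F (fun K => normalD (n F) (v K))))

/-- `L_{λ,𝒯} v = Δv - χ r_𝒯([∇v · n]) - λ v`. -/
def discreteL (T : Mesh Ω) (n : Finset (E d) → E d) (q : ℕ) (χ lam : ℝ) (v : T.PwPoly)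
    (K : T.elems) (x : E d) : ℝ :=
  ev (lapP (v K)) x - χ * ev (T.liftTotal n q v K) x - lam * ev (v K) x

/-- The stabilization bilinear form `S_𝒯`. -/
def stab (T : Mesh Ω) (n : Finset (E d) → E d) (w v : T.PwPoly) : ℝ :=
  T.elemInt (fun K x => (∑ i, ∑ j, ev (hessP (w K) i j) x * ev (hessP (v K) i j) x) -
      ev (lapP (w K)) x * ev (lapP (v K)) x) -
    facesInt T.facets (fun F x =>
      (∑ i, ev (gradT (n F) (T.avg F (fun K => normalD (n F) (w K))) i) x *
        ev (T.jump n F (fun K => gradT (n F) (v K) i)) x) +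
      (∑ i, ev (gradT (n F) (T.avg F (fun K => normalD (n F) (v K))) i) x *
        ev (T.jump n F (fun K => gradT (n F) (w K) i)) x)) +
    facesInt T.facetsI (fun F x =>
      ev (T.avg F (fun K => lapT (n F) (w K))) x *
        ev (T.jump n F (fun K => normalD (n F) (v K))) x +
      ev (T.avg F (fun K => lapT (n F) (v K))) x *
        ev (T.jump n F (fun K => normalD (n F) (w K))) x)

/-- The jump penalization bilinear form `J_𝒯`. -/
def penal (T : Mesh Ω) (n : Finset (E d) → E d) (σ ρ : ℝ) (w v : T.PwPoly) : ℝ :=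
  facesInt T.facetsI (fun F x => σ * (hFace F)⁻¹ *
      ∑ i, ev (T.jump n F (fun K => gradP (w K) i)) x *
        ev (T.jump n F (fun K => gradP (v K) i)) x) +
    facesInt T.facetsB (fun F x => σ * (hFace F)⁻¹ *
      ∑ i, ev (T.jump n F (fun K => gradT (n F) (w K) i)) x *
        ev (T.jump n F (fun K => gradT (n F) (v K) i)) x) +
    facesInt T.facets (fun F x => ρ * (hFace F ^ 3)⁻¹ *
      (ev (T.jump n F w) x * ev (T.jump n F v) x))

/-- The elementwise value of the renormalized Isaacs operator `F_γ[w]`. -/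
def FgammaPw (T : Mesh Ω) {𝒜 ℬ : Type*} (D : Coefficients d 𝒜 ℬ) (lam : ℝ) (w : T.PwPoly)
    (K : T.elems) (x : E d) : ℝ :=
  D.Fgamma lam x (Matrix.of fun i j => ev (hessP (w K) i j) x)
    (WithLp.toLp 2 fun i => ev (gradP (w K) i) x) (ev (w K) x)

/-- The nonlinear form
`A_𝒯(w; v) = ∫_Ω F_γ[w] L_{λ,𝒯} v + θ S_𝒯(w, v) + J_𝒯(w, v)`. -/
def form (T : Mesh Ω) (n : Finset (E d) → E d) {𝒜 ℬ : Type*} (D : Coefficients d 𝒜 ℬ)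
    (lam θ χ σ ρ : ℝ) (q : ℕ) (w v : T.PwPoly) : ℝ :=
  T.elemInt (fun K x => T.FgammaPw D lam w K x * T.discreteL n q χ lam v K x) +
    θ * T.stab n w v + T.penal n σ ρ w v

/-- Strong monotonicity on `V_𝒯^s`, with constant `C > 0`, of a form `A`:
`C⁻¹ ‖w - v‖_𝒯² ≤ A(w; w - v) - A(v; w - v)`. -/
def StronglyMonotone (T : Mesh Ω) (n : Finset (E d) → E d) (p : ℕ) (s : Fin 2)
    (A : T.PwPoly → T.PwPoly → ℝ) (C : ℝ) : Prop :=
  0 < C ∧ ∀ w ∈ T.V p s, ∀ v ∈ T.V p s,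
    C⁻¹ * T.normSq n (w - v) ≤ A w (w - v) - A v (w - v)

end Mesh

/-- `μ = θ - (1 - ν) / (4 (1 - θ))`. -/
def muConst (ν θ : ℝ) : ℝ := θ - (1 - ν) / (4 * (1 - θ))

end IsaacsDG

end

open scoped BigOperators

noncomputable section

/-! Monotonicity. Put z = w - v, δ = F_γ[w] - F_γ[v], ℓ = Δz - λz and Q = |∇²z|² + 2λ|∇z|² + λ²z².
By the Cordes condition every renormalized linear operator, applied to z, differs from ℓ by at most
√((1-ν)Q). An inf-sup inherits such a bound, so (δ - ℓ)² ≤ (1-ν)Q pointwise (`sq_Fgamma_sub_le`).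
Completing a square gives δℓ ≥ θℓ² - (1-ν)/(4(1-θ)) Q = θℓ² - (θ-μ)Q (`le_mul_sub_of_sq_le`). The
volume part of θS turns θ∫ℓ² into θ∫Q up to 2λθ∫(|∇z|² + zΔz), and by the elementwise divergence
theorem this last integral consists of jump terms only. What remains is μ∫Q minus error terms. The
face terms pair an average with a jump, and the lifting is L²-stable in terms of the jumps. Discrete
trace and inverse inequalities bound the averages by volume terms, so Young's inequality leaves a
small multiple of μ∫Q and jumps that large σ, ρ absorb (`coercivity_arith`). The result is the lower
bound μ/2 (∫|∇²z|² + |z|_J²), and a Poincaré–Friedrichs constant C > 0 converts it into monotonicity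
with C_mon = 2C²/μ.

Poincaré–Friedrichs. With D = diam Ω and a ∈ Ω, the divergence theorem for v²(x₁-a₁)e₁ bounds ∫v² by
a multiple of D²∫|∇v|² plus jumps (`l2Sq_le`). For v∇v it bounds ∫|∇v|² by ε∫v² plus a multiple of
∫|∇²v|² and jumps (`gradSq_le`). A small ε closes the loop. Boundary values are part of the jumps,
so no boundary condition is required.

Tools. A simplex is a cone over each of its facets. Slicing parallel to the base gives the
divergence theorem for the fields P(x-v), v a vertex, and combinations of the x-v with weights of
sum zero produce all constant directions (`integral_directional`). The same cone identity yields the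
discrete trace inequality. The inverse inequality is equivalence of norms on the unit ball,
rescaled: shape-regularity puts each element between concentric balls of radii r and 4ϑr
(`exists_faceBounds`). Two different elements on the same side of a common facet would overlap, so
each facet is interior or boundary, with opposite orientations of the neighbours at an interior one
(`eq_of_side_eq`). -/

namespace IsaacsDG

open MeasureTheory

/-! ### Calculus of polynomials along curves. -/

section Calculus
variable {d : ℕ}

@[simp] lemma ev_add (P Q : Poly d) (x : E d) : ev (P + Q) x = ev P x + ev Q x := by simp [ev]
@[simp] lemma ev_sub (P Q : Poly d) (x : E d) : ev (P - Q) x = ev P x - ev Q x := by simp [ev]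
@[simp] lemma ev_mul (P Q : Poly d) (x : E d) : ev (P * Q) x = ev P x * ev Q x := by simp [ev]
@[simp] lemma ev_pow (P : Poly d) (k : ℕ) (x : E d) : ev (P ^ k) x = ev P x ^ k := by simp [ev]
@[simp] lemma ev_C (c : ℝ) (x : E d) : ev (MvPolynomial.C c) x = c := by simp [ev]
@[simp] lemma ev_X (i : Fin d) (x : E d) : ev (MvPolynomial.X i) x = x i := by simp [ev]
@[simp] lemma ev_zero (x : E d) : ev (0 : Poly d) x = 0 := by simp [ev]
@[simp] lemma ev_one (x : E d) : ev (1 : Poly d) x = 1 := by simp [ev]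
@[simp] lemma ev_sum {ι : Type*} (s : Finset ι) (P : ι → Poly d) (x : E d) :
    ev (∑ i ∈ s, P i) x = ∑ i ∈ s, ev (P i) x := by simp [ev]

@[fun_prop] lemma continuous_ev (P : Poly d) : Continuous (ev P) := by
  unfold ev
  exact (MvPolynomial.continuous_eval P).comp (by fun_prop)

@[simp] lemma pd_add (i : Fin d) (P Q : Poly d) : pd i (P + Q) = pd i P + pd i Q := map_add _ _ _
@[simp] lemma pd_sub (i : Fin d) (P Q : Poly d) : pd i (P - Q) = pd i P - pd i Q := map_sub _ _ _
@[simp] lemma pd_zero (i : Fin d) : pd i (0 : Poly d) = 0 := map_zero _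
@[simp] lemma pd_one (i : Fin d) : pd i (1 : Poly d) = 0 := by simp [pd]
@[simp] lemma pd_C (i : Fin d) (c : ℝ) : pd i (MvPolynomial.C c : Poly d) = 0 := by simp [pd]
@[simp] lemma pd_sum {ι : Type*} (i : Fin d) (s : Finset ι) (P : ι → Poly d) :
    pd i (∑ j ∈ s, P j) = ∑ j ∈ s, pd i (P j) := map_sum _ _ _
@[simp] lemma pd_mul (i : Fin d) (P Q : Poly d) : pd i (P * Q) = pd i P * Q + P * pd i Q := by
  simp [pd]; ring
@[simp] lemma pd_X (i j : Fin d) : pd i (MvPolynomial.X j : Poly d) = if i = j then 1 else 0 := by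
  simp [pd, MvPolynomial.pderiv_X, Pi.single_apply, eq_comm]
lemma pd_C_mul (i : Fin d) (c : ℝ) (P : Poly d) :
    pd i (MvPolynomial.C c * P) = MvPolynomial.C c * pd i P := by simp

lemma totalDegree_pd_le (i : Fin d) (P : Poly d) : (pd i P).totalDegree ≤ P.totalDegree := by
  conv_lhs => rw [P.as_sum]
  rw [pd_sum]
  refine MvPolynomial.totalDegree_finsetSum_le fun m hm => ?_
  rw [pd, MvPolynomial.pderiv_monomial]
  refine (MvPolynomial.totalDegree_monomial_le _ _).trans (le_trans ?_ (MvPolynomial.le_totalDegree hm))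
  exact Finsupp.degree_mono tsub_le_self

/-- Chain rule by induction on the polynomial; it supplies the fundamental theorem of calculus along
the rays of a cone. -/
lemma hasDerivAt_ev (P : Poly d) {γ : ℝ → E d} {γ' : E d} {t : ℝ}
    (h : ∀ i, HasDerivAt (fun s => γ s i) (γ' i) t) :
    HasDerivAt (fun s => ev P (γ s)) (∑ i, ev (pd i P) (γ t) * γ' i) t := by
  induction P using MvPolynomial.induction_on with
  | C a => simpa using hasDerivAt_const t a
  | add p q hp hq =>
    simp only [ev_add, pd_add, add_mul, Finset.sum_add_distrib]
    exact hp.add hq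
  | mul_X p k hp =>
    have := hp.mul (h k)
    simp only [ev_mul, ev_X, pd_mul, pd_X, ev_add]
    have heq : ∑ i, (ev (pd i p) (γ t) * γ t k + ev p (γ t) * ev (if i = k then 1 else 0) (γ t)) *
        γ' i = (∑ i, ev (pd i p) (γ t) * γ' i) * γ t k + ev p (γ t) * γ' k := by
      rw [Finset.sum_mul, Finset.sum_congr rfl fun i _ => add_mul _ _ _, Finset.sum_add_distrib]
      congr 1
      · exact Finset.sum_congr rfl fun i _ => by ring
      · rw [Finset.sum_eq_single k] <;> simp +contextual
    rw [heq]
    exact this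

end Calculus

lemma dot_eq_inner {d : ℕ} (x y : E d) : dot x y = inner ℝ x y := by
  simp [dot, PiLp.inner_apply, mul_comm]

/-! ### Volume of a cone by slices parallel to its base. -/

section Cone

variable {d : ℕ}

lemma dot_add_right (x y z : E d) : dot x (y + z) = dot x y + dot x z := by
  simp [dot_eq_inner, inner_add_right]
lemma dot_sub_right (x y z : E d) : dot x (y - z) = dot x y - dot x z := by
  simp [dot_eq_inner, inner_sub_right]
lemma dot_smul_right (x y : E d) (c : ℝ) : dot x (c • y) = c * dot x y := by
  simp [dot_eq_inner, inner_smul_right]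
@[fun_prop] lemma continuous_dot (x : E d) : Continuous (dot x) := by
  unfold dot; fun_prop

lemma convex_hyperplane_dot (n z : E d) (c : ℝ) : Convex ℝ {y : E d | dot n (y - z) = c} := by
  have : {y : E d | dot n (y - z) = c} = {y | dot n y = c + dot n z} := by
    ext y; simp [dot_sub_right, sub_eq_iff_eq_add]
  rw [this]
  exact convex_hyperplane ⟨fun x y => dot_add_right n x y, fun c x => dot_smul_right n x c⟩ _

lemma dot_hull_eq {F : Finset (E d)} {n z : E d} {c : ℝ} (h : ∀ x ∈ F, dot n (x - z) = c)
    {y : E d} (hy : y ∈ hull F) : dot n (y - z) = c :=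
  convexHull_min (s := (F : Set (E d))) (t := {y : E d | dot n (y - z) = c}) h
    (convex_hyperplane_dot n z c) hy

lemma isCompact_hull (F : Finset (E d)) : IsCompact (hull F) :=
  F.finite_toSet.isCompact_convexHull ℝ

lemma measurableSet_hull (F : Finset (E d)) : MeasurableSet (hull F) :=
  (isCompact_hull F).measurableSet

/-- The surface measure on the hull of `F`. -/
abbrev surf (F : Finset (E d)) : Measure (E d) :=
  (Measure.euclideanHausdorffMeasure (d - 1)).restrict (hull F)

/-- The data of a simplex seen as the cone over its facet `F` with apex `v`, of height `H` in the
direction of the unit vector `n`. -/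
structure IsCone (F : Finset (E d)) (v n : E d) (H : ℝ) : Prop where
  nonempty : F.Nonempty
  norm_eq : ‖n‖ = 1
  height_pos : 0 < H
  height : ∀ x ∈ F, dot n (x - v) = H

/-- The cone parametrization `(t, y) ↦ v + t (y - v)`. -/
def coneMap (v : E d) (z : ℝ × E d) : E d := AffineMap.homothety v z.1 z.2

lemma coneMap_apply (v : E d) (t : ℝ) (y : E d) : coneMap v (t, y) = v + t • (y - v) := by
  simp [coneMap, AffineMap.homothety_apply, add_comm]

@[fun_prop] lemma continuous_coneMap (v : E d) : Continuous (coneMap v) := by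
  have : coneMap v = fun z => v + z.1 • (z.2 - v) := by ext1 z; exact coneMap_apply v z.1 z.2
  rw [this]; fun_prop

variable {F : Finset (E d)} {v n : E d} {H : ℝ}

lemma mem_hull_insert [DecidableEq (E d)] (hF : F.Nonempty) {x : E d} :
    x ∈ hull (insert v F) ↔ ∃ t ∈ Set.Icc (0 : ℝ) 1, ∃ y ∈ hull F, x = coneMap v (t, y) := by
  have hF' : (F : Set (E d)).Nonempty := hF
  simp only [hull, Finset.coe_insert]
  rw [convexHull_insert hF']
  simp only [convexJoin_singleton_left, Set.mem_iUnion, segment_eq_image']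
  constructor
  · rintro ⟨y, hy, t, ht, rfl⟩
    exact ⟨t, ht, y, hy, (coneMap_apply v t y).symm⟩
  · rintro ⟨t, ht, y, hy, rfl⟩
    exact ⟨y, hy, t, ht, (coneMap_apply v t y).symm⟩

lemma IsCone.dot_coneMap (h : IsCone F v n H) {y : E d} (hy : y ∈ hull F) (t : ℝ) :
    dot n (coneMap v (t, y) - v) = t * H := by
  rw [coneMap_apply, add_sub_cancel_left, dot_smul_right, dot_hull_eq h.height hy]

/-- The slice at relative height t is the image of the base under the homothety of ratio t centred
at the apex, which scales (d-1)-dimensional measure by t^(d-1). The height `t * H` of a point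
determines its t, so slices outside (0,1] are empty, except the one through the apex, which is left
out. -/
lemma IsCone.section_measure [DecidableEq (E d)] (h : IsCone F v n H) (S : Set (E d)) {t : ℝ}
    (ht : t ≠ 0) :
    (Measure.euclideanHausdorffMeasure (d - 1) : Measure (E d))
      (S ∩ hull (insert v F) ∩ AffineSubspace.mk' (t • (H • n) +ᵥ v) (ℝ ∙ (H • n))ᗮ) =
    (Set.Ioc (0 : ℝ) 1).indicator (fun t => ENNReal.ofReal (t ^ (d - 1)) *
      surf F ((fun y => coneMap v (t, y)) ⁻¹' S)) t := by
  have hplane : ∀ x : E d, x ∈ (AffineSubspace.mk' (t • (H • n) +ᵥ v) (ℝ ∙ (H • n))ᗮ : Set (E d)) ↔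
      dot n (x - v) = t * H := by
    intro x
    rw [SetLike.mem_coe, AffineSubspace.mem_mk', Submodule.mem_orthogonal_singleton_iff_inner_right]
    have hnn : (inner ℝ n n : ℝ) = 1 := by rw [real_inner_self_eq_norm_sq, h.norm_eq]; norm_num
    have : (x -ᵥ (t • (H • n) +ᵥ v) : E d) = (x - v) - (t * H) • n := by
      simp only [vsub_eq_sub, vadd_eq_add, smul_smul]; abel
    rw [this, inner_smul_left, inner_sub_right, inner_smul_right, hnn, dot_eq_inner]
    have := h.height_pos.ne'
    simp only [conj_trivial, mul_one, mul_eq_zero, this, false_or]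
    constructor <;> intro h' <;> linarith
  by_cases ht1 : t ∈ Set.Ioc (0 : ℝ) 1
  · rw [Set.indicator_of_mem ht1, Measure.restrict_apply' (measurableSet_hull F)]
    have : S ∩ hull (insert v F) ∩ AffineSubspace.mk' (t • (H • n) +ᵥ v) (ℝ ∙ (H • n))ᗮ =
        AffineMap.homothety v t '' ((fun y => coneMap v (t, y)) ⁻¹' S ∩ hull F) := by
      ext x
      constructor
      · rintro ⟨⟨hxS, hxK⟩, hx⟩
        obtain ⟨s, hs, y, hy, rfl⟩ := (mem_hull_insert h.nonempty).1 hxK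
        have := (hplane _).1 hx
        rw [h.dot_coneMap hy] at this
        -- Positivity of the height makes the cone parameter of a point unique.
        obtain rfl : s = t := mul_right_cancel₀ h.height_pos.ne' this
        exact ⟨y, ⟨hxS, hy⟩, rfl⟩
      · rintro ⟨y, ⟨hyS, hy⟩, rfl⟩
        exact ⟨⟨hyS, (mem_hull_insert h.nonempty).2 ⟨t, ⟨ht1.1.le, ht1.2⟩, y, hy, rfl⟩⟩,
          (hplane _).2 (h.dot_coneMap hy t)⟩
    rw [this, euclideanHausdorffMeasure_homothety_image _ _ ht, ENNReal.smul_def, smul_eq_mul]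
    congr 1
    rw [ENNReal.ofReal_pow ht1.1.le, ENNReal.coe_pow, Real.nnnorm_of_nonneg ht1.1.le,
      ENNReal.ofReal_eq_coe_nnreal ht1.1.le]
  · rw [Set.indicator_of_notMem ht1]
    refine (congrArg _ ?_).trans measure_empty
    rw [Set.eq_empty_iff_forall_notMem]
    rintro x ⟨⟨-, hxK⟩, hx⟩
    obtain ⟨s, hs, y, hy, rfl⟩ := (mem_hull_insert h.nonempty).1 hxK
    have := (hplane _).1 hx
    rw [h.dot_coneMap hy] at this
    obtain rfl : s = t := mul_right_cancel₀ h.height_pos.ne' this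
    exact ht1 ⟨lt_of_le_of_ne hs.1 ht.symm, hs.2⟩

/-- The measure of a subset of a cone, by sections parallel to the base. -/
lemma IsCone.volume_inter [DecidableEq (E d)] (h : IsCone F v n H) {S : Set (E d)}
    (hS : MeasurableSet S) :
    volume (S ∩ hull (insert v F)) = ENNReal.ofReal H * ∫⁻ t in Set.Ioc (0 : ℝ) 1,
      ENNReal.ofReal (t ^ (d - 1)) * surf F ((fun y => coneMap v (t, y)) ⁻¹' S) := by
  have hn : n ≠ 0 := by
    intro h0; have := h.norm_eq; simp [h0] at this
  have hv : H • n ≠ 0 := smul_ne_zero h.height_pos.ne' hn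
  -- Slicing along the vector `H • n` rather than `n` makes t range over (0,1] and produces the
  -- factor H.
  have key := EuclideanGeometry.euclideanHausdorffMeasure_eq_lintegral (P := E d) v hv
    (hS.inter (measurableSet_hull (insert v F)))
  rw [finrank_euclideanSpace_fin, EuclideanSpace.euclideanHausdorffMeasure_eq_volume] at key
  rw [key, ← lintegral_indicator measurableSet_Ioc]
  congr 1
  · rw [enorm_smul, Real.enorm_of_nonneg h.height_pos.le, ← ofReal_norm, h.norm_eq]; simp
  · refine lintegral_congr_ae ?_
    filter_upwards [Measure.ae_ne volume (0 : ℝ)] with t ht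
    exact h.section_measure S ht

/-- If the base had infinite measure, the slicing formula would give infinite volume to the compact
cone. -/
lemma IsCone.measure_lt_top [DecidableEq (E d)] (h : IsCone F v n H) :
    (Measure.euclideanHausdorffMeasure (d - 1) : Measure (E d)) (hull F) < ⊤ := by
  have key := h.volume_inter MeasurableSet.univ
  simp only [Set.univ_inter, Set.preimage_univ, Measure.restrict_apply MeasurableSet.univ] at key
  rw [lintegral_mul_const _ (by fun_prop)] at key
  have hK : volume (hull (insert v F)) < ⊤ := (isCompact_hull _).measure_lt_top
  by_contra htop
  rw [not_lt, top_le_iff] at htop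
  rw [key, htop, ENNReal.mul_top, ENNReal.mul_top] at hK
  · exact lt_irrefl _ hK
  · simpa using h.height_pos
  · rw [← pos_iff_ne_zero, lintegral_pos_iff_support (by fun_prop)]
    refine lt_of_lt_of_le ?_ (measure_mono (s := Set.Ioc (0:ℝ) 1) ?_)
    · rw [Measure.restrict_apply' measurableSet_Ioc]; simp
    · intro t ht
      simp [pow_pos ht.1]

/-- The product measure that is pushed forward to the volume on the cone. -/
def coneMeasure (F : Finset (E d)) (H : ℝ) : Measure (ℝ × E d) :=
  ((volume.restrict (Set.Ioc (0 : ℝ) 1)).withDensity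
    fun t => ENNReal.ofReal (H * t ^ (d - 1))).prod (surf F)

/-- The slicing formula, read as an identity of measures, so that integrals over the cone become
integrals over a product. -/
lemma IsCone.map_coneMeasure [DecidableEq (E d)] (h : IsCone F v n H) :
    (coneMeasure F H).map (coneMap v) = volume.restrict (hull (insert v F)) := by
  have : IsFiniteMeasure (surf F) := ⟨by simpa using h.measure_lt_top⟩
  ext S hS
  rw [Measure.map_apply (continuous_coneMap v).measurable hS, Measure.restrict_apply hS,
    h.volume_inter hS, coneMeasure,
    Measure.prod_apply ((continuous_coneMap v).measurable hS),
    lintegral_withDensity_eq_lintegral_mul _ (by fun_prop)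
      (measurable_measure_prodMk_left ((continuous_coneMap v).measurable hS)),
    ← lintegral_const_mul']
  · refine setLIntegral_congr_fun measurableSet_Ioc fun t ht => ?_
    simp only [Pi.mul_apply]
    rw [ENNReal.ofReal_mul h.height_pos.le, mul_assoc]
    rfl
  · exact ENNReal.ofReal_ne_top

end Cone

/-! ### Integration over a cone and the divergence theorem for radial fields. -/

section ConeIntegral

variable {d : ℕ} {F : Finset (E d)} {v n : E d} {H : ℝ}

lemma IsCone.integral_eq [DecidableEq (E d)] (h : IsCone F v n H) {g : E d → ℝ}
    (hg : Continuous g) :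
    ∫ x in hull (insert v F), g x =
      ∫ y, ∫ t in (0 : ℝ)..1, H * t ^ (d - 1) * g (coneMap v (t, y)) ∂(volume) ∂(surf F) := by
  have : IsFiniteMeasure (surf F) := ⟨by simpa using h.measure_lt_top⟩
  have hgK : Integrable g (volume.restrict (hull (insert v F))) :=
    hg.continuousOn.integrableOn_compact (isCompact_hull _)
  rw [← h.map_coneMeasure] at hgK ⊢
  have hm := (continuous_coneMap v).measurable
  rw [integral_map hm.aemeasurable hg.aestronglyMeasurable]
  have hi := (integrable_map_measure hg.aestronglyMeasurable hm.aemeasurable).1 hgK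
  rw [coneMeasure] at hi ⊢
  refine (integral_prod_symm _ hi).trans ?_
  refine integral_congr_ae (Filter.Eventually.of_forall fun y => ?_)
  simp only [Function.comp_apply]
  rw [integral_withDensity_eq_integral_toReal_smul (by fun_prop)
    (Filter.Eventually.of_forall fun t => ENNReal.ofReal_lt_top),
    intervalIntegral.integral_of_le zero_le_one]
  refine setIntegral_congr_fun measurableSet_Ioc fun t ht => ?_
  have : 0 ≤ H * t ^ (d - 1) := mul_nonneg h.height_pos.le (pow_nonneg ht.1.le _)
  simp [ENNReal.toReal_ofReal this]

/-- The divergence theorem on a simplex for the vector field `Q (x - v)`, where `v` is the vertex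
opposite to the facet `F`. -/
lemma IsCone.height_mul_faceInt [DecidableEq (E d)] (h : IsCone F v n H) (hd : 1 ≤ d)
    (Q : Poly d) :
    H * faceInt F (ev Q) = ∫ x in hull (insert v F),
      (d * ev Q x + ∑ i, ev (pd i Q) x * (x i - v i)) := by
  rw [h.integral_eq (by fun_prop), faceInt, ← integral_const_mul]
  refine integral_congr_ae (Filter.Eventually.of_forall fun y => ?_)
  -- Since x - v = t (y - v) on the ray through y, the integrand is the t-derivative of H t^d Q(v +
  -- t(y - v)). Its value is H Q(y) at t = 1, and 0 at t = 0 because d ≥ 1.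
  have hder : ∀ t ∈ Set.uIcc (0 : ℝ) 1,
      HasDerivAt (fun s => H * (s ^ d * ev Q (coneMap v (s, y))))
        (H * t ^ (d - 1) * (d * ev Q (coneMap v (t, y)) +
          ∑ i, ev (pd i Q) (coneMap v (t, y)) * (coneMap v (t, y) i - v i))) t := by
    intro t _
    have h1 : ∀ i, HasDerivAt (fun s => coneMap v (s, y) i) ((y - v) i) t := by
      intro i
      simp only [coneMap_apply, PiLp.add_apply, PiLp.smul_apply, PiLp.sub_apply, smul_eq_mul]
      simpa using ((hasDerivAt_id t).mul_const (y i - v i)).const_add (v i)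
    refine (((hasDerivAt_pow d t).mul (hasDerivAt_ev Q h1)).const_mul H).congr_deriv ?_
    have ht : t ^ d = t ^ (d - 1) * t := by rw [← pow_succ, Nat.sub_add_cancel hd]
    have hs : ∑ i, ev (pd i Q) (coneMap v (t, y)) * (coneMap v (t, y) i - v i) =
        t * ∑ i, ev (pd i Q) (coneMap v (t, y)) * (y - v) i := by
      rw [Finset.mul_sum]
      refine Finset.sum_congr rfl fun i _ => ?_
      simp only [coneMap_apply, PiLp.add_apply, PiLp.smul_apply, PiLp.sub_apply, smul_eq_mul]
      ring
    rw [ht, hs]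
    ring
  symm
  beta_reduce
  rw [intervalIntegral.integral_eq_sub_of_hasDerivAt hder]
  · have : d ≠ 0 := by omega
    simp [this, coneMap_apply]
  · apply Continuous.intervalIntegrable
    fun_prop

end ConeIntegral

/-! ### Geometry of simplices and the divergence theorem on them. -/

section Simplex

variable {d : ℕ}

lemma vectorSpan_simplex_eq_top {K : Finset (E d)}
    (hK : AffineIndependent ℝ ((↑) : K → E d)) (hcard : K.card = d + 1) :
    vectorSpan ℝ (K : Set (E d)) = ⊤ := by
  have := hK.vectorSpan_eq_top_of_card_eq_finrank_add_one (by simp [hcard])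
  simpa using this

/-- Constant vectors are combinations with constant coefficients of the fields `x - v`,
where `v` ranges over the vertices. -/
lemma exists_weights_simplex {K : Finset (E d)}
    (hK : AffineIndependent ℝ ((↑) : K → E d)) (hcard : K.card = d + 1) (e : E d) :
    ∃ c : E d → ℝ, ∑ v ∈ K, c v = 0 ∧ ∑ v ∈ K, c v • v = -e := by
  classical
  have hmem : -e ∈ vectorSpan ℝ (Set.range ((↑) : K → E d)) := by
    have := vectorSpan_simplex_eq_top hK hcard
    have h2 : Set.range ((↑) : K → E d) = (K : Set (E d)) := by simp
    rw [h2, this]; trivial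
  obtain ⟨s, w, hw, hwe⟩ := (mem_vectorSpan_iff_eq_weightedVSub ℝ).1 hmem
  rw [Finset.weightedVSub_eq_linear_combination _ hw] at hwe
  refine ⟨fun v => if h : v ∈ K then (if ⟨v, h⟩ ∈ s then w ⟨v, h⟩ else 0) else 0, ?_, ?_⟩
  · rw [← Finset.sum_coe_sort]
    simpa [-Finset.univ_eq_attach] using hw
  · rw [hwe, ← Finset.sum_coe_sort]
    simp [ite_smul, -Finset.univ_eq_attach]

/-- For each vertex, the outward normal and the height of the opposite facet. -/
def IsSimplexData [DecidableEq (E d)] (K : Finset (E d)) (ν : E d → E d) (H : E d → ℝ) : Prop :=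
  ∀ v ∈ K, IsCone (K.erase v) v (ν v) (H v)

/-- The divergence theorem on a simplex, for a constant direction `e`. -/
lemma integral_directional [DecidableEq (E d)] {K : Finset (E d)}
    (hK : AffineIndependent ℝ ((↑) : K → E d)) (hcard : K.card = d + 1) (hd : 1 ≤ d)
    {ν : E d → E d} {H : E d → ℝ} (h : IsSimplexData K ν H) (e : E d) (P : Poly d) :
    ∫ x in hull K, ∑ i, ev (pd i P) x * e i =
      ∑ v ∈ K, dot (ν v) e * faceInt (K.erase v) (ev P) := by
  obtain ⟨c, hc0, hce⟩ := exists_weights_simplex hK hcard e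
  -- Because the weights sum to zero, e is the combination of the v - w with weights c_w. All w ≠ v
  -- contribute the same -H_v, and their weights sum to -c_v.
  have hdot : ∀ v ∈ K, dot (ν v) e = c v * H v := by
    intro v hv
    have h1 : e = ∑ w ∈ K, c w • (v - w) := by
      simp only [smul_sub, Finset.sum_sub_distrib, ← Finset.sum_smul, hc0, hce]; simp
    have h2 : dot (ν v) e = ∑ w ∈ K, c w * dot (ν v) (v - w) := by
      conv_lhs => rw [h1, dot_eq_inner, inner_sum]
      simp [inner_smul_right, dot_eq_inner]
    have h3 : ∑ w ∈ K, c w * dot (ν v) (v - w) = ∑ w ∈ K.erase v, c w * (-H v) := by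
      rw [← Finset.add_sum_erase _ _ hv]
      have : dot (ν v) (v - v) = 0 := by simp [dot]
      rw [this, mul_zero, zero_add]
      refine Finset.sum_congr rfl fun w hw => ?_
      have := (h v hv).height w hw
      rw [dot_sub_right] at this ⊢
      rw [← this]; ring
    rw [h2, h3, ← Finset.sum_mul]
    have := Finset.add_sum_erase K c hv
    rw [hc0] at this
    linear_combination (-H v) * this
  have hint : ∀ v ∈ K, Integrable (fun x => c v * (d * ev P x + ∑ i, ev (pd i P) x * (x i - v i)))
      (volume.restrict (hull K)) := fun v _ =>
    (Continuous.continuousOn (by fun_prop)).integrableOn_compact (isCompact_hull _)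
  have h4 : ∀ v ∈ K, dot (ν v) e * faceInt (K.erase v) (ev P) =
      ∫ x in hull K, c v * (d * ev P x + ∑ i, ev (pd i P) x * (x i - v i)) := by
    intro v hv
    have := (h v hv).height_mul_faceInt hd P
    rw [Finset.insert_erase hv] at this
    rw [hdot v hv, mul_assoc, this, integral_const_mul]
  rw [Finset.sum_congr rfl h4, ← integral_finsetSum _ hint]
  refine integral_congr_ae (Filter.Eventually.of_forall fun x => ?_)
  beta_reduce
  -- In the weighted sum of the fields dP + ∇P·(x - v), zero total weight removes dP and the terms
  -- in x; only ∇P·e survives.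
  have hei : ∀ i, ∑ v ∈ K, c v * v i = - e i := by
    intro i
    have := congrArg (fun y : E d => y i) hce
    simpa using this
  simp only [mul_add, Finset.sum_add_distrib, ← Finset.sum_mul, hc0, zero_mul, zero_add]
  simp only [Finset.mul_sum]
  rw [Finset.sum_comm]
  refine Finset.sum_congr rfl fun i _ => ?_
  have : ∀ v ∈ K, c v * (ev (pd i P) x * (x i - v i)) =
      c v * (ev (pd i P) x * x i) - (c v * v i) * ev (pd i P) x := fun v _ => by ring
  rw [Finset.sum_congr rfl this, Finset.sum_sub_distrib, ← Finset.sum_mul, ← Finset.sum_mul, hc0,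
    hei]
  ring

/-- The height cannot vanish: otherwise n would be orthogonal to the span of all edges, which is the
whole space, hence to itself. -/
lemma exists_height [DecidableEq (E d)] {K : Finset (E d)}
    (hK : AffineIndependent ℝ ((↑) : K → E d)) (hcard : K.card = d + 1) (hd : 1 ≤ d)
    {v : E d} (hv : v ∈ K) {n : E d} (hn : ‖n‖ = 1)
    (horth : ∀ x ∈ K.erase v, ∀ y ∈ K.erase v, dot n (y - x) = 0) :
    ∃ h : ℝ, h ≠ 0 ∧ (K.erase v).Nonempty ∧ ∀ x ∈ K.erase v, dot n (x - v) = h := by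
  have hne : (K.erase v).Nonempty := by
    rw [← Finset.card_pos, Finset.card_erase_of_mem hv]; omega
  obtain ⟨x₀, hx₀⟩ := hne
  have hall : ∀ x ∈ K.erase v, dot n (x - v) = dot n (x₀ - v) := by
    intro x hx
    have := horth x₀ hx₀ x hx
    simp only [dot_sub_right] at this ⊢
    linarith
  refine ⟨dot n (x₀ - v), fun h0 => ?_, ⟨x₀, hx₀⟩, hall⟩
  have hzero : vectorSpan ℝ (K : Set (E d)) ≤ (innerSL ℝ n).toLinearMap.ker := by
    rw [vectorSpan_eq_span_vsub_set_right ℝ (Finset.mem_coe.2 hv), Submodule.span_le]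
    rintro _ ⟨x, hx, rfl⟩
    change inner ℝ n (x - v) = 0
    rw [← dot_eq_inner]
    by_cases hxv : x = v
    · simp [hxv, dot]
    · rw [hall x (Finset.mem_erase.2 ⟨hxv, hx⟩), h0]
  rw [vectorSpan_simplex_eq_top hK hcard] at hzero
  have : inner ℝ n n = (0 : ℝ) := hzero (Submodule.mem_top (x := n))
  rw [real_inner_self_eq_norm_sq, hn] at this
  norm_num at this

/-- A ball inside a cone has diameter at most the height. -/
lemma IsCone.two_mul_radius_le [DecidableEq (E d)] {F : Finset (E d)} {v n : E d} {H : ℝ}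
    (h : IsCone F v n H) {z : E d} {r : ℝ} (hr : 0 ≤ r)
    (hball : Metric.closedBall z r ⊆ hull (insert v F)) : 2 * r ≤ H := by
  have hslab : ∀ x ∈ hull (insert v F), 0 ≤ dot n (x - v) ∧ dot n (x - v) ≤ H := by
    intro x hx
    obtain ⟨t, ht, y, hy, rfl⟩ := (mem_hull_insert h.nonempty).1 hx
    rw [h.dot_coneMap hy]
    exact ⟨mul_nonneg ht.1 h.height_pos.le, mul_le_of_le_one_left h.height_pos.le ht.2⟩
  have hnn : dot n n = 1 := by
    rw [dot_eq_inner, real_inner_self_eq_norm_sq, h.norm_eq]; norm_num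
  -- The two ends of the diameter of the ball in the direction n lie in the slab between apex and
  -- base.
  have hn1 : z + r • n ∈ Metric.closedBall z r := by
    simp [norm_smul, h.norm_eq, abs_of_nonneg hr]
  have hn2 : z + (-r) • n ∈ Metric.closedBall z r := by
    simp [norm_smul, h.norm_eq, abs_of_nonneg hr]
  have h1 := (hslab _ (hball hn1)).2
  have h2 := (hslab _ (hball hn2)).1
  simp only [dot_sub_right, dot_add_right, dot_smul_right, hnn] at h1 h2
  linarith

/-- Two simplices on the same side of a common facet overlap outside this facet. -/
lemma exists_mem_inter_of_same_side [DecidableEq (E d)] {F : Finset (E d)} {v v' n : E d}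
    {H H' : ℝ} (h : IsCone F v n H) (h' : IsCone F v' n H')
    (hind : AffineIndependent ℝ (fun x : (insert v' F : Finset (E d)) => (x : E d)))
    (hcard : (insert v' F).card = d + 1) :
    ∃ x ∈ hull (insert v F) ∩ hull (insert v' F), x ∉ hull F := by
  set K' := insert v' F with hK'
  have hspan : affineSpan ℝ (Set.range (fun x : K' => (x : E d))) = ⊤ :=
    (hind.affineSpan_eq_top_iff_card_eq_finrank_add_one).2 (by simp [hcard])
  let b : AffineBasis K' ℝ (E d) := ⟨fun x => (x : E d), hind, hspan⟩
  have hv'K : v' ∈ K' := Finset.mem_insert_self _ _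
  have hFK : ∀ f ∈ F, f ∈ K' := fun f hf => Finset.mem_insert_of_mem hf
  have hv'F : v' ∉ F := by
    intro hmem
    have := h'.height v' hmem
    have h0 : dot n (v' - v') = 0 := by simp [dot]
    linarith [h'.height_pos]
  have hbhull : ∀ x, x ∈ hull K' ↔ ∀ i, 0 ≤ b.coord i x := by
    intro x
    have hr : Set.range b = (K' : Set (E d)) := by
      change Set.range ((↑) : K' → E d) = _
      simp
    rw [hull, ← hr, b.convexHull_eq_nonneg_coord]; rfl
  -- Compare the height of v with that of v': only the coordinate at v' affects the height. Being on
  -- the same side makes this coordinate positive.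
  have hcoordv : b.coord ⟨v', hv'K⟩ v = H / H' := by
    have hx := b.linear_combination_coord_eq_self v
    have hs := b.sum_coord_apply_eq_one v
    have h1 : dot n (v - v') = ∑ i, b.coord i v * dot n ((i : E d) - v') := by
      have : v - v' = ∑ i, b.coord i v • ((i : E d) - v') := by
        simp only [smul_sub, Finset.sum_sub_distrib, ← Finset.sum_smul, hs, one_smul]
        congr 1
        exact hx.symm
      conv_lhs => rw [this, dot_eq_inner, inner_sum]
      simp [inner_smul_right, dot_eq_inner]
    have h2 : ∀ i : K', i ≠ ⟨v', hv'K⟩ → dot n ((i : E d) - v') = H' := by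
      rintro ⟨i, hi⟩ hne
      have : i ≠ v' := fun h => hne (Subtype.ext h)
      exact h'.height i (Finset.mem_of_mem_insert_of_ne hi this)
    rw [← Finset.add_sum_erase _ _ (Finset.mem_univ ⟨v', hv'K⟩)] at h1 hs
    have h00 : dot n (v' - v') = 0 := by simp [dot]
    rw [h00, mul_zero, zero_add, Finset.sum_congr rfl
      (fun i hi => by rw [h2 i (Finset.ne_of_mem_erase hi)]), ← Finset.sum_mul] at h1
    obtain ⟨x₀, hx₀⟩ := h.nonempty
    have h3 := h.height x₀ hx₀
    have h4 := h'.height x₀ hx₀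
    simp only [dot_sub_right] at h1 h3 h4
    rw [eq_div_iff h'.height_pos.ne']
    have h5 := congrArg (· * H') hs
    simp only [add_mul] at h5
    linarith
  have hcpos : (0 : ℝ) < F.card := by exact_mod_cast h.nonempty.card_pos
  -- The centroid of F has positive coordinates at the vertices of F and coordinate 0 at v'. A small
  -- move from it towards v keeps the former positive and makes the latter ε H / H', so the point
  -- stays in the second simplex.
  set c : E d := F.centroid ℝ id with hc
  have hcF : c ∈ hull F := F.centroid_mem_convexHull h.nonempty
  have hcc : ∀ i, b.coord i c = ∑ j ∈ F, (F.card : ℝ)⁻¹ * b.coord i j := by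
    intro i
    have hw : ∑ j ∈ F, F.centroidWeights ℝ j = 1 :=
      F.sum_centroidWeights_eq_one_of_nonempty ℝ h.nonempty
    rw [hc, Finset.centroid_def, Finset.map_affineCombination _ _ _ hw,
      Finset.affineCombination_eq_linear_combination _ _ _ hw]
    simp [Finset.centroidWeights]
  have hcoordF : ∀ i : K', ∀ j : K', b.coord i (j : E d) = if i = j then 1 else 0 :=
    fun i j => b.coord_apply i j
  have hcpos' : ∀ i : K', (i : E d) ∈ F → 0 < b.coord i c := by
    intro i hi
    rw [hcc]
    refine Finset.sum_pos' (fun j hj => ?_) ⟨i, hi, ?_⟩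
    · have := hcoordF i ⟨j, hFK j hj⟩
      simp only at this
      rw [this]; split_ifs <;> positivity
    · rw [hcoordF i i]; simp [hcpos]
  have hline : ∀ (i : K') (ε : ℝ), b.coord i (AffineMap.lineMap c v ε) =
      (1 - ε) * b.coord i c + ε * b.coord i v := by
    intro i ε
    rw [AffineMap.apply_lineMap, AffineMap.lineMap_apply]
    simp; ring
  have hcv' : b.coord ⟨v', hv'K⟩ c = 0 := by
    rw [hcc]
    refine Finset.sum_eq_zero fun j hj => ?_
    have := hcoordF ⟨v', hv'K⟩ ⟨j, hFK j hj⟩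
    simp only [Subtype.mk.injEq] at this
    rw [this, if_neg (by rintro rfl; exact hv'F hj), mul_zero]
  have hev : ∀ i : K', ∀ᶠ ε in nhdsWithin (0 : ℝ) (Set.Ioi 0),
      0 ≤ b.coord i (AffineMap.lineMap c v ε) := by
    intro i
    by_cases hi : (i : E d) ∈ F
    · have hcont : Filter.Tendsto (fun ε : ℝ => (1 - ε) * b.coord i c + ε * b.coord i v)
          (nhdsWithin 0 (Set.Ioi 0)) (nhds ((1 - 0) * b.coord i c + 0 * b.coord i v)) :=
        ((by fun_prop : Continuous fun ε : ℝ => (1 - ε) * b.coord i c + ε * b.coord i v).tendsto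
          0).mono_left nhdsWithin_le_nhds
      have hp : 0 < (1 - 0) * b.coord i c + 0 * b.coord i v := by
        have := hcpos' i hi; linarith
      filter_upwards [hcont.eventually (lt_mem_nhds hp)] with ε hε
      rw [hline]; exact hε.le
    · have hiv : i = ⟨v', hv'K⟩ := by
        refine Subtype.ext ?_
        rcases Finset.mem_insert.1 i.2 with h0 | h0
        · exact h0
        · exact absurd h0 hi
      filter_upwards [self_mem_nhdsWithin] with ε hε
      rw [hline, hiv, hcv', hcoordv]
      have := h.height_pos
      have := h'.height_pos
      have : (0 : ℝ) < ε := hε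
      have : 0 ≤ ε * (H / H') := by positivity
      linarith
  have hsmall : ∀ᶠ ε in nhdsWithin (0 : ℝ) (Set.Ioi 0), ε < 1 :=
    nhdsWithin_le_nhds (gt_mem_nhds one_pos)
  obtain ⟨ε, hε, hε1, hε0⟩ := ((Filter.eventually_all.2 hev).and
    (hsmall.and self_mem_nhdsWithin)).exists
  have hε0 : (0 : ℝ) < ε := hε0
  refine ⟨AffineMap.lineMap c v ε, ⟨?_, (hbhull _).2 hε⟩, fun hmem => ?_⟩
  · rw [mem_hull_insert h.nonempty]
    refine ⟨1 - ε, ⟨by linarith, by linarith⟩, c, hcF, ?_⟩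
    rw [coneMap_apply, AffineMap.lineMap_apply]
    simp only [vsub_eq_sub, vadd_eq_add]
    module
  -- The moved point has height (1 - ε) H above v, whereas points of the facet have height H.
  · have h1 := dot_hull_eq h.height hmem
    have h2 := dot_hull_eq h.height hcF
    rw [AffineMap.lineMap_apply] at h1
    simp only [vsub_eq_sub, vadd_eq_add, dot_sub_right, dot_add_right, dot_smul_right] at h1 h2
    have h3 : ε * H = 0 := by rw [← h2]; linarith
    have := h.height_pos
    have : 0 < ε * H := by positivity
    linarith

end Simplex

/-! ### Elements and facets of a mesh, orientation, and the elementwise divergence theorem. -/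

namespace Mesh

variable {d : ℕ} {Ω : Set (E d)} (T : Mesh Ω) {n : Finset (E d) → E d}

lemma mem_elems {K : Finset (E d)} : K ∈ T.elems ↔ K ∈ T.faces ∧ K.card = d + 1 := by
  classical
  simp [elems]

lemma mem_facets {F : Finset (E d)} : F ∈ T.facets ↔ F ∈ T.faces ∧ F.card = d := by
  classical
  simp [facets]

lemma mem_adj {F : Finset (E d)} {K : T.elems} : K ∈ T.adj F ↔ F ⊆ K.1 := by
  classical
  simp [adj]

lemma affineIndependent_elem (K : T.elems) : AffineIndependent ℝ ((↑) : K.1 → E d) :=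
  T.indep (T.mem_elems.1 K.2).1

lemma card_elem (K : T.elems) : K.1.card = d + 1 := (T.mem_elems.1 K.2).2

lemma hull_subset_closure (K : T.elems) : hull K.1 ⊆ closure Ω := by
  rw [← T.space_eq]
  exact T.convexHull_subset_space (T.mem_elems.1 K.2).1

lemma erase_mem_facets [DecidableEq (E d)] (hd : 1 ≤ d) (K : T.elems) {v : E d} (hv : v ∈ K.1) :
    K.1.erase v ∈ T.facets := by
  have hc : (K.1.erase v).card = d := by rw [Finset.card_erase_of_mem hv, T.card_elem]; simp
  refine T.mem_facets.2 ⟨T.down_closed (T.mem_elems.1 K.2).1 (Finset.erase_subset _ _) ?_, hc⟩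
  rw [← Finset.card_pos]; omega

lemma exists_eq_erase [DecidableEq (E d)] {F : Finset (E d)} (hF : F ∈ T.facets) {K : T.elems}
    (hK : K ∈ T.adj F) : ∃ v ∈ K.1, F = K.1.erase v := by
  have hsub := T.mem_adj.1 hK
  have hc : (K.1 \ F).card = 1 := by
    rw [Finset.card_sdiff_of_subset hsub, T.card_elem, (T.mem_facets.1 hF).2]; simp
  obtain ⟨v, hv⟩ := Finset.card_eq_one.1 hc
  refine ⟨v, ?_, ?_⟩
  · have : v ∈ K.1 \ F := by simp [hv]
    exact (Finset.mem_sdiff.1 this).1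
  · rw [Finset.erase_eq, ← hv, Finset.sdiff_sdiff_eq_self hsub]

variable {T}

lemma side_eq_or (F K : Finset (E d)) : side n F K = 1 ∨ side n F K = -1 := by
  unfold side; split_ifs <;> simp

/-- The sign `side` is exactly what turns the fixed normal of the facet into the outward normal of
the element, so the height from the opposite vertex becomes positive. -/
lemma IsNormalField.isCone [DecidableEq (E d)] (hn : T.IsNormalField n) (hd : 1 ≤ d)
    {K : T.elems} {v : E d} (hv : v ∈ K.1) :
    ∃ H, IsCone (K.1.erase v) v (side n (K.1.erase v) K.1 • n (K.1.erase v)) H := by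
  have hF := T.erase_mem_facets hd K hv
  obtain ⟨h, h0, hne, hall⟩ := exists_height (T.affineIndependent_elem K) (T.card_elem K) hd hv
    (hn.norm_eq_one _ hF) (hn.orthogonal _ hF)
  have hdots : ∀ c : ℝ, ∀ x : E d, dot (c • n (K.1.erase v)) x = c * dot (n (K.1.erase v)) x := by
    intro c x; simp [dot_eq_inner, inner_smul_left]
  have key : ∀ x ∈ K.1.erase v, ∀ y ∈ K.1, dot (n (K.1.erase v)) (y - x) = 0 ∨
      (y = v ∧ dot (n (K.1.erase v)) (y - x) = -h) := by
    intro x hx y hy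
    by_cases hyv : y = v
    · right
      refine ⟨hyv, ?_⟩
      rw [hyv, ← hall x hx, dot_sub_right, dot_sub_right]; ring
    · left
      exact hn.orthogonal _ hF x hx y (Finset.mem_erase.2 ⟨hyv, hy⟩)
  refine ⟨|h|, hne, ?_, abs_pos.2 h0, fun x hx => ?_⟩
  · rw [norm_smul, hn.norm_eq_one _ hF]
    rcases side_eq_or (n := n) (K.1.erase v) K.1 with h | h <;> rw [h] <;> norm_num
  · rw [hdots, hall x hx]
    unfold side
    rcases lt_or_gt_of_ne h0 with hneg | hpos
    · rw [if_neg, abs_of_neg hneg]; · ring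
      intro hc
      obtain ⟨x, hx⟩ := hne
      have h1 := hc x hx v hv
      have h2 := hall x hx
      rw [dot_sub_right] at h1 h2
      linarith
    · rw [if_pos, abs_of_pos hpos]; · ring
      intro x hx y hy
      rcases key x hx y hy with h1 | ⟨-, h1⟩ <;> rw [h1]
      linarith

lemma IsNormalField.isCone_facet [DecidableEq (E d)] (hn : T.IsNormalField n) (hd : 1 ≤ d)
    {F : Finset (E d)} (hF : F ∈ T.facets) {K : T.elems} (hK : K ∈ T.adj F) :
    ∃ v H, IsCone F v (side n F K.1 • n F) H ∧ K.1 = insert v F := by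
  obtain ⟨v, hv, rfl⟩ := T.exists_eq_erase hF hK
  obtain ⟨H, hH⟩ := hn.isCone hd hv
  exact ⟨v, H, hH, (Finset.insert_erase hv).symm⟩

/-- Two elements on the same side share a point off the facet. In a simplicial complex their
intersection lies in the hull of the common vertices, and for different elements these all belong to
the facet. -/
lemma IsNormalField.eq_of_side_eq (hn : T.IsNormalField n) (hd : 1 ≤ d)
    {F : Finset (E d)} (hF : F ∈ T.facets) {K K' : T.elems} (hK : K ∈ T.adj F)
    (hK' : K' ∈ T.adj F) (h : side n F K.1 = side n F K'.1) : K = K' := by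
  classical
  obtain ⟨v, H, hc, hv⟩ := hn.isCone_facet hd hF hK
  obtain ⟨v', H', hc', hv'⟩ := hn.isCone_facet hd hF hK'
  rw [← h] at hc'
  by_contra hne
  have hne' : K.1 ≠ K'.1 := fun h => hne (Subtype.ext h)
  have hind := T.affineIndependent_elem K'
  have hcard := T.card_elem K'
  obtain ⟨x, ⟨hx1, hx2⟩, hxF⟩ :=
    exists_mem_inter_of_same_side hc hc' (by rw [← hv']; exact hind) (by rw [← hv']; exact hcard)
  rw [← hv] at hx1
  rw [← hv'] at hx2
  have hx := T.inter_subset_convexHull (T.mem_elems.1 K.2).1 (T.mem_elems.1 K'.2).1 ⟨hx1, hx2⟩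
  refine hxF (convexHull_mono ?_ hx)
  rintro y ⟨hy1, hy2⟩
  rw [hv] at hy1
  rw [hv'] at hy2
  rcases Finset.mem_insert.1 (Finset.mem_coe.1 hy1) with rfl | h1
  · rcases Finset.mem_insert.1 (Finset.mem_coe.1 hy2) with rfl | h2
    · exact absurd (hv.trans hv'.symm) hne'
    · exact h2
  · exact h1

lemma adj_nonempty {F : Finset (E d)} (hF : F ∈ T.facets) : (T.adj F).Nonempty := by
  obtain ⟨t, ht, hst, hc⟩ := T.pure_dim F (T.mem_facets.1 hF).1
  exact ⟨⟨t, T.mem_elems.2 ⟨ht, hc⟩⟩, T.mem_adj.2 hst⟩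

lemma mem_facetsI {F : Finset (E d)} : F ∈ T.facetsI ↔ F ∈ T.facets ∧ (T.adj F).card = 2 := by
  classical
  simp [facetsI]

lemma mem_facetsB {F : Finset (E d)} : F ∈ T.facetsB ↔ F ∈ T.facets ∧ (T.adj F).card = 1 := by
  classical
  simp [facetsB]

/-- The two elements that share an interior face. -/
lemma IsNormalField.interior_facet (hn : T.IsNormalField n) (hd : 1 ≤ d)
    {F : Finset (E d)} (hF : F ∈ T.facetsI) :
    ∃ K K' : T.elems, K ≠ K' ∧ (∃ _ : DecidableEq T.elems, T.adj F = {K, K'}) ∧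
      side n F K.1 = 1 ∧ side n F K'.1 = -1 := by
  classical
  obtain ⟨hF, hc⟩ := mem_facetsI.1 hF
  obtain ⟨K, K', hne, hadj⟩ := Finset.card_eq_two.1 hc
  have hK : K ∈ T.adj F := by simp [hadj]
  have hK' : K' ∈ T.adj F := by simp [hadj]
  have hs : side n F K.1 ≠ side n F K'.1 := fun h => hne (hn.eq_of_side_eq hd hF hK hK' h)
  rcases side_eq_or (n := n) F K.1 with h | h <;> rcases side_eq_or (n := n) F K'.1 with h' | h'
  · exact absurd (h.trans h'.symm) hs
  · exact ⟨K, K', hne, ⟨_, hadj⟩, h, h'⟩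
  · exact ⟨K', K, hne.symm, ⟨_, by rw [hadj, Finset.pair_comm]⟩, h', h⟩
  · exact absurd (h.trans h'.symm) hs

/-- The only element at a boundary face. -/
lemma IsNormalField.boundary_facet (hn : T.IsNormalField n)
    {F : Finset (E d)} (hF : F ∈ T.facetsB) :
    ∃ K : T.elems, T.adj F = {K} ∧ side n F K.1 = 1 := by
  classical
  obtain ⟨-, hc⟩ := mem_facetsB.1 hF
  obtain ⟨K, hadj⟩ := Finset.card_eq_one.1 hc
  refine ⟨K, hadj, ?_⟩
  unfold side
  rw [if_pos]
  intro x hx y hy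
  have hy' : y ∈ closure Ω := T.hull_subset_closure K (subset_convexHull ℝ _ hy)
  have hcl : IsClosed {y : E d | dot (n F) (y - x) ≤ 0} :=
    isClosed_le (by fun_prop) continuous_const
  exact closure_minimal (fun y hy => hn.outward F hF x hx y hy) hcl hy'

/-- Adjacent elements have distinct signs, so there are at most two; purity of the complex gives at
least one. -/
lemma IsNormalField.facets_cases (hn : T.IsNormalField n) (hd : 1 ≤ d)
    {F : Finset (E d)} (hF : F ∈ T.facets) : F ∈ T.facetsI ∨ F ∈ T.facetsB := by
  classical
  have h1 := (adj_nonempty hF).card_pos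
  have h2 : (T.adj F).card ≤ 2 := by
    by_contra! h
    obtain ⟨a, b, c, ha, hb, hc, hab, hac, hbc⟩ := Finset.two_lt_card_iff.1 h
    have e1 : side n F a.1 ≠ side n F b.1 := fun h => hab (hn.eq_of_side_eq hd hF ha hb h)
    have e2 : side n F a.1 ≠ side n F c.1 := fun h => hac (hn.eq_of_side_eq hd hF ha hc h)
    have e3 : side n F b.1 ≠ side n F c.1 := fun h => hbc (hn.eq_of_side_eq hd hF hb hc h)
    rcases side_eq_or (n := n) F a.1 with h | h <;> rcases side_eq_or (n := n) F b.1 with h' | h' <;>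
      rcases side_eq_or (n := n) F c.1 with h'' | h'' <;> simp_all
  rw [mem_facetsI, mem_facetsB]
  have : (T.adj F).card = 2 ∨ (T.adj F).card = 1 := by omega
  tauto

lemma facetsI_subset : T.facetsI ⊆ T.facets := fun _ hF => (mem_facetsI.1 hF).1
lemma facetsB_subset : T.facetsB ⊆ T.facets := fun _ hF => (mem_facetsB.1 hF).1

lemma IsNormalField.sum_facets (hn : T.IsNormalField n) (hd : 1 ≤ d) (g : Finset (E d) → ℝ) :
    ∑ F ∈ T.facets, g F = ∑ F ∈ T.facetsI, g F + ∑ F ∈ T.facetsB, g F := by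
  classical
  rw [← Finset.sum_union]
  · congr 1
    ext F
    rw [Finset.mem_union]
    exact ⟨hn.facets_cases hd, fun h => h.elim (facetsI_subset ·) (facetsB_subset ·)⟩
  · rw [Finset.disjoint_left]
    intro F h1 h2
    have := (mem_facetsI.1 h1).2
    have := (mem_facetsB.1 h2).2
    omega

open Classical in
-- Double counting of the incident pairs (facet, element), used to pass between sums over faces and
-- sums over elements.
lemma sum_facets_adj (g : Finset (E d) → T.elems → ℝ) :
    ∑ F ∈ T.facets, ∑ K ∈ T.adj F, g F K =
      ∑ K : T.elems, ∑ F ∈ T.facets with F ⊆ K.1, g F K := by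
  simp only [adj, Finset.sum_filter]
  rw [Finset.sum_comm]

open Classical in
lemma facets_filter_eq (hd : 1 ≤ d) (K : T.elems) :
    T.facets.filter (fun F => F ⊆ K.1) = K.1.image (fun v => K.1.erase v) := by
  ext F
  simp only [Finset.mem_filter, Finset.mem_image]
  constructor
  · rintro ⟨hF, hs⟩
    obtain ⟨v, hv, rfl⟩ := T.exists_eq_erase hF (T.mem_adj.2 hs)
    exact ⟨v, hv, rfl⟩
  · rintro ⟨v, hv, rfl⟩
    exact ⟨T.erase_mem_facets hd K hv, Finset.erase_subset _ _⟩

open Classical in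
/-- The divergence theorem on an element. -/
lemma IsNormalField.integral_div (hn : T.IsNormalField n) (hd : 1 ≤ d) (K : T.elems) (i : Fin d)
    (P : Poly d) :
    ∫ x in hull K.1, ev (pd i P) x =
      ∑ F ∈ T.facets with F ⊆ K.1, side n F K.1 * n F i * faceInt F (ev P) := by
  -- Heights are chosen as a function on the whole space, with an irrelevant value off the vertices.
  have hex : ∀ v, ∃ H, v ∈ K.1 →
      IsCone (K.1.erase v) v (side n (K.1.erase v) K.1 • n (K.1.erase v)) H := by
    intro v
    by_cases hv : v ∈ K.1
    · obtain ⟨H, hH⟩ := hn.isCone hd hv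
      exact ⟨H, fun _ => hH⟩
    · exact ⟨0, fun h => absurd h hv⟩
  choose H hH using hex
  have := integral_directional (T.affineIndependent_elem K) (T.card_elem K) hd
    (fun v hv => hH v hv) (EuclideanSpace.single i 1) P
  rw [facets_filter_eq hd, Finset.sum_image]
  · simpa [dot] using this
  · intro a ha b hb hab
    exact Finset.erase_injOn _ ha hb hab

/-- The hull of the facet has finite surface measure as the base of a cone, and a continuous
function is bounded on it. -/
lemma IsNormalField.integrable_surf (hn : T.IsNormalField n) (hd : 1 ≤ d)
    {F : Finset (E d)} (hF : F ∈ T.facets) {g : E d → ℝ} (hg : Continuous g) :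
    Integrable g (surf F) := by
  classical
  obtain ⟨K, hK⟩ := adj_nonempty hF
  obtain ⟨v, H, hc, -⟩ := hn.isCone_facet hd hF hK
  have : IsFiniteMeasure (surf F) := ⟨by simpa using hc.measure_lt_top⟩
  obtain ⟨C, hC⟩ := (isCompact_hull F).exists_bound_of_continuousOn hg.continuousOn
  exact Integrable.of_bound hg.aestronglyMeasurable C
    ((ae_restrict_iff' (measurableSet_hull F)).2 (Filter.Eventually.of_forall hC))

/-- The sum over the elements of the divergence theorem, with jumps of normal components. -/
lemma IsNormalField.elemInt_div (hn : T.IsNormalField n) (hd : 1 ≤ d)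
    (Φ : T.elems → Fin d → Poly d) :
    T.elemInt (fun K x => ∑ i, ev (pd i (Φ K i)) x) =
      facesInt T.facets (fun F => ev (T.jump n F
        (fun K => ∑ i, MvPolynomial.C (n F i) * Φ K i))) := by
  classical
  have hintF : ∀ F ∈ T.facets, ∀ g : E d → ℝ, Continuous g → Integrable g (surf F) :=
    fun F hF g hg => hn.integrable_surf hd hF hg
  have hL : ∀ K : T.elems, ∫ x in hull K.1, ∑ i, ev (pd i (Φ K i)) x =
      ∑ F ∈ T.facets with F ⊆ K.1, ∑ i, side n F K.1 * n F i * faceInt F (ev (Φ K i)) := by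
    intro K
    rw [integral_finsetSum _ fun i _ => (Continuous.continuousOn
      (by fun_prop)).integrableOn_compact (isCompact_hull _), Finset.sum_comm]
    exact Finset.sum_congr rfl fun i _ => hn.integral_div hd K i (Φ K i)
  unfold elemInt facesInt
  rw [Finset.sum_congr rfl fun K _ => hL K, ← sum_facets_adj
    (fun F K => ∑ i, side n F K.1 * n F i * faceInt F (ev (Φ K i)))]
  refine Finset.sum_congr rfl fun F hF => ?_
  have : ev (T.jump n F (fun K => ∑ i, MvPolynomial.C (n F i) * Φ K i)) =
      fun x => ∑ K ∈ T.adj F, ∑ i, side n F K.1 * n F i * ev (Φ K i) x := by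
    ext x
    simp [jump, Finset.mul_sum, mul_assoc]
  beta_reduce
  rw [this, faceInt, integral_finsetSum _ fun K _ => hintF F hF _ (by fun_prop)]
  refine Finset.sum_congr rfl fun K _ => ?_
  rw [integral_finsetSum _ fun i _ => hintF F hF _ (by fun_prop)]
  exact Finset.sum_congr rfl fun i _ => by rw [integral_const_mul, faceInt]

end Mesh

/-! ### Inverse inequalities for polynomials by compactness and scaling. -/

section InverseInequality

variable {d : ℕ}

/-- Equivalence of the coefficient norm and the `L²` norm on the unit ball, for combinations of
finitely many linearly independent continuous functions. -/
lemma exists_sq_norm_le_integral {ι : Type*} [Fintype ι] (f : ι → E d → ℝ)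
    (hf : ∀ m, Continuous (f m))
    (hinj : ∀ c : ι → ℝ, (∀ x ∈ Metric.ball (0 : E d) 1, ∑ m, c m * f m x = 0) → c = 0) :
    ∃ C > 0, ∀ c : ι → ℝ,
      ‖c‖ ^ 2 ≤ C * ∫ x in Metric.closedBall (0 : E d) 1, (∑ m, c m * f m x) ^ 2 := by
  set Q : (ι → ℝ) → ℝ := fun c => ∫ x in Metric.closedBall (0 : E d) 1, (∑ m, c m * f m x) ^ 2
    with hQ
  have hQcont : Continuous Q := by
    refine continuous_parametric_integral_of_continuous (f := fun (c : ι → ℝ) (x : E d) =>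
      (∑ m, c m * f m x) ^ 2) ?_ (isCompact_closedBall _ _)
    simp only [Function.uncurry_def]
    fun_prop
  have hQnonneg : ∀ c, 0 ≤ Q c := fun c => integral_nonneg fun x => sq_nonneg _
  -- A vanishing integral forces the continuous integrand to vanish on the open ball, contradicting
  -- linear independence. The minimum of Q over the unit sphere of coefficients is therefore
  -- positive, and homogeneity does the rest.
  have hQpos : ∀ c, c ≠ 0 → 0 < Q c := by
    intro c hc
    refine lt_of_le_of_ne (hQnonneg c) fun h0 => hc (hinj c ?_)
    have hcont : Continuous fun x => (∑ m, c m * f m x) ^ 2 := by fun_prop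
    have hint : Integrable (fun x => (∑ m, c m * f m x) ^ 2)
        (volume.restrict (Metric.closedBall (0 : E d) 1)) :=
      hcont.continuousOn.integrableOn_compact (isCompact_closedBall _ _)
    have hae := (integral_eq_zero_iff_of_nonneg (fun x => sq_nonneg _) hint).1 h0.symm
    have hae' := ae_restrict_of_ae_restrict_of_subset Metric.ball_subset_closedBall hae
    have heq := Measure.eqOn_open_of_ae_eq hae' Metric.isOpen_ball hcont.continuousOn
      continuousOn_const
    intro x hx
    exact pow_eq_zero_iff (two_ne_zero) |>.1 (heq hx)
  have hhom : ∀ (t : ℝ) (c : ι → ℝ), Q (t • c) = t ^ 2 * Q c := by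
    intro t c
    simp only [hQ]
    rw [← integral_const_mul]
    congr 1
    ext x
    simp only [Pi.smul_apply, smul_eq_mul, mul_assoc, ← Finset.mul_sum]
    ring
  by_cases hne : (Metric.sphere (0 : ι → ℝ) 1).Nonempty
  · obtain ⟨c₀, hc₀, hmin⟩ := (isCompact_sphere (0 : ι → ℝ) 1).exists_isMinOn hne
      hQcont.continuousOn
    have hc₀' : c₀ ≠ 0 := by
      rintro rfl; simp at hc₀
    refine ⟨(Q c₀)⁻¹, inv_pos.2 (hQpos _ hc₀'), fun c => ?_⟩
    by_cases hc : c = 0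
    · simp [hc]
    have hcn : 0 < ‖c‖ := norm_pos_iff.2 hc
    have h1 : Q c₀ ≤ Q (‖c‖⁻¹ • c) := hmin (by simp [norm_smul, hcn.ne'])
    rw [hhom] at h1
    have h2 := hQpos _ hc₀'
    change _ ≤ _ * Q c
    rw [inv_mul_eq_div, le_div_iff₀ h2]
    calc ‖c‖ ^ 2 * Q c₀ ≤ ‖c‖ ^ 2 * (‖c‖⁻¹ ^ 2 * Q c) := by gcongr
      _ = Q c := by field_simp
  -- The sphere is empty only when all coefficient vectors vanish.
  · refine ⟨1, one_pos, fun c => ?_⟩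
    have hc : c = 0 := by
      by_contra hc
      exact hne ⟨‖c‖⁻¹ • c, by simp [norm_smul, (norm_pos_iff.2 hc).ne']⟩
    simp [hc]

/-- A neighbourhood of 0 contains a product of infinite sets, and a polynomial vanishing on such a
product is zero. -/
lemma eq_zero_of_ev_ball {P : Poly d} (h : ∀ x ∈ Metric.ball (0 : E d) 1, ev P x = 0) :
    P = 0 := by
  have hopen : IsOpen {y : Fin d → ℝ | WithLp.toLp 2 y ∈ Metric.ball (0 : E d) 1} :=
    Metric.isOpen_ball.preimage (by fun_prop)
  obtain ⟨ε, hε, hsub⟩ := Metric.isOpen_iff.1 hopen 0 (by simp)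
  refine MvPolynomial.funext_set (fun _ : Fin d => Metric.ball (0 : ℝ) ε) (fun i => ?_) ?_
  · rw [Real.ball_eq_Ioo]; exact Set.Ioo_infinite (by linarith)
  · intro y hy
    have hy' : y ∈ Metric.ball (0 : Fin d → ℝ) ε := by
      rw [ball_pi _ hε]; exact hy
    have := h _ (hsub hy')
    simpa [ev] using this

/-- An inverse inequality from the `L²` norm on the unit ball to the maximum norm on a larger
ball. -/
lemma exists_sq_pd_le (d p : ℕ) (κ : ℝ) : ∃ C > 0, ∀ P : Poly d, P.totalDegree ≤ p →
    ∀ i, ∀ y ∈ Metric.closedBall (0 : E d) κ,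
      (ev (pd i P) y) ^ 2 ≤ C * ∫ x in Metric.closedBall (0 : E d) 1, (ev P x) ^ 2 := by
  classical
  set S : Finset (Fin d →₀ ℕ) := (Finsupp.finite_of_degree_le (σ := Fin d) p).toFinset with hS
  let mono : S → Poly d := fun m => MvPolynomial.monomial m.1 1
  have hrep : ∀ P : Poly d, P.totalDegree ≤ p →
      P = ∑ m : S, MvPolynomial.C (P.coeff m.1) * mono m := by
    intro P hP
    have h1 : ∑ m : S, MvPolynomial.C (P.coeff m.1) * mono m =
        ∑ m ∈ S, MvPolynomial.monomial m (P.coeff m) := by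
      rw [← Finset.sum_coe_sort S (fun m => MvPolynomial.monomial m (P.coeff m))]
      refine Finset.sum_congr rfl fun m _ => ?_
      simp [mono, MvPolynomial.C_mul_monomial]
    rw [h1]
    conv_lhs => rw [P.as_sum]
    refine Finset.sum_subset (fun m hm => ?_) (fun m _ hm => ?_)
    · simp only [hS, Set.Finite.mem_toFinset]
      exact (MvPolynomial.le_totalDegree hm).trans hP
    · rw [MvPolynomial.notMem_support_iff.1 hm, map_zero]
  have hinj : ∀ c : S → ℝ, (∀ x ∈ Metric.ball (0 : E d) 1, ∑ m, c m * ev (mono m) x = 0) →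
      c = 0 := by
    intro c hc
    have h0 : ∑ m : S, MvPolynomial.C (c m) * mono m = 0 :=
      eq_zero_of_ev_ball fun x hx => by simpa using hc x hx
    ext m
    have := congrArg (MvPolynomial.coeff m.1) h0
    simpa [MvPolynomial.coeff_sum, mono, MvPolynomial.coeff_C_mul, MvPolynomial.coeff_monomial,
      ← Subtype.ext_iff] using this
  obtain ⟨C, hC, hbound⟩ := exists_sq_norm_le_integral (fun m => ev (mono m))
    (fun m => continuous_ev _) hinj
  -- M bounds the derivatives of all monomials of degree at most p on the larger ball; the
  -- coefficients are bounded by the L² norm on the unit ball.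
  obtain ⟨M, hM⟩ := (isCompact_closedBall (0 : E d) κ).exists_bound_of_continuousOn
    (f := fun y => ∑ m : S, ∑ i, |ev (pd i (mono m)) y|) (Continuous.continuousOn (by fun_prop))
  refine ⟨(M ^ 2 + 1) * C, by positivity, fun P hP i y hy => ?_⟩
  set c : S → ℝ := fun m => P.coeff m.1
  have h1 : ev (pd i P) y = ∑ m, c m * ev (pd i (mono m)) y := by
    conv_lhs => rw [hrep P hP]
    simp [c]
  have h2 : |ev (pd i P) y| ≤ ‖c‖ * M := by
    rw [h1]
    calc |∑ m, c m * ev (pd i (mono m)) y| ≤ ∑ m, |c m * ev (pd i (mono m)) y| :=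
          Finset.abs_sum_le_sum_abs _ _
      _ ≤ ∑ m, ‖c‖ * ∑ j, |ev (pd j (mono m)) y| := by
          refine Finset.sum_le_sum fun m _ => ?_
          rw [abs_mul]
          refine mul_le_mul (norm_le_pi_norm c m) ?_ (abs_nonneg _) (norm_nonneg _)
          exact Finset.single_le_sum (f := fun j => |ev (pd j (mono m)) y|)
            (fun j _ => abs_nonneg _) (Finset.mem_univ i)
      _ = ‖c‖ * ∑ m, ∑ j, |ev (pd j (mono m)) y| := by rw [Finset.mul_sum]
      _ ≤ ‖c‖ * M := by
          gcongr
          exact (le_abs_self _).trans (hM y hy)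
  have h3 := hbound c
  have h4 : ∀ x, ∑ m, c m * ev (mono m) x = ev P x := by
    intro x
    conv_rhs => rw [hrep P hP]
    simp [c]
  simp only [h4] at h3
  calc (ev (pd i P) y) ^ 2 = |ev (pd i P) y| ^ 2 := (sq_abs _).symm
    _ ≤ (‖c‖ * M) ^ 2 := by gcongr
    _ = M ^ 2 * ‖c‖ ^ 2 := by ring
    _ ≤ (M ^ 2 + 1) * ‖c‖ ^ 2 := by gcongr; linarith
    _ ≤ (M ^ 2 + 1) * (C * ∫ x in Metric.closedBall (0 : E d) 1, (ev P x) ^ 2) := by gcongr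
    _ = _ := by ring

/-- The polynomial `y ↦ P (z + r y)`. -/
def rescale (z : E d) (r : ℝ) (P : Poly d) : Poly d :=
  MvPolynomial.bind₁ (fun i => MvPolynomial.C (z i) + MvPolynomial.C r * MvPolynomial.X i) P

lemma ev_rescale (z : E d) (r : ℝ) (P : Poly d) (y : E d) :
    ev (rescale z r P) y = ev P (z + r • y) := by
  induction P using MvPolynomial.induction_on with
  | C a => simp [rescale]
  | add p q hp hq => simpa [rescale] using congrArg₂ (· + ·) hp hq
  | mul_X p k hp =>
    simp only [rescale, map_mul, MvPolynomial.bind₁_X_right, ev_mul, ev_add, ev_C, ev_X] at hp ⊢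
    rw [hp]; simp

lemma pd_rescale (z : E d) (r : ℝ) (P : Poly d) (i : Fin d) :
    pd i (rescale z r P) = MvPolynomial.C r * rescale z r (pd i P) := by
  induction P using MvPolynomial.induction_on with
  | C a => simp [rescale]
  | add p q hp hq => simp only [rescale, map_add, pd_add] at hp hq ⊢; rw [hp, hq]; ring
  | mul_X p k hp =>
    simp only [rescale, map_mul, map_add, MvPolynomial.bind₁_X_right, pd_mul, pd_add, pd_C, pd_X]
      at hp ⊢
    rw [hp]
    split_ifs <;> simp <;> ring

lemma totalDegree_rescale_le (z : E d) (r : ℝ) (P : Poly d) :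
    (rescale z r P).totalDegree ≤ P.totalDegree := by
  conv_lhs => rw [P.as_sum]
  rw [rescale, map_sum]
  refine MvPolynomial.totalDegree_finsetSum_le fun m hm => ?_
  rw [MvPolynomial.bind₁_monomial]
  refine (MvPolynomial.totalDegree_mul _ _).trans ?_
  rw [MvPolynomial.totalDegree_C, zero_add]
  refine (MvPolynomial.totalDegree_finsetProd _ _).trans
    (le_trans ?_ (MvPolynomial.le_totalDegree hm))
  refine Finset.sum_le_sum fun i _ => (MvPolynomial.totalDegree_pow _ _).trans ?_
  refine (Nat.mul_le_mul_left _ ?_).trans (mul_one _).le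
  refine (MvPolynomial.totalDegree_add _ _).trans (max_le (by simp) ?_)
  refine (MvPolynomial.totalDegree_mul _ _).trans ?_
  simp

lemma integral_closedBall_rescale (z : E d) {r : ℝ} (hr : 0 < r) (g : E d → ℝ) :
    ∫ y in Metric.closedBall (0 : E d) 1, g (z + r • y) =
      (r ^ d)⁻¹ * ∫ x in Metric.closedBall z r, g x := by
  rw [← integral_indicator measurableSet_closedBall, ← integral_indicator measurableSet_closedBall]
  have h1 : ∀ y : E d, (Metric.closedBall (0 : E d) 1).indicator (fun y => g (z + r • y)) y =
      (fun x => (Metric.closedBall z r).indicator g (z + x)) (r • y) := by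
    intro y
    have : y ∈ Metric.closedBall (0 : E d) 1 ↔ z + r • y ∈ Metric.closedBall z r := by
      simp only [Metric.mem_closedBall, dist_zero_right, dist_self_add_left, norm_smul,
        Real.norm_eq_abs, abs_of_pos hr]
      constructor <;> intro h <;> nlinarith
    by_cases hy : y ∈ Metric.closedBall (0 : E d) 1
    · simp only [Set.indicator_of_mem hy, Set.indicator_of_mem (this.1 hy)]
    · simp only [Set.indicator_of_notMem hy, Set.indicator_of_notMem (fun h => hy (this.2 h))]
  simp only [h1]
  rw [Measure.integral_comp_smul volume
    (fun x => (Metric.closedBall z r).indicator g (z + x)) r, integral_add_left_eq_self,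
    finrank_euclideanSpace_fin, abs_of_pos (by positivity), smul_eq_mul]

/-- The inverse inequality on sets that lie between balls of radii `r` and `κ r`. -/
lemma exists_inverse_ineq (d p : ℕ) (κ : ℝ) : ∃ C > 0, ∀ (S : Set (E d)) (z : E d) (r : ℝ), 0 < r →
    IsCompact S → Metric.closedBall z r ⊆ S → S ⊆ Metric.closedBall z (κ * r) →
    ∀ P : Poly d, P.totalDegree ≤ p → ∀ i,
      r ^ 2 * ∫ x in S, (ev (pd i P) x) ^ 2 ≤ C * ∫ x in S, (ev P x) ^ 2 := by
  obtain ⟨C, hC, hb⟩ := exists_sq_pd_le d p κ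
  set V : ℝ := volume.real (Metric.closedBall (0 : E d) κ) with hV
  refine ⟨C * V + 1, by positivity, fun S z r hr hS hsub hsup P hP i => ?_⟩
  have hint : ∀ Q : Poly d, IntegrableOn (fun x => (ev Q x) ^ 2) S :=
    fun Q => (Continuous.continuousOn (by fun_prop)).integrableOn_compact hS
  have hvol : volume.real S ≤ r ^ d * V := by
    have hle : volume.real S ≤ volume.real (Metric.closedBall z (r * κ)) := by
      refine measureReal_mono (by rwa [mul_comm]) (isCompact_closedBall _ _).measure_lt_top.ne
    refine hle.trans (le_of_eq ?_)
    rw [Measure.real, Measure.addHaar_closedBall_mul_of_pos _ _ hr, ENNReal.toReal_mul,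
      finrank_euclideanSpace_fin, ENNReal.toReal_ofReal (by positivity)]
    rfl
  set I := ∫ x in S, (ev P x) ^ 2 with hI
  have hI0 : 0 ≤ I := integral_nonneg fun x => sq_nonneg _
  -- After rescaling the inner ball to the unit ball, the maximum bound holds at every point of S.
  -- The factor r^(-d) from the change of variables cancels against the volume of S, which is at
  -- most r^d V.
  have hpt : ∀ x ∈ S, r ^ 2 * (ev (pd i P) x) ^ 2 ≤ C * ((r ^ d)⁻¹ * I) := by
    intro x hx
    have hy : r⁻¹ • (x - z) ∈ Metric.closedBall (0 : E d) κ := by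
      have := hsup hx
      rw [Metric.mem_closedBall, dist_eq_norm] at this
      rw [mem_closedBall_zero_iff, norm_smul, norm_inv, Real.norm_of_nonneg hr.le,
        inv_mul_le_iff₀ hr]
      linarith
    have h1 := hb (rescale z r P) ((totalDegree_rescale_le z r P).trans hP) i _ hy
    have hx' : z + r • r⁻¹ • (x - z) = x := by rw [smul_inv_smul₀ hr.ne']; abel
    rw [pd_rescale, ev_mul, ev_C, ev_rescale, hx'] at h1
    simp only [ev_rescale] at h1
    rw [integral_closedBall_rescale z hr (fun x => (ev P x) ^ 2)] at h1
    calc r ^ 2 * (ev (pd i P) x) ^ 2 = (r * ev (pd i P) x) ^ 2 := by ring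
      _ ≤ _ := h1
      _ ≤ C * ((r ^ d)⁻¹ * I) := by
        gcongr
        exact setIntegral_mono_set (hint P) (Filter.Eventually.of_forall fun x => sq_nonneg _)
          hsub.eventuallyLE
  rw [← integral_const_mul]
  calc ∫ x in S, r ^ 2 * (ev (pd i P) x) ^ 2 ≤ ∫ x in S, C * ((r ^ d)⁻¹ * I) :=
        setIntegral_mono_on ((hint _).const_mul _)
          (integrableOn_const hS.measure_lt_top.ne) hS.measurableSet hpt
    _ = volume.real S * (C * ((r ^ d)⁻¹ * I)) := by simp
    _ ≤ (r ^ d * V) * (C * ((r ^ d)⁻¹ * I)) := by gcongr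
    _ = C * V * I := by field_simp
    _ ≤ (C * V + 1) * I := by nlinarith

end InverseInequality

/-! ### Shape-regularity and the resulting bounds on elements and facets. -/

namespace Mesh

variable {d : ℕ} {Ω : Set (E d)} {T : Mesh Ω} {n : Finset (E d) → E d}

lemma elem_nonempty (K : T.elems) : K.1.Nonempty := by
  rw [← Finset.card_pos, T.card_elem]; omega

lemma integrableOn_hull (K : Finset (E d)) {g : E d → ℝ} (hg : Continuous g) :
    IntegrableOn g (hull K) :=
  hg.continuousOn.integrableOn_compact (isCompact_hull _)

lemma shapeReg_ge (K : T.elems) : Metric.diam (hull K.1) / inscribedDiam K.1 ≤ T.shapeReg :=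
  le_ciSup (f := fun K : T.elems => Metric.diam (hull K.1) / inscribedDiam K.1)
    (Set.finite_range _).bddAbove K

/-- An element lies between two concentric balls whose radii are comparable, with a ratio that
depends on the shape-regularity. -/
lemma IsNormalField.exists_balls (hn : T.IsNormalField n) (hd : 1 ≤ d) (K : T.elems) :
    ∃ (z : E d) (r : ℝ), 0 < r ∧ Metric.closedBall z r ⊆ hull K.1 ∧
      hull K.1 ⊆ Metric.closedBall z (4 * T.shapeReg * r) := by
  classical
  obtain ⟨v, hv⟩ := elem_nonempty K
  obtain ⟨H, hH⟩ := hn.isCone hd hv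
  have hins := Finset.insert_erase hv
  set A := {δ : ℝ | ∃ (z : E d) (r : ℝ), 0 ≤ r ∧ Metric.closedBall z r ⊆ hull K.1 ∧ δ = 2 * r}
    with hA
  -- Without an upper bound the supremum would take its default value 0; the height of a facet
  -- provides one.
  have hbdd : BddAbove A := by
    refine ⟨H, ?_⟩
    rintro _ ⟨z, r, hr, hsub, rfl⟩
    exact hH.two_mul_radius_le hr (by rwa [hins])
  have hint : (interior (hull K.1)).Nonempty := by
    rw [hull, interior_convexHull_nonempty_iff_affineSpan_eq_top]
    have := ((T.affineIndependent_elem K).affineSpan_eq_top_iff_card_eq_finrank_add_one).2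
      (by simp [T.card_elem K])
    simpa using this
  have hpos : 0 < inscribedDiam K.1 := by
    obtain ⟨z, hz⟩ := hint
    obtain ⟨ε, hε, hsub⟩ := Metric.isOpen_iff.1 isOpen_interior z hz
    have : 2 * (ε / 2) ∈ A := ⟨z, ε / 2, by linarith,
      (Metric.closedBall_subset_ball (by linarith)).trans (hsub.trans interior_subset), rfl⟩
    have := le_csSup hbdd this
    change 0 < sSup A
    linarith
  have hne : A.Nonempty := by
    obtain ⟨z, hz⟩ := hint
    exact ⟨2 * 0, z, 0, le_rfl, by simpa using interior_subset hz, rfl⟩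
  -- A ball of more than half the maximal diameter suffices, so that attainment of the supremum is
  -- not needed. Then ρ_K < 4r, whence the factor 4 in the outer radius.
  obtain ⟨_, ⟨z, r, hr, hsub, rfl⟩, hlt⟩ := exists_lt_of_lt_csSup hne
    (show inscribedDiam K.1 / 2 < sSup A by change _ < inscribedDiam K.1; linarith)
  refine ⟨z, r, by linarith, hsub, fun x hx => ?_⟩
  have hz : z ∈ hull K.1 := hsub (Metric.mem_closedBall_self hr)
  have h1 := Metric.dist_le_diam_of_mem (isCompact_hull K.1).isBounded hx hz
  have h2 := shapeReg_ge K
  rw [div_le_iff₀ hpos] at h2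
  have h3 : 0 ≤ T.shapeReg := le_trans (div_nonneg Metric.diam_nonneg hpos.le) (shapeReg_ge K)
  rw [Metric.mem_closedBall]
  nlinarith

/-- The bounds for polynomials of degree at most `p` on an element `K` and on a facet `F` of `K`
with constant `C`: discrete trace inequality, inverse inequality, and bound on the size of
the facet. -/
structure FaceBounds (F K : Finset (E d)) (p : ℕ) (D C : ℝ) : Prop where
  pos : 0 < hFace F
  trace : ∀ P : Poly d, P.totalDegree ≤ p →
    hFace F * faceInt F (fun x => (ev P x) ^ 2) ≤ C * ∫ x in hull K, (ev P x) ^ 2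
  inverse : ∀ P : Poly d, P.totalDegree ≤ p → ∀ i,
    hFace F ^ 2 * ∫ x in hull K, (ev (pd i P) x) ^ 2 ≤ C * ∫ x in hull K, (ev P x) ^ 2
  le_diam : hFace F ≤ C * D

/-- The element lies between balls of radii r and κr, which gives the inverse inequality. The cone
identity for P² expresses H ∫_F P² as a volume integral, bounded through |x - v| ≤ 2κr and the
inverse inequality; this is the trace inequality, because h_F ≤ βr and 2r ≤ H. -/
lemma exists_faceBounds (d p : ℕ) (hd : 2 ≤ d) (ϑ : ℝ) : ∃ C > 0, ∀ (Ω : Set (E d)),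
    Bornology.IsBounded Ω → ∀ (T : Mesh Ω) (n : Finset (E d) → E d), T.IsNormalField n →
    T.shapeReg = ϑ → ∀ F ∈ T.facets, ∀ K ∈ T.adj F,
      FaceBounds F K.1 p (Metric.diam Ω) C := by
  classical
  set κ : ℝ := 4 * ϑ with hκ
  obtain ⟨C, hC, hinv⟩ := exists_inverse_ineq d p κ
  set V : ℝ := volume.real (Metric.closedBall (0 : E d) κ) with hV
  have hV0 : 0 ≤ V := measureReal_nonneg
  -- From H · area = d · volume, H ≥ 2r and volume ≤ r^d V, the area of the facet is at most (dV/2)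
  -- r^(d-1); its (d-1)-th root is βr.
  set β : ℝ := (d * V / 2) ^ (1 / ((d : ℝ) - 1)) with hβ
  have hβ0 : 0 ≤ β := Real.rpow_nonneg (by positivity) _
  -- The sum of the constants for trace, inverse and size bounds; 1 ensures positivity.
  refine ⟨β * (2 * d + 4 * d * κ ^ 2 * C) + β ^ 2 * C + β + 1, by positivity, ?_⟩
  intro Ω hΩ T n hn hT F hF K hK
  obtain ⟨z, r, hr, hsub, hsup⟩ := hn.exists_balls (by omega) K
  rw [hT] at hsup
  obtain ⟨v, H, hc, hKv⟩ := hn.isCone_facet (by omega) hF hK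
  have hvK : v ∈ hull K.1 := subset_convexHull ℝ _ (by rw [hKv]; simp)
  have h2r : 2 * r ≤ H := hc.two_mul_radius_le hr.le (by rwa [← hKv])
  have hHpos := hc.height_pos
  have hdpos : (0 : ℝ) < d := by exact_mod_cast (by omega : 0 < d)
  have hd1 : (0 : ℝ) < (d : ℝ) - 1 := by
    have : (2 : ℝ) ≤ d := by exact_mod_cast hd
    linarith
  -- the measure of the facet
  set A : ℝ := (Measure.euclideanHausdorffMeasure (d - 1) : Measure (E d)).real (hull F) with hA
  have hvolK : volume.real (hull K.1) ≤ r ^ d * V := by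
    have hle : volume.real (hull K.1) ≤ volume.real (Metric.closedBall z (r * κ)) :=
      measureReal_mono (by rwa [mul_comm]) (isCompact_closedBall _ _).measure_lt_top.ne
    refine hle.trans (le_of_eq ?_)
    rw [Measure.real, Measure.addHaar_closedBall_mul_of_pos _ _ hr, ENNReal.toReal_mul,
      finrank_euclideanSpace_fin, ENNReal.toReal_ofReal (by positivity)]
    rfl
  have hvolpos : 0 < volume.real (hull K.1) := by
    refine ENNReal.toReal_pos (ne_of_gt (lt_of_lt_of_le ?_ (measure_mono hsub)))
      (isCompact_hull _).measure_lt_top.ne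
    exact Metric.measure_closedBall_pos _ _ hr
  -- The cone identity for the constant polynomial 1.
  have hHA : H * A = d * volume.real (hull K.1) := by
    have := hc.height_mul_faceInt (by omega) 1
    rw [← hKv] at this
    simpa [faceInt, hA, mul_comm] using this
  have hApos : 0 < A := by
    have : 0 < H * A := by rw [hHA]; positivity
    exact (pos_iff_pos_of_mul_pos this).1 hHpos
  have hhpos : 0 < hFace F := Real.rpow_pos_of_pos hApos _
  have hhr : hFace F ≤ β * r := by
    have hA2 : A ≤ (d * V / 2) * r ^ ((d : ℝ) - 1) := by
      have h1 : r ^ ((d : ℝ) - 1) * r = r ^ d := by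
        rw [← Real.rpow_add_one hr.ne', sub_add_cancel, Real.rpow_natCast]
      have h2 : 2 * r * A ≤ d * (r ^ d * V) :=
        calc 2 * r * A ≤ H * A := by gcongr
          _ = d * volume.real (hull K.1) := hHA
          _ ≤ _ := by gcongr
      rw [← h1] at h2
      have h3 : r * (2 * A) ≤ r * (d * V * r ^ ((d : ℝ) - 1)) := by linarith
      have := le_of_mul_le_mul_left h3 hr
      linarith
    calc hFace F ≤ ((d * V / 2) * r ^ ((d : ℝ) - 1)) ^ (1 / ((d : ℝ) - 1)) :=
          Real.rpow_le_rpow hApos.le hA2 (by positivity)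
      _ = β * r := by
          rw [Real.mul_rpow (by positivity) (by positivity), ← Real.rpow_mul hr.le,
            mul_one_div_cancel hd1.ne', Real.rpow_one]
  have hinvK := hinv (hull K.1) z r hr (isCompact_hull _) hsub hsup
  refine ⟨hhpos, fun P hP => ?_, fun P hP i => ?_, ?_⟩
  · set I := ∫ x in hull K.1, (ev P x) ^ 2 with hI
    have hI0 : 0 ≤ I := integral_nonneg fun x => sq_nonneg _
    have hfi : faceInt F (ev (P ^ 2)) = faceInt F (fun x => (ev P x) ^ 2) := by
      unfold faceInt; simp
    have hJ0 : 0 ≤ faceInt F (fun x => (ev P x) ^ 2) := integral_nonneg fun x => sq_nonneg _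
    have h1 := hc.height_mul_faceInt (by omega) (P ^ 2)
    rw [← hKv, hfi] at h1
    have hpt : ∀ x ∈ hull K.1, d * ev (P ^ 2) x + ∑ i, ev (pd i (P ^ 2)) x * (x i - v i) ≤
        2 * d * (ev P x) ^ 2 + ∑ i, 4 * κ ^ 2 * (r ^ 2 * (ev (pd i P) x) ^ 2) := by
      intro x hx
      have hi : ∀ i, ev (pd i (P ^ 2)) x * (x i - v i) ≤
          (ev P x) ^ 2 + 4 * κ ^ 2 * (r ^ 2 * (ev (pd i P) x) ^ 2) := by
        intro i
        have hxi : |x i - v i| ≤ 2 * (κ * r) := by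
          have h3 := hsup hx
          have h4 := hsup hvK
          rw [Metric.mem_closedBall] at h3 h4
          have h5 := dist_triangle_right x v z
          have h6 : |x i - v i| ≤ dist x v := by
            rw [dist_eq_norm]
            simpa using PiLp.norm_apply_le (x - v) i
          linarith
        have hsq : (x i - v i) ^ 2 ≤ (2 * (κ * r)) ^ 2 := sq_le_sq' (abs_le.1 hxi).1 (abs_le.1 hxi).2
        have h7 : (ev (pd i P) x) ^ 2 * (x i - v i) ^ 2 ≤
            (ev (pd i P) x) ^ 2 * (2 * (κ * r)) ^ 2 := by gcongr
        rw [sq P, pd_mul]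
        simp only [ev_add, ev_mul]
        nlinarith [sq_nonneg (ev P x - ev (pd i P) x * (x i - v i))]
      have := Finset.sum_le_sum fun i (_ : i ∈ Finset.univ) => hi i
      rw [Finset.sum_add_distrib] at this
      simp only [Finset.sum_const, Finset.card_univ, Fintype.card_fin, nsmul_eq_mul] at this
      rw [ev_pow]
      linarith
    have h2 : H * faceInt F (fun x => (ev P x) ^ 2) ≤ (2 * d + 4 * d * κ ^ 2 * C) * I := by
      rw [h1]
      refine (setIntegral_mono_on (integrableOn_hull _ (by fun_prop))
        (integrableOn_hull _ (by fun_prop)) (measurableSet_hull _) hpt).trans ?_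
      rw [integral_add (integrableOn_hull _ (by fun_prop)) (integrableOn_hull _ (by fun_prop)),
        integral_const_mul, integral_finsetSum _ fun i _ => integrableOn_hull _ (by fun_prop)]
      have h3 : ∑ i : Fin d, ∫ x in hull K.1, 4 * κ ^ 2 * (r ^ 2 * (ev (pd i P) x) ^ 2) ≤
          ∑ i : Fin d, 4 * κ ^ 2 * (C * I) := by
        refine Finset.sum_le_sum fun i _ => ?_
        rw [integral_const_mul, integral_const_mul]
        have := hinvK P hP i
        gcongr
      simp only [Finset.sum_const, Finset.card_univ, Fintype.card_fin, nsmul_eq_mul] at h3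
      linarith
    have h3 : hFace F * faceInt F (fun x => (ev P x) ^ 2) ≤
        β * ((2 * d + 4 * d * κ ^ 2 * C) * I) :=
      calc hFace F * faceInt F (fun x => (ev P x) ^ 2) ≤
            (β * H) * faceInt F (fun x => (ev P x) ^ 2) := by
            gcongr
            refine hhr.trans ?_
            gcongr
            linarith
        _ = β * (H * faceInt F (fun x => (ev P x) ^ 2)) := by ring
        _ ≤ _ := by gcongr
    have : 0 ≤ (β ^ 2 * C + β + 1) * I := by positivity
    linarith
  · set I := ∫ x in hull K.1, (ev P x) ^ 2 with hI
    have hI0 : 0 ≤ I := integral_nonneg fun x => sq_nonneg _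
    have hJ0 : 0 ≤ ∫ x in hull K.1, (ev (pd i P) x) ^ 2 := integral_nonneg fun x => sq_nonneg _
    have h3 : hFace F ^ 2 * ∫ x in hull K.1, (ev (pd i P) x) ^ 2 ≤ β ^ 2 * (C * I) :=
      calc hFace F ^ 2 * ∫ x in hull K.1, (ev (pd i P) x) ^ 2 ≤
            (β * r) ^ 2 * ∫ x in hull K.1, (ev (pd i P) x) ^ 2 := by gcongr
        _ = β ^ 2 * (r ^ 2 * ∫ x in hull K.1, (ev (pd i P) x) ^ 2) := by ring
        _ ≤ _ := mul_le_mul_of_nonneg_left (hinvK P hP i) (by positivity)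
    have : 0 ≤ (β * (2 * d + 4 * d * κ ^ 2 * C) + β + 1) * I := by positivity
    linarith
  -- The centre of the inner ball and one of its boundary points both lie in the closure of Ω.
  · have hrD : r ≤ Metric.diam Ω := by
      rw [← Metric.diam_closure]
      have hbd : Bornology.IsBounded (closure Ω) := hΩ.closure
      let i0 : Fin d := ⟨0, by omega⟩
      have hz1 : z ∈ Metric.closedBall z r := Metric.mem_closedBall_self hr.le
      have hz2 : z + r • EuclideanSpace.single i0 (1 : ℝ) ∈ Metric.closedBall z r := by
        simp [norm_smul, abs_of_pos hr]
      have := Metric.dist_le_diam_of_mem hbd (T.hull_subset_closure K (hsub hz2))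
        (T.hull_subset_closure K (hsub hz1))
      simpa [norm_smul, abs_of_pos hr] using this
    have hD : 0 ≤ Metric.diam Ω := Metric.diam_nonneg
    have h1 : hFace F ≤ β * Metric.diam Ω := hhr.trans (by gcongr)
    have : 0 ≤ (β * (2 * d + 4 * d * κ ^ 2 * C) + β ^ 2 * C + 1) * Metric.diam Ω := by positivity
    linarith

end Mesh

namespace Mesh

variable {d : ℕ} {Ω : Set (E d)} {T : Mesh Ω} {n : Finset (E d) → E d}

/-! ### Integrals over faces and elements -/

lemma faceInt_nonneg {F : Finset (E d)} {f : E d → ℝ} (h : ∀ x, 0 ≤ f x) : 0 ≤ faceInt F f :=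
  integral_nonneg h

lemma faceInt_const_mul (F : Finset (E d)) (c : ℝ) (f : E d → ℝ) :
    faceInt F (fun x => c * f x) = c * faceInt F f := integral_const_mul _ _

lemma IsNormalField.faceInt_mono (hn : T.IsNormalField n) (hd : 1 ≤ d) {F : Finset (E d)}
    (hF : F ∈ T.facets) {f g : E d → ℝ} (hf : Continuous f) (hg : Continuous g)
    (h : ∀ x ∈ hull F, f x ≤ g x) : faceInt F f ≤ faceInt F g :=
  setIntegral_mono_on (hn.integrable_surf hd hF hf) (hn.integrable_surf hd hF hg)
    (measurableSet_hull F) h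

lemma IsNormalField.faceInt_add (hn : T.IsNormalField n) (hd : 1 ≤ d) {F : Finset (E d)}
    (hF : F ∈ T.facets) {f g : E d → ℝ} (hf : Continuous f) (hg : Continuous g) :
    faceInt F (fun x => f x + g x) = faceInt F f + faceInt F g :=
  integral_add (hn.integrable_surf hd hF hf) (hn.integrable_surf hd hF hg)

lemma IsNormalField.faceInt_sum (hn : T.IsNormalField n) (hd : 1 ≤ d) {F : Finset (E d)}
    (hF : F ∈ T.facets) {ι : Type*} (s : Finset ι) {f : ι → E d → ℝ}
    (hf : ∀ i, Continuous (f i)) :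
    faceInt F (fun x => ∑ i ∈ s, f i x) = ∑ i ∈ s, faceInt F (f i) :=
  integral_finsetSum _ fun i _ => hn.integrable_surf hd hF (hf i)

lemma facesInt_congr {G : Finset (Finset (E d))} {f g : Finset (E d) → E d → ℝ}
    (h : ∀ F ∈ G, ∀ x, f F x = g F x) : facesInt G f = facesInt G g :=
  Finset.sum_congr rfl fun F hF => by rw [funext (h F hF)]

lemma facesInt_nonneg {G : Finset (Finset (E d))} {f : Finset (E d) → E d → ℝ}
    (h : ∀ F ∈ G, ∀ x, 0 ≤ f F x) : 0 ≤ facesInt G f :=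
  Finset.sum_nonneg fun F hF => faceInt_nonneg (h F hF)

lemma IsNormalField.facesInt_mono (hn : T.IsNormalField n) (hd : 1 ≤ d)
    {G : Finset (Finset (E d))} (hG : G ⊆ T.facets) {f g : Finset (E d) → E d → ℝ}
    (hf : ∀ F, Continuous (f F)) (hg : ∀ F, Continuous (g F))
    (h : ∀ F ∈ G, ∀ x ∈ hull F, f F x ≤ g F x) : facesInt G f ≤ facesInt G g :=
  Finset.sum_le_sum fun F hF => hn.faceInt_mono hd (hG hF) (hf F) (hg F) (h F hF)

lemma IsNormalField.facesInt_add (hn : T.IsNormalField n) (hd : 1 ≤ d)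
    {G : Finset (Finset (E d))} (hG : G ⊆ T.facets) {f g : Finset (E d) → E d → ℝ}
    (hf : ∀ F, Continuous (f F)) (hg : ∀ F, Continuous (g F)) :
    facesInt G (fun F x => f F x + g F x) = facesInt G f + facesInt G g := by
  unfold facesInt
  rw [← Finset.sum_add_distrib]
  exact Finset.sum_congr rfl fun F hF => hn.faceInt_add hd (hG hF) (hf F) (hg F)

lemma facesInt_const_mul (G : Finset (Finset (E d))) (c : ℝ) (f : Finset (E d) → E d → ℝ) :
    facesInt G (fun F x => c * f F x) = c * facesInt G f := by
  unfold facesInt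
  rw [Finset.mul_sum]
  exact Finset.sum_congr rfl fun F _ => faceInt_const_mul F c _

lemma IsNormalField.facesInt_facets (hn : T.IsNormalField n) (hd : 1 ≤ d)
    (f : Finset (E d) → E d → ℝ) :
    facesInt T.facets f = facesInt T.facetsI f + facesInt T.facetsB f :=
  hn.sum_facets hd _

lemma facesInt_mono_set {G G' : Finset (Finset (E d))} (hG : G ⊆ G')
    {f : Finset (E d) → E d → ℝ} (h : ∀ F ∈ G', ∀ x, 0 ≤ f F x) :
    facesInt G f ≤ facesInt G' f :=
  Finset.sum_le_sum_of_subset_of_nonneg hG fun F hF _ => faceInt_nonneg (h F hF)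

/-- A weighted Young inequality for sums of integrals over faces. -/
lemma IsNormalField.abs_facesInt_mul_le (hn : T.IsNormalField n) (hd : 1 ≤ d)
    {G : Finset (Finset (E d))} (hG : G ⊆ T.facets) {w : Finset (E d) → ℝ}
    (hw : ∀ F ∈ G, 0 < w F) {f g : Finset (E d) → E d → ℝ} (hf : ∀ F, Continuous (f F))
    (hg : ∀ F, Continuous (g F)) {ε : ℝ} (hε : 0 < ε) :
    facesInt G (fun F x => |f F x * g F x|) ≤
      ε * facesInt G (fun F x => w F * (f F x) ^ 2) +
        (4 * ε)⁻¹ * facesInt G (fun F x => (w F)⁻¹ * (g F x) ^ 2) := by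
  rw [← facesInt_const_mul, ← facesInt_const_mul, ← hn.facesInt_add hd hG
    (fun F => by have := hf F; fun_prop) (fun F => by have := hg F; fun_prop)]
  refine hn.facesInt_mono hd hG (fun F => by have := hf F; have := hg F; fun_prop)
    (fun F => by have := hf F; have := hg F; fun_prop) fun F hF x _ => ?_
  have hwF := hw F hF
  -- The difference of the two sides is a multiple of (2εwa - b)².
  have key : ∀ a b : ℝ, a * b ≤ ε * (w F * a ^ 2) + (4 * ε)⁻¹ * ((w F)⁻¹ * b ^ 2) := by
    intro a b
    have h1 : ε * (w F * a ^ 2) + (4 * ε)⁻¹ * ((w F)⁻¹ * b ^ 2) - a * b =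
        (4 * ε * w F)⁻¹ * (2 * ε * w F * a - b) ^ 2 := by
      field_simp; ring
    have h2 : 0 ≤ (4 * ε * w F)⁻¹ * (2 * ε * w F * a - b) ^ 2 := by positivity
    linarith
  refine abs_le'.2 ⟨key _ _, ?_⟩
  have := key (-f F x) (g F x)
  simpa using this

lemma abs_facesInt_le (G : Finset (Finset (E d))) (f : Finset (E d) → E d → ℝ) :
    |facesInt G f| ≤ facesInt G (fun F x => |f F x|) :=
  (Finset.abs_sum_le_sum_abs _ _).trans
    (Finset.sum_le_sum fun _ _ => abs_integral_le_integral_abs)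

lemma elemInt_add {f g : T.elems → E d → ℝ} (hf : ∀ K, IntegrableOn (f K) (hull K.1))
    (hg : ∀ K, IntegrableOn (g K) (hull K.1)) :
    T.elemInt (fun K x => f K x + g K x) = T.elemInt f + T.elemInt g := by
  unfold elemInt
  rw [← Finset.sum_add_distrib]
  exact Finset.sum_congr rfl fun K _ => integral_add (hf K) (hg K)

lemma elemInt_sub {f g : T.elems → E d → ℝ} (hf : ∀ K, IntegrableOn (f K) (hull K.1))
    (hg : ∀ K, IntegrableOn (g K) (hull K.1)) :
    T.elemInt (fun K x => f K x - g K x) = T.elemInt f - T.elemInt g := by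
  unfold elemInt
  rw [← Finset.sum_sub_distrib]
  exact Finset.sum_congr rfl fun K _ => integral_sub (hf K) (hg K)

lemma elemInt_const_mul (c : ℝ) (f : T.elems → E d → ℝ) :
    T.elemInt (fun K x => c * f K x) = c * T.elemInt f := by
  unfold elemInt
  rw [Finset.mul_sum]
  exact Finset.sum_congr rfl fun K _ => integral_const_mul _ _

lemma elemInt_sum {ι : Type*} (s : Finset ι) {f : ι → T.elems → E d → ℝ}
    (hf : ∀ i K, IntegrableOn (f i K) (hull K.1)) :
    T.elemInt (fun K x => ∑ i ∈ s, f i K x) = ∑ i ∈ s, T.elemInt (f i) := by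
  unfold elemInt
  rw [Finset.sum_comm]
  exact Finset.sum_congr rfl fun K _ => integral_finsetSum _ fun i _ => hf i K

lemma elemInt_mono {f g : T.elems → E d → ℝ} (hf : ∀ K, IntegrableOn (f K) (hull K.1))
    (hg : ∀ K, IntegrableOn (g K) (hull K.1)) (h : ∀ K, ∀ x ∈ hull K.1, f K x ≤ g K x) :
    T.elemInt f ≤ T.elemInt g :=
  Finset.sum_le_sum fun K _ => setIntegral_mono_on (hf K) (hg K) (measurableSet_hull _) (h K)

lemma elemInt_nonneg {f : T.elems → E d → ℝ} (h : ∀ K x, 0 ≤ f K x) : 0 ≤ T.elemInt f :=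
  Finset.sum_nonneg fun K _ => integral_nonneg (h K)

/-- The square of the `L²` norm of a piecewise polynomial. -/
def l2Sq (T : Mesh Ω) (v : T.PwPoly) : ℝ := T.elemInt (fun K x => (ev (v K) x) ^ 2)

/-- `∫_Ω |∇v|²`. -/
def gradSq (T : Mesh Ω) (v : T.PwPoly) : ℝ :=
  T.elemInt (fun K x => ∑ i, (ev (gradP (v K) i) x) ^ 2)

lemma l2Sq_nonneg (v : T.PwPoly) : 0 ≤ T.l2Sq v := elemInt_nonneg fun _ _ => sq_nonneg _

lemma gradSq_nonneg (v : T.PwPoly) : 0 ≤ T.gradSq v :=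
  elemInt_nonneg fun _ _ => Finset.sum_nonneg fun _ _ => sq_nonneg _

lemma hessSq_nonneg (v : T.PwPoly) : 0 ≤ T.hessSq v :=
  elemInt_nonneg fun _ _ => Finset.sum_nonneg fun _ _ => Finset.sum_nonneg fun _ _ => sq_nonneg _

lemma normSq_eq (v : T.PwPoly) :
    T.normSq n v = T.hessSq v + T.gradSq v + T.l2Sq v + T.jumpSq n v := by
  unfold normSq hessSq gradSq l2Sq
  rw [elemInt_add (fun K => integrableOn_hull _ (by fun_prop))
      (fun K => integrableOn_hull _ (by fun_prop)),
    elemInt_add (fun K => integrableOn_hull _ (by fun_prop))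
      (fun K => integrableOn_hull _ (by fun_prop))]

/-! ### Jumps and averages -/

lemma ev_jump (F : Finset (E d)) (v : T.PwPoly) (x : E d) :
    ev (T.jump n F v) x = ∑ K ∈ T.adj F, side n F K.1 * ev (v K) x := by
  simp [jump]

lemma ev_avg (F : Finset (E d)) (v : T.PwPoly) (x : E d) :
    ev (T.avg F v) x = ((T.adj F).card : ℝ)⁻¹ * ∑ K ∈ T.adj F, ev (v K) x := by
  simp [avg]

lemma ev_avg_sq_le (F : Finset (E d)) (v : T.PwPoly) (x : E d) :
    (ev (T.avg F v) x) ^ 2 ≤ ∑ K ∈ T.adj F, (ev (v K) x) ^ 2 := by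
  rw [ev_avg]
  have hS : 0 ≤ ∑ K ∈ T.adj F, (ev (v K) x) ^ 2 := Finset.sum_nonneg fun _ _ => sq_nonneg _
  rcases Nat.eq_zero_or_pos (T.adj F).card with h | h
  · simp [h, hS]
  have h1 : (1 : ℝ) ≤ (T.adj F).card := by exact_mod_cast h
  have h2 := sq_sum_le_card_mul_sum_sq (s := T.adj F) (f := fun K => ev (v K) x)
  rw [mul_pow]
  calc (((T.adj F).card : ℝ)⁻¹) ^ 2 * (∑ K ∈ T.adj F, ev (v K) x) ^ 2
      ≤ (((T.adj F).card : ℝ)⁻¹) ^ 2 * ((T.adj F).card * ∑ K ∈ T.adj F, (ev (v K) x) ^ 2) := by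
        gcongr
    _ = ((T.adj F).card : ℝ)⁻¹ * ∑ K ∈ T.adj F, (ev (v K) x) ^ 2 := by field_simp
    _ ≤ 1 * ∑ K ∈ T.adj F, (ev (v K) x) ^ 2 := by
        gcongr
        exact inv_le_one_of_one_le₀ h1
    _ = _ := one_mul _

/-- Sums over faces of integrals of averages are bounded by sums over elements. -/
lemma IsNormalField.facesInt_avg_le (hn : T.IsNormalField n) (hd : 1 ≤ d) (v : T.PwPoly)
    {w : Finset (E d) → ℝ} (hw : ∀ F ∈ T.facets, 0 ≤ w F) {m : T.elems → ℝ} (hm : ∀ K, 0 ≤ m K)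
    (h : ∀ F ∈ T.facets, ∀ K ∈ T.adj F, w F * faceInt F (fun x => (ev (v K) x) ^ 2) ≤ m K) :
    facesInt T.facets (fun F x => w F * (ev (T.avg F v) x) ^ 2) ≤ (d + 1) * ∑ K, m K := by
  classical
  calc facesInt T.facets (fun F x => w F * (ev (T.avg F v) x) ^ 2)
      ≤ ∑ F ∈ T.facets, ∑ K ∈ T.adj F, m K := by
        refine Finset.sum_le_sum fun F hF => ?_
        rw [faceInt_const_mul]
        calc w F * faceInt F (fun x => (ev (T.avg F v) x) ^ 2)
            ≤ w F * faceInt F (fun x => ∑ K ∈ T.adj F, (ev (v K) x) ^ 2) :=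
              mul_le_mul_of_nonneg_left (hn.faceInt_mono hd hF (by fun_prop) (by fun_prop)
                fun x _ => ev_avg_sq_le F v x) (hw F hF)
          _ = ∑ K ∈ T.adj F, w F * faceInt F (fun x => (ev (v K) x) ^ 2) := by
              rw [hn.faceInt_sum hd hF _ (fun K => by fun_prop), Finset.mul_sum]
          _ ≤ _ := Finset.sum_le_sum fun K hK => h F hF K hK
    _ = ∑ K : T.elems, ∑ F ∈ T.facets with F ⊆ K.1, m K := sum_facets_adj (fun _ K => m K)
    _ ≤ ∑ K : T.elems, (d + 1) * m K := by
        refine Finset.sum_le_sum fun K _ => ?_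
        rw [Finset.sum_const, nsmul_eq_mul, facets_filter_eq hd]
        -- Each element is counted once for each of its at most d + 1 facets.
        have h1 : (K.1.image fun v => K.1.erase v).card ≤ d + 1 :=
          Finset.card_image_le.trans (T.card_elem K).le
        have h2 : ((K.1.image fun v => K.1.erase v).card : ℝ) ≤ d + 1 := by exact_mod_cast h1
        exact mul_le_mul_of_nonneg_right h2 (hm K)
    _ = _ := by rw [Finset.mul_sum]

lemma IsNormalField.sum_normal_sq (hn : T.IsNormalField n) {F : Finset (E d)}
    (hF : F ∈ T.facets) : ∑ i, (n F i) ^ 2 = 1 := by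
  have := EuclideanSpace.real_norm_sq_eq (n F)
  rw [hn.norm_eq_one F hF] at this
  simpa using this.symm

/-- The Cauchy-Schwarz inequality for the scalar product with a normal. -/
lemma IsNormalField.sq_sum_normal_le (hn : T.IsNormalField n) {F : Finset (E d)}
    (hF : F ∈ T.facets) (g : Fin d → ℝ) : (∑ i, n F i * g i) ^ 2 ≤ ∑ i, (g i) ^ 2 := by
  have := Finset.sum_mul_sq_le_sq_mul_sq Finset.univ (fun i => n F i) g
  rwa [hn.sum_normal_sq hF, one_mul] at this

lemma ev_jump_normalD (F : Finset (E d)) (v : T.PwPoly) (x : E d) (e : E d) :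
    ev (T.jump n F (fun K => normalD e (v K))) x =
      ∑ i, e i * ev (T.jump n F (fun K => gradP (v K) i)) x := by
  simp only [ev_jump, normalD, gradP, ev_sum, ev_mul, ev_C, Finset.mul_sum]
  rw [Finset.sum_comm]
  exact Finset.sum_congr rfl fun i _ => Finset.sum_congr rfl fun K _ => by ring

lemma ev_avg_normalD (F : Finset (E d)) (v : T.PwPoly) (x : E d) (e : E d) :
    ev (T.avg F (fun K => normalD e (v K))) x =
      ∑ i, e i * ev (T.avg F (fun K => pd i (v K))) x := by
  simp only [ev_avg, normalD, ev_sum, ev_mul, ev_C]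
  rw [Finset.sum_comm, Finset.mul_sum]
  refine Finset.sum_congr rfl fun i _ => ?_
  rw [← Finset.mul_sum]
  ring

/-- The product rule for jumps over interior faces. -/
lemma IsNormalField.ev_jump_mul_interior (hn : T.IsNormalField n) (hd : 1 ≤ d) {F : Finset (E d)}
    (hF : F ∈ T.facetsI) (u v : T.PwPoly) (x : E d) :
    ev (T.jump n F (fun K => u K * v K)) x = ev (T.avg F u) x * ev (T.jump n F v) x +
      ev (T.jump n F u) x * ev (T.avg F v) x := by
  obtain ⟨K, K', hne, ⟨_, hadj⟩, hs, hs'⟩ := hn.interior_facet hd hF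
  rw [ev_jump, ev_jump, ev_jump, ev_avg, ev_avg, (mem_facetsI.1 hF).2, hadj]
  simp only [Finset.sum_pair hne, hs, hs', ev_mul]
  push_cast
  ring

/-- The product rule for jumps on boundary faces. -/
lemma IsNormalField.ev_jump_mul_boundary (hn : T.IsNormalField n) {F : Finset (E d)}
    (hF : F ∈ T.facetsB) (u v : T.PwPoly) (x : E d) :
    ev (T.jump n F (fun K => u K * v K)) x = ev (T.jump n F u) x * ev (T.avg F v) x := by
  obtain ⟨K, hadj, hs⟩ := hn.boundary_facet hF
  rw [ev_jump, ev_jump, ev_avg, hadj]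
  simp [hs]

/-- Elementwise integration by parts for `∫_Ω (|∇v|² + v Δv)`. -/
lemma IsNormalField.elemInt_grad_add (hn : T.IsNormalField n) (hd : 1 ≤ d) (v : T.PwPoly) :
    T.elemInt (fun K x => ∑ i, (ev (gradP (v K) i) x) ^ 2 + ev (v K) x * ev (lapP (v K)) x) =
      facesInt T.facetsI (fun F x => ev (T.avg F v) x *
        ev (T.jump n F (fun K => normalD (n F) (v K))) x) +
      facesInt T.facets (fun F x => ev (T.jump n F v) x *
        ev (T.avg F (fun K => normalD (n F) (v K))) x) := by
  -- The divergence of v∇v is |∇v|² + vΔv, and its normal component is v times the normal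
  -- derivative.
  have h1 := hn.elemInt_div hd (fun K i => v K * pd i (v K))
  have h2 : T.elemInt (fun K x => ∑ i, ev (pd i (v K * pd i (v K))) x) =
      T.elemInt (fun K x => ∑ i, (ev (gradP (v K) i) x) ^ 2 + ev (v K) x * ev (lapP (v K)) x) := by
    congr 1
    ext K x
    simp only [pd_mul, ev_add, ev_mul, Finset.sum_add_distrib, gradP, lapP, hessP, ev_sum,
      Finset.mul_sum, sq]
  have h3 : facesInt T.facets (fun F => ev (T.jump n F
        (fun K => ∑ i, MvPolynomial.C (n F i) * (v K * pd i (v K))))) =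
      facesInt T.facets (fun F => ev (T.jump n F (fun K => v K * normalD (n F) (v K)))) := by
    congr 1
    ext F x
    congr 2
    ext1 K
    rw [normalD, Finset.mul_sum]
    exact Finset.sum_congr rfl fun i _ => by ring
  rw [← h2, h1, h3, hn.facesInt_facets hd, hn.facesInt_facets hd (fun F x => ev (T.jump n F v) x *
    ev (T.avg F (fun K => normalD (n F) (v K))) x), ← add_assoc]
  refine congrArg₂ (· + ·) ?_ ?_
  · rw [← hn.facesInt_add hd facetsI_subset (fun F => by fun_prop) (fun F => by fun_prop)]
    exact facesInt_congr fun F hF x => hn.ev_jump_mul_interior hd hF _ _ x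
  · exact facesInt_congr fun F hF x => hn.ev_jump_mul_boundary hF _ _ x

end Mesh

/-! ### The discrete Poincaré–Friedrichs inequality. -/

namespace Mesh

variable {d : ℕ} {Ω : Set (E d)} {T : Mesh Ω} {n : Finset (E d) → E d} {p : ℕ} {C D : ℝ}

/-- The bounds of `FaceBounds` hold for all elements and facets of the mesh. -/
def HasFaceBounds (T : Mesh Ω) (p : ℕ) (D C : ℝ) : Prop :=
  ∀ F ∈ T.facets, ∀ K ∈ T.adj F, FaceBounds F K.1 p D C

lemma HasFaceBounds.hFace_pos (hb : T.HasFaceBounds p D C) {F : Finset (E d)}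
    (hF : F ∈ T.facets) : 0 < hFace F := by
  obtain ⟨K, hK⟩ := adj_nonempty hF
  exact (hb F hF K hK).pos

lemma HasFaceBounds.hFace_le (hb : T.HasFaceBounds p D C) {F : Finset (E d)}
    (hF : F ∈ T.facets) : hFace F ≤ C * D := by
  obtain ⟨K, hK⟩ := adj_nonempty hF
  exact (hb F hF K hK).le_diam

/-- The part of the jump seminorm that involves the gradients. -/
def jumpGradSq (T : Mesh Ω) (n : Finset (E d) → E d) (v : T.PwPoly) : ℝ :=
  facesInt T.facetsI (fun F x =>
      (hFace F)⁻¹ * ∑ i, (ev (T.jump n F (fun K => gradP (v K) i)) x) ^ 2)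

/-- The part of the jump seminorm that involves the values. -/
def jumpValSq (T : Mesh Ω) (n : Finset (E d) → E d) (v : T.PwPoly) : ℝ :=
  facesInt T.facets (fun F x => (hFace F ^ 3)⁻¹ * (ev (T.jump n F v) x) ^ 2)

lemma jumpSq_eq (v : T.PwPoly) : T.jumpSq n v = T.jumpGradSq n v + T.jumpValSq n v := rfl

lemma HasFaceBounds.jumpGradSq_nonneg (hb : T.HasFaceBounds p D C) (v : T.PwPoly) :
    0 ≤ T.jumpGradSq n v :=
  facesInt_nonneg fun F hF x => by
    have := hb.hFace_pos (facetsI_subset hF)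
    positivity

lemma HasFaceBounds.jumpValSq_nonneg (hb : T.HasFaceBounds p D C) (v : T.PwPoly) :
    0 ≤ T.jumpValSq n v :=
  facesInt_nonneg fun F hF x => by
    have := hb.hFace_pos hF
    positivity

lemma HasFaceBounds.jumpSq_nonneg (hb : T.HasFaceBounds p D C) (v : T.PwPoly) :
    0 ≤ T.jumpSq n v := add_nonneg (hb.jumpGradSq_nonneg v) (hb.jumpValSq_nonneg v)

lemma sum_integral_eq_l2Sq (v : T.PwPoly) (c : ℝ) :
    ∑ K : T.elems, c * ∫ x in hull K.1, (ev (v K) x) ^ 2 = c * T.l2Sq v := by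
  rw [l2Sq, elemInt, Finset.mul_sum]

lemma HasFaceBounds.facesInt_avg_sq_le (hb : T.HasFaceBounds p D C) (hn : T.IsNormalField n)
    (hd : 1 ≤ d) (hC : 0 ≤ C) {v : T.PwPoly} (hv : v ∈ T.V0 p) :
    facesInt T.facets (fun F x => hFace F * (ev (T.avg F v) x) ^ 2) ≤
      (d + 1) * (C * T.l2Sq v) := by
  rw [← sum_integral_eq_l2Sq]
  exact hn.facesInt_avg_le hd v (fun F hF => (hb.hFace_pos hF).le)
    (fun K => mul_nonneg hC (integral_nonneg fun _ => sq_nonneg _))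
    fun F hF K hK => (hb F hF K hK).trace _ (hv K)

/-- Of the weight h³, one power pays for the trace inequality and two for the inverse inequality.
This weight is dual to the h⁻³ on jumps of values. -/
lemma HasFaceBounds.facesInt_avg_pd_sq_le (hb : T.HasFaceBounds p D C) (hn : T.IsNormalField n)
    (hd : 1 ≤ d) (hC : 0 ≤ C) {v : T.PwPoly} (hv : v ∈ T.V0 p) (i : Fin d) :
    facesInt T.facets (fun F x => hFace F ^ 3 * (ev (T.avg F (fun K => pd i (v K))) x) ^ 2) ≤
      (d + 1) * (C ^ 2 * T.l2Sq v) := by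
  rw [← sum_integral_eq_l2Sq]
  refine hn.facesInt_avg_le hd _ (fun F hF => (pow_pos (hb.hFace_pos hF) 3).le)
    (fun K => mul_nonneg (by positivity) (integral_nonneg fun _ => sq_nonneg _))
    fun F hF K hK => ?_
  have hB := hb F hF K hK
  have hh := hB.pos
  have h1 := hB.trace (pd i (v K)) ((totalDegree_pd_le i _).trans (hv K))
  have h2 := hB.inverse (v K) (hv K) i
  calc hFace F ^ 3 * faceInt F (fun x => (ev (pd i (v K)) x) ^ 2)
      = hFace F ^ 2 * (hFace F * faceInt F (fun x => (ev (pd i (v K)) x) ^ 2)) := by ring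
    _ ≤ hFace F ^ 2 * (C * ∫ x in hull K.1, (ev (pd i (v K)) x) ^ 2) :=
        mul_le_mul_of_nonneg_left h1 (by positivity)
    _ = C * (hFace F ^ 2 * ∫ x in hull K.1, (ev (pd i (v K)) x) ^ 2) := by ring
    _ ≤ C * (C * ∫ x in hull K.1, (ev (v K) x) ^ 2) := mul_le_mul_of_nonneg_left h2 hC
    _ = _ := by ring

lemma HasFaceBounds.facesInt_avg_normalD_sq_le (hb : T.HasFaceBounds p D C)
    (hn : T.IsNormalField n) (hd : 1 ≤ d) (hC : 0 ≤ C) {v : T.PwPoly} (hv : v ∈ T.V0 p) :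
    facesInt T.facets (fun F x => hFace F ^ 3 *
      (ev (T.avg F (fun K => normalD (n F) (v K))) x) ^ 2) ≤
      d * ((d + 1) * (C ^ 2 * T.l2Sq v)) := by
  have h1 : ∑ i : Fin d, facesInt T.facets (fun F x => hFace F ^ 3 *
      (ev (T.avg F (fun K => pd i (v K))) x) ^ 2) ≤
      ∑ _i : Fin d, (d + 1) * (C ^ 2 * T.l2Sq v) :=
    Finset.sum_le_sum fun i _ => hb.facesInt_avg_pd_sq_le hn hd hC hv i
  rw [Finset.sum_const, Finset.card_univ, Fintype.card_fin, nsmul_eq_mul] at h1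
  refine le_trans ?_ h1
  unfold facesInt
  rw [Finset.sum_comm]
  refine Finset.sum_le_sum fun F hF => ?_
  rw [← hn.faceInt_sum hd hF _ (fun i => by fun_prop)]
  refine hn.faceInt_mono hd hF (by fun_prop) (by fun_prop) fun x _ => ?_
  beta_reduce
  rw [← Finset.mul_sum, ev_avg_normalD]
  have := hb.hFace_pos hF
  exact mul_le_mul_of_nonneg_left (hn.sq_sum_normal_le hF _) (by positivity)

lemma HasFaceBounds.facesInt_jump_normalD_le (hb : T.HasFaceBounds p D C)
    (hn : T.IsNormalField n) (hd : 1 ≤ d) (v : T.PwPoly) :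
    facesInt T.facetsI (fun F x => (hFace F)⁻¹ *
      (ev (T.jump n F (fun K => normalD (n F) (v K))) x) ^ 2) ≤ T.jumpGradSq n v := by
  refine hn.facesInt_mono hd facetsI_subset (fun F => by fun_prop) (fun F => by fun_prop)
    fun F hF x _ => ?_
  have := hb.hFace_pos (facetsI_subset hF)
  rw [ev_jump_normalD]
  exact mul_le_mul_of_nonneg_left (hn.sq_sum_normal_le (facetsI_subset hF) _) (by positivity)

/-- The defect in the integration by parts of `∫_Ω (|∇v|² + v Δv)` is controlled by the jumps. -/
lemma HasFaceBounds.abs_elemInt_grad_add_le (hb : T.HasFaceBounds p D C)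
    (hn : T.IsNormalField n) (hd : 1 ≤ d) (hC : 0 ≤ C) {v : T.PwPoly} (hv : v ∈ T.V0 p)
    {ε : ℝ} (hε : 0 < ε) :
    |T.elemInt (fun K x => ∑ i, (ev (gradP (v K) i) x) ^ 2 + ev (v K) x * ev (lapP (v K)) x)| ≤
      ε * ((d + 1) * (C + d * C ^ 2) * T.l2Sq v) + (4 * ε)⁻¹ * T.jumpSq n v := by
  rw [hn.elemInt_grad_add hd]
  -- The weight h pairs averages of v with jumps of its normal derivative; below, h³ pairs averages
  -- of the normal derivative with jumps of v.
  have h1 := hn.abs_facesInt_mul_le hd (facetsI_subset (T := T)) (w := hFace)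
    (fun F hF => hb.hFace_pos (facetsI_subset hF)) (f := fun F => ev (T.avg F v))
    (g := fun F => ev (T.jump n F (fun K => normalD (n F) (v K))))
    (fun F => by fun_prop) (fun F => by fun_prop) hε
  have h2 := hn.abs_facesInt_mul_le hd (subset_refl T.facets) (w := fun F => hFace F ^ 3)
    (fun F hF => pow_pos (hb.hFace_pos hF) 3)
    (f := fun F => ev (T.avg F (fun K => normalD (n F) (v K))))
    (g := fun F => ev (T.jump n F v)) (fun F => by fun_prop) (fun F => by fun_prop) hε
  have h3 : facesInt T.facetsI (fun F x => hFace F * (ev (T.avg F v) x) ^ 2) ≤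
      (d + 1) * (C * T.l2Sq v) :=
    (facesInt_mono_set facetsI_subset fun F hF x => by
      have := hb.hFace_pos hF
      positivity).trans (hb.facesInt_avg_sq_le hn hd hC hv)
  have h4 := hb.facesInt_avg_normalD_sq_le hn hd hC hv
  have h5 := hb.facesInt_jump_normalD_le hn hd v
  have h6 := (abs_facesInt_le T.facetsI (fun F x => ev (T.avg F v) x *
        ev (T.jump n F (fun K => normalD (n F) (v K))) x)).trans h1
  have h7 := (abs_facesInt_le T.facets (fun F x => ev (T.avg F (fun K => normalD (n F) (v K))) x *
        ev (T.jump n F v) x)).trans h2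
  have h8 : facesInt T.facets (fun F x => ev (T.jump n F v) x *
      ev (T.avg F (fun K => normalD (n F) (v K))) x) = facesInt T.facets
      (fun F x => ev (T.avg F (fun K => normalD (n F) (v K))) x * ev (T.jump n F v) x) :=
    facesInt_congr fun F _ x => mul_comm _ _
  rw [h8]
  refine (abs_add_le _ _).trans ((add_le_add h6 h7).trans ?_)
  rw [jumpSq_eq]
  have h9 : (4 * ε)⁻¹ * facesInt T.facetsI (fun F x => (hFace F)⁻¹ *
      (ev (T.jump n F (fun K => normalD (n F) (v K))) x) ^ 2) ≤ (4 * ε)⁻¹ * T.jumpGradSq n v :=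
    mul_le_mul_of_nonneg_left h5 (by positivity)
  have h10 := mul_le_mul_of_nonneg_left h3 hε.le
  have h11 := mul_le_mul_of_nonneg_left h4 hε.le
  have h12 : (4 * ε)⁻¹ * facesInt T.facets (fun F x => (hFace F ^ 3)⁻¹ *
      (ev (T.jump n F v) x) ^ 2) = (4 * ε)⁻¹ * T.jumpValSq n v := rfl
  linarith

lemma sq_lapP_le (P : Poly d) (x : E d) :
    (ev (lapP P) x) ^ 2 ≤ d * ∑ i, ∑ j, (ev (hessP P i j) x) ^ 2 := by
  rw [lapP, ev_sum]
  have h := sq_sum_le_card_mul_sum_sq (s := Finset.univ) (f := fun i => ev (hessP P i i) x)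
  rw [Finset.card_univ, Fintype.card_fin] at h
  refine h.trans (mul_le_mul_of_nonneg_left (Finset.sum_le_sum fun i _ => ?_) (by positivity))
  exact Finset.single_le_sum (f := fun j => (ev (hessP P i j) x) ^ 2)
    (fun j _ => sq_nonneg _) (Finset.mem_univ i)

lemma elemInt_lap_sq_le (v : T.PwPoly) :
    T.elemInt (fun K x => (ev (lapP (v K)) x) ^ 2) ≤ d * T.hessSq v := by
  rw [hessSq, ← elemInt_const_mul]
  exact elemInt_mono (fun K => integrableOn_hull _ (by fun_prop))
    (fun K => integrableOn_hull _ (by fun_prop)) fun K x _ => sq_lapP_le _ _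

/-- The discrete gradient is controlled by the values, second derivatives and jumps. -/
lemma HasFaceBounds.gradSq_le (hb : T.HasFaceBounds p D C)
    (hn : T.IsNormalField n) (hd : 1 ≤ d) (hC : 0 ≤ C) {v : T.PwPoly} (hv : v ∈ T.V0 p)
    {ε : ℝ} (hε : 0 < ε) :
    T.gradSq v ≤ ε * (((d + 1) * (C + d * C ^ 2) + 1) * T.l2Sq v) +
      (4 * ε)⁻¹ * (d * T.hessSq v + T.jumpSq n v) := by
  have h1 := (abs_le.1 (hb.abs_elemInt_grad_add_le hn hd hC hv hε)).2
  rw [elemInt_add (f := fun K x => ∑ i, (ev (gradP (v K) i) x) ^ 2)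
    (fun K => integrableOn_hull _ (by fun_prop))
    (fun K => integrableOn_hull _ (by fun_prop))] at h1
  -- What remains of the identity is -∫vΔv, treated by Young's inequality with the same ε.
  have h2 : -T.elemInt (fun K x => ev (v K) x * ev (lapP (v K)) x) ≤
      ε * T.l2Sq v + (4 * ε)⁻¹ * (d * T.hessSq v) := by
    refine le_trans ?_ (add_le_add le_rfl
      (mul_le_mul_of_nonneg_left (elemInt_lap_sq_le v) (by positivity)))
    rw [l2Sq, ← elemInt_const_mul, ← elemInt_const_mul, ← elemInt_add
      (fun K => integrableOn_hull _ (by fun_prop)) (fun K => integrableOn_hull _ (by fun_prop)),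
      neg_eq_neg_one_mul, ← elemInt_const_mul]
    refine elemInt_mono (fun K => integrableOn_hull _ (by fun_prop))
      (fun K => integrableOn_hull _ (by fun_prop)) fun K x _ => ?_
    generalize ev (v K) x = a
    generalize ev (lapP (v K)) x = b
    have h3 : ε * a ^ 2 + (4 * ε)⁻¹ * b ^ 2 - (-1 * (a * b)) = (4 * ε)⁻¹ * (2 * ε * a + b) ^ 2 := by
      field_simp; ring
    have h4 : 0 ≤ (4 * ε)⁻¹ * (2 * ε * a + b) ^ 2 := by positivity
    linarith
  change T.gradSq v + _ ≤ _ at h1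
  linarith

lemma hull_subset_closure_of_mem_facets {F : Finset (E d)} (hF : F ∈ T.facets) :
    hull F ⊆ closure Ω := by
  rw [← T.space_eq]
  exact T.convexHull_subset_space (T.mem_facets.1 hF).1

/-- A discrete Friedrichs inequality. -/
lemma HasFaceBounds.l2Sq_le (hb : T.HasFaceBounds p D C)
    (hn : T.IsNormalField n) (hd : 1 ≤ d) (hC : 0 < C) (hΩ : Bornology.IsBounded Ω)
    (hne : Ω.Nonempty) (hD : D = Metric.diam Ω) (hD0 : 0 < D) {v : T.PwPoly}
    (hv : v ∈ T.V0 p) :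
    T.l2Sq v ≤ 8 * D ^ 2 * T.gradSq v + 32 * (d + 1) * C ^ 3 * D ^ 4 * T.jumpValSq n v := by
  obtain ⟨a, ha⟩ := hne
  let i0 : Fin d := ⟨0, by omega⟩
  have hdist : ∀ x ∈ closure Ω, |x i0 - a i0| ≤ D := by
    intro x hx
    have h1 := Metric.dist_le_diam_of_mem hΩ.closure hx (subset_closure ha)
    rw [Metric.diam_closure, ← hD, dist_eq_norm] at h1
    exact le_trans (by simpa using PiLp.norm_apply_le (x - a) i0) h1
  set Y : Poly d := MvPolynomial.X i0 - MvPolynomial.C (a i0) with hY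
  have hevY : ∀ x, ev Y x = x i0 - a i0 := by intro x; simp [hY]
  -- The field v²(x₀ - a₀)e₀ has divergence v² + 2v ∂₀v (x₀ - a₀), and |x₀ - a₀| ≤ D on the closure
  -- of Ω.
  have h1 := hn.elemInt_div hd (fun K i => if i = i0 then v K * v K * Y else 0)
  have h2 : T.elemInt (fun K x => ∑ i, ev (pd i (if i = i0 then v K * v K * Y else 0)) x) =
      T.elemInt (fun K x => 2 * (ev (v K) x * ev (pd i0 (v K)) x * ev Y x) + (ev (v K) x) ^ 2) := by
    congr 1
    ext K x
    rw [Finset.sum_eq_single i0]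
    · simp [hY]; ring
    · intro i _ hi; simp [hi]
    · simp
  have h3 : facesInt T.facets (fun F => ev (T.jump n F (fun K => ∑ i, MvPolynomial.C (n F i) *
      (if i = i0 then v K * v K * Y else 0)))) ≤
      facesInt T.facets (fun F x => 2 * D * |ev (T.avg F v) x * ev (T.jump n F v) x|) := by
    refine hn.facesInt_mono hd (subset_refl _) (fun F => by fun_prop) (fun F => by fun_prop)
      fun F hF x hx => ?_
    have e1 : ev (T.jump n F (fun K => ∑ i, MvPolynomial.C (n F i) *
        (if i = i0 then v K * v K * Y else 0))) x =
        (n F i0 * ev Y x) * ev (T.jump n F (fun K => v K * v K)) x := by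
      rw [ev_jump, ev_jump, Finset.mul_sum]
      refine Finset.sum_congr rfl fun K _ => ?_
      simp; ring
    have hni : |n F i0| ≤ 1 := by
      have := PiLp.norm_apply_le (n F) i0
      rwa [hn.norm_eq_one F hF, Real.norm_eq_abs] at this
    have hYx : |ev Y x| ≤ D := by
      rw [hevY]; exact hdist x (hull_subset_closure_of_mem_facets hF hx)
    -- The jump of v² is 2{v}[v] on interior faces and {v}[v] on boundary faces.
    have e2 : |ev (T.jump n F (fun K => v K * v K)) x| ≤
        2 * |ev (T.avg F v) x * ev (T.jump n F v) x| := by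
      rcases hn.facets_cases hd hF with hI | hB
      · rw [hn.ev_jump_mul_interior hd hI, mul_comm (ev (T.jump n F v) x), ← two_mul, abs_mul]
        simp
      · rw [hn.ev_jump_mul_boundary hB, mul_comm (ev (T.jump n F v) x)]
        linarith [abs_nonneg (ev (T.avg F v) x * ev (T.jump n F v) x)]
    rw [e1]
    calc _ ≤ |(n F i0 * ev Y x) * ev (T.jump n F (fun K => v K * v K)) x| := le_abs_self _
      _ = (|n F i0| * |ev Y x|) * |ev (T.jump n F (fun K => v K * v K)) x| := by
          rw [abs_mul, abs_mul]
      _ ≤ (1 * D) * (2 * |ev (T.avg F v) x * ev (T.jump n F v) x|) := by gcongr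
      _ = _ := by ring
  have h4 : T.elemInt (fun K x => -(4⁻¹ * (ev (v K) x) ^ 2) -
      4 * D ^ 2 * ∑ i, (ev (gradP (v K) i) x) ^ 2) ≤
      T.elemInt (fun K x => 2 * (ev (v K) x * ev (pd i0 (v K)) x * ev Y x)) := by
    refine elemInt_mono (fun K => integrableOn_hull _ (by fun_prop))
      (fun K => integrableOn_hull _ (by fun_prop)) fun K x hx => ?_
    have hYx : |ev Y x| ≤ D := by
      rw [hevY]; exact hdist x (T.hull_subset_closure K hx)
    have hY2 : (ev Y x) ^ 2 ≤ D ^ 2 := sq_le_sq' (abs_le.1 hYx).1 (abs_le.1 hYx).2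
    have hg : (ev (pd i0 (v K)) x) ^ 2 ≤ ∑ i, (ev (gradP (v K) i) x) ^ 2 :=
      Finset.single_le_sum (f := fun i => (ev (gradP (v K) i) x) ^ 2)
        (fun i _ => sq_nonneg _) (Finset.mem_univ i0)
    have h5 : (ev (pd i0 (v K)) x) ^ 2 * (ev Y x) ^ 2 ≤
        (∑ i, (ev (gradP (v K) i) x) ^ 2) * D ^ 2 := by gcongr
    nlinarith [sq_nonneg (2⁻¹ * ev (v K) x + 2 * (ev (pd i0 (v K)) x * ev Y x))]
  -- With this ε, the averages on the faces, multiplied by 2D, cost ∫v²/4. Another quarter is lost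
  -- in the volume term, so half of ∫v² survives.
  have hε : 0 < (8 * D * C * (d + 1))⁻¹ := by positivity
  have h5 := hn.abs_facesInt_mul_le hd (subset_refl T.facets) (w := hFace)
    (fun F hF => hb.hFace_pos hF) (f := fun F => ev (T.avg F v))
    (g := fun F => ev (T.jump n F v)) (fun F => by fun_prop) (fun F => by fun_prop) hε
  have h6 := hb.facesInt_avg_sq_le hn hd hC.le hv
  -- The weight h⁻¹ = h² h⁻³ is at most (CD)² h⁻³, since h ≤ CD.
  have h7 : facesInt T.facets (fun F x => (hFace F)⁻¹ * (ev (T.jump n F v) x) ^ 2) ≤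
      (C * D) ^ 2 * T.jumpValSq n v := by
    rw [jumpValSq, ← facesInt_const_mul]
    refine hn.facesInt_mono hd (subset_refl _) (fun F => by fun_prop) (fun F => by fun_prop)
      fun F hF x _ => ?_
    have hh := hb.hFace_pos hF
    have hle := hb.hFace_le hF
    have : (hFace F)⁻¹ ≤ (C * D) ^ 2 * (hFace F ^ 3)⁻¹ := by
      have e : (hFace F)⁻¹ = hFace F ^ 2 * (hFace F ^ 3)⁻¹ := by field_simp
      rw [e]
      gcongr
    rw [← mul_assoc]
    gcongr
  rw [h2] at h1
  rw [elemInt_add (fun K => integrableOn_hull _ (by fun_prop))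
    (fun K => integrableOn_hull _ (by fun_prop))] at h1
  have h8 : T.elemInt (fun K x => -(4⁻¹ * (ev (v K) x) ^ 2) -
      4 * D ^ 2 * ∑ i, (ev (gradP (v K) i) x) ^ 2) = -(4⁻¹ * T.l2Sq v) - 4 * D ^ 2 * T.gradSq v := by
    rw [elemInt_sub (fun K => integrableOn_hull _ (by fun_prop))
      (fun K => integrableOn_hull _ (by fun_prop)), elemInt_const_mul, l2Sq, gradSq]
    congr 1
    rw [neg_mul_eq_neg_mul, ← elemInt_const_mul]
    simp
  rw [facesInt_const_mul] at h3
  have h9 := mul_le_mul_of_nonneg_left h6 hε.le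
  have h10 : (4 * (8 * D * C * (d + 1))⁻¹)⁻¹ * facesInt T.facets (fun F x => (hFace F)⁻¹ *
      (ev (T.jump n F v) x) ^ 2) ≤ (4 * (8 * D * C * (d + 1))⁻¹)⁻¹ *
        ((C * D) ^ 2 * T.jumpValSq n v) := mul_le_mul_of_nonneg_left h7 (by positivity)
  have h11 : (8 * D * C * (d + 1))⁻¹ * ((d + 1) * (C * T.l2Sq v)) = T.l2Sq v / (8 * D) := by
    field_simp
  have h12 : (4 * (8 * D * C * (d + 1))⁻¹)⁻¹ * ((C * D) ^ 2 * T.jumpValSq n v) =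
      2 * (d + 1) * C ^ 3 * D ^ 3 * T.jumpValSq n v := by
    field_simp; ring
  have h13 : facesInt T.facets (fun F x => |ev (T.avg F v) x * ev (T.jump n F v) x|) ≤
      T.l2Sq v / (8 * D) + 2 * (d + 1) * C ^ 3 * D ^ 3 * T.jumpValSq n v := by
    linarith
  have h14 := mul_le_mul_of_nonneg_left h13 (by positivity : 0 ≤ 2 * D)
  have h15 : 2 * D * (T.l2Sq v / (8 * D) + 2 * (d + 1) * C ^ 3 * D ^ 3 * T.jumpValSq n v) =
      4⁻¹ * T.l2Sq v + 4 * (d + 1) * C ^ 3 * D ^ 4 * T.jumpValSq n v := by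
    field_simp; ring
  have h16 : 0 ≤ 24 * (d + 1) * C ^ 3 * D ^ 4 * T.jumpValSq n v := by
    have := hb.jumpValSq_nonneg (n := n) v
    positivity
  rw [h15] at h14
  change _ + T.l2Sq v = _ at h1
  linarith

/-- A nonempty domain has an element, hence a facet, and its positive size is at most CD. -/
lemma HasFaceBounds.diam_pos (hb : T.HasFaceBounds p D C) (hd : 1 ≤ d) (hC : 0 < C)
    (hne : Ω.Nonempty) : 0 < D := by
  classical
  obtain ⟨a, ha⟩ := hne
  have h1 : a ∈ T.space := by rw [T.space_eq]; exact subset_closure ha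
  obtain ⟨s, hs, -⟩ := T.mem_space_iff.1 h1
  obtain ⟨t, ht, -, hc⟩ := T.pure_dim s hs
  obtain ⟨v, hv⟩ := elem_nonempty (T := T) ⟨t, T.mem_elems.2 ⟨ht, hc⟩⟩
  have hF := T.erase_mem_facets hd ⟨t, T.mem_elems.2 ⟨ht, hc⟩⟩ hv
  exact (pos_iff_pos_of_mul_pos ((hb.hFace_pos hF).trans_le (hb.hFace_le hF))).1 hC

/-- The square of a discrete Poincaré--Friedrichs constant, in terms of the constant `C` of the
bounds on faces and the diameter `D`. -/
def poincareSq (d : ℕ) (C D : ℝ) : ℝ :=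
  1 + (64 * D ^ 4 + 8 * D ^ 2) * (((d + 1) * (C + d * C ^ 2) + 1) * (d + 1)) +
    (64 * D ^ 4 + 4 * D ^ 2) * ((d + 1) * C ^ 3)

/-- The discrete Poincaré--Friedrichs inequality. -/
lemma HasFaceBounds.isPoincareConst (hb : T.HasFaceBounds p D C)
    (hn : T.IsNormalField n) (hd : 1 ≤ d) (hC : 0 < C) (hΩ : Bornology.IsBounded Ω)
    (hne : Ω.Nonempty) (hD : D = Metric.diam Ω) :
    T.IsPoincareConst n p (Real.sqrt (poincareSq d C D)) := by
  rintro s v ⟨hv, -⟩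
  have hD0 := hb.diam_pos hd hC hne
  set M : ℝ := (d + 1) * (C + d * C ^ 2) + 1 with hM
  have hM0 : 0 < M := by positivity
  have hP0 : 0 ≤ poincareSq d C D := by unfold poincareSq; positivity
  have h1 := hb.l2Sq_le hn hd hC hΩ hne hD hD0 hv
  -- This ε turns the term 8D²∫|∇v|² of the Friedrichs inequality into half of ∫v² plus controlled
  -- terms.
  have h2 := hb.gradSq_le hn hd hC.le hv (ε := (16 * D ^ 2 * M)⁻¹) (by positivity)
  rw [← hM] at h2
  have e1 : (16 * D ^ 2 * M)⁻¹ * (M * T.l2Sq v) = T.l2Sq v / (16 * D ^ 2) := by field_simp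
  have e2 : (4 * (16 * D ^ 2 * M)⁻¹)⁻¹ = 4 * D ^ 2 * M := by field_simp; ring
  rw [e1, e2] at h2
  have hH := hessSq_nonneg v
  have hL := l2Sq_nonneg v
  have hJ := hb.jumpSq_nonneg (n := n) v
  have hJV : T.jumpValSq n v ≤ T.jumpSq n v := by
    rw [jumpSq_eq]; linarith [hb.jumpGradSq_nonneg (n := n) v]
  set X := T.hessSq v + T.jumpSq n v with hX
  have hX0 : 0 ≤ X := by positivity
  have hX1 : d * T.hessSq v + T.jumpSq n v ≤ (d + 1) * X := by
    have : (0 : ℝ) ≤ d := by positivity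
    nlinarith
  have h3 : 32 * (d + 1) * C ^ 3 * D ^ 4 * T.jumpValSq n v ≤ 32 * (d + 1) * C ^ 3 * D ^ 4 * X := by
    gcongr; linarith
  have h4 : 4 * D ^ 2 * M * (d * T.hessSq v + T.jumpSq n v) ≤
      4 * D ^ 2 * M * ((d + 1) * X) := by gcongr
  have h5 : T.l2Sq v ≤ 64 * D ^ 4 * M * ((d + 1) * X) + 64 * (d + 1) * C ^ 3 * D ^ 4 * X := by
    have h6 : 8 * D ^ 2 * T.gradSq v ≤ 8 * D ^ 2 * (T.l2Sq v / (16 * D ^ 2) +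
      4 * D ^ 2 * M * ((d + 1) * X)) := by gcongr; linarith
    have e3 : 8 * D ^ 2 * (T.l2Sq v / (16 * D ^ 2) + 4 * D ^ 2 * M * ((d + 1) * X)) =
      T.l2Sq v / 2 + 32 * D ^ 4 * M * ((d + 1) * X) := by field_simp; ring
    linarith
  have h7 : T.gradSq v ≤ 8 * D ^ 2 * M * ((d + 1) * X) + 4 * (d + 1) * C ^ 3 * D ^ 2 * X := by
    have h8 : T.l2Sq v / (16 * D ^ 2) ≤ (64 * D ^ 4 * M * ((d + 1) * X) +
      64 * (d + 1) * C ^ 3 * D ^ 4 * X) / (16 * D ^ 2) := by gcongr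
    have e4 : (64 * D ^ 4 * M * ((d + 1) * X) +
      64 * (d + 1) * C ^ 3 * D ^ 4 * X) / (16 * D ^ 2) = 4 * D ^ 2 * M * ((d + 1) * X) +
        4 * (d + 1) * C ^ 3 * D ^ 2 * X := by field_simp; ring
    linarith
  have h9 : T.normSq n v ≤ poincareSq d C D * X := by
    rw [normSq_eq, poincareSq, ← hM]
    linarith
  rw [← Real.sqrt_mul hP0]
  exact Real.sqrt_le_sqrt h9

/-- There is a discrete Poincaré--Friedrichs constant that depends only on the dimension, the
shape-regularity, the polynomial degree and the diameter of the domain. -/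
theorem exists_poincareConst : ∃ CPF : ℕ → ℝ → ℕ → ℝ → ℝ,
    ∀ (d : ℕ), 2 ≤ d → ∀ (Ω : Set (E d)), Bornology.IsBounded Ω → Ω.Nonempty →
    ∀ (T : Mesh Ω) (n : Finset (E d) → E d), T.IsNormalField n → ∀ p : ℕ,
      T.IsPoincareConst n p (CPF d T.shapeReg p (Metric.diam Ω)) := by
  have hex : ∀ (d : ℕ) (ϑ : ℝ) (p : ℕ), ∃ C > 0, 2 ≤ d → ∀ (Ω : Set (E d)),
      Bornology.IsBounded Ω → ∀ (T : Mesh Ω) (n : Finset (E d) → E d), T.IsNormalField n →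
      T.shapeReg = ϑ → T.HasFaceBounds p (Metric.diam Ω) C := by
    intro d ϑ p
    by_cases hd : 2 ≤ d
    · obtain ⟨C, hC, h⟩ := exists_faceBounds d p hd ϑ
      exact ⟨C, hC, fun _ Ω hΩ T n hn hT => h Ω hΩ T n hn hT⟩
    -- A dummy value in low dimension makes the constant a function of all d.
    · exact ⟨1, one_pos, fun h => absurd h hd⟩
  choose C hC hb using hex
  refine ⟨fun d ϑ p D => Real.sqrt (poincareSq d (C d ϑ p) D), ?_⟩
  intro d hd Ω hΩ hne T n hn p
  exact (hb d T.shapeReg p hd Ω hΩ T n hn rfl).isPoincareConst hn (by omega) (hC _ _ _) hΩ hne rfl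

end Mesh

/-! ### The Cordes inequality and the stability of inf-sup. -/

section Cordes

/-- The Cauchy–Schwarz inequality in ℝ², in a squared form that can be iterated over the
contributions of a, b and c. -/
lemma sq_add_le_of_sq_le {A B p q P Q : ℝ} (hp : 0 ≤ p) (hq : 0 ≤ q) (hP : 0 ≤ P) (hQ : 0 ≤ Q)
    (hA : A ^ 2 ≤ p * P) (hB : B ^ 2 ≤ q * Q) : (A + B) ^ 2 ≤ (p + q) * (P + Q) := by
  have h1 : (2 * (A * B)) ^ 2 ≤ (p * Q + q * P) ^ 2 := by
    have h2 : A ^ 2 * B ^ 2 ≤ (p * P) * (q * Q) := by gcongr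
    nlinarith [sq_nonneg (p * Q - q * P)]
  have h3 := abs_le_of_sq_le_sq' h1 (by positivity)
  nlinarith [h3.2]

lemma frobInner_sq_le {d : ℕ} (M N : Matrix (Fin d) (Fin d) ℝ) :
    (frobInner M N) ^ 2 ≤ frobSq M * frobSq N := by
  have := Finset.sum_mul_sq_le_sq_mul_sq (Finset.univ : Finset (Fin d × Fin d))
    (fun z => M z.1 z.2) (fun z => N z.1 z.2)
  simpa only [Fintype.sum_prod_type, frobInner, frobSq] using this

lemma frobSq_nonneg {d : ℕ} (M : Matrix (Fin d) (Fin d) ℝ) : 0 ≤ frobSq M :=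
  Finset.sum_nonneg fun _ _ => Finset.sum_nonneg fun _ _ => sq_nonneg _

lemma trace_sq_le {d : ℕ} (M : Matrix (Fin d) (Fin d) ℝ) : M.trace ^ 2 ≤ d * frobSq M := by
  have h := sq_sum_le_card_mul_sum_sq (s := Finset.univ) (f := fun i => M i i)
  rw [Finset.card_univ, Fintype.card_fin] at h
  refine h.trans (mul_le_mul_of_nonneg_left (Finset.sum_le_sum fun i _ => ?_) (by positivity))
  exact Finset.single_le_sum (f := fun j => (M i j) ^ 2) (fun j _ => sq_nonneg _)
    (Finset.mem_univ i)

lemma frobSq_smul_sub_one {d : ℕ} (M : Matrix (Fin d) (Fin d) ℝ) (g : ℝ) :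
    frobSq (g • M - 1) = g ^ 2 * frobSq M - 2 * g * M.trace + d := by
  have h1 : ∀ i j, ((g • M - 1) i j) ^ 2 =
      g ^ 2 * (M i j) ^ 2 - 2 * g * (M i j * if i = j then 1 else 0) + if i = j then 1 else 0 := by
    intro i j
    simp only [Matrix.sub_apply, Matrix.smul_apply, Matrix.one_apply, smul_eq_mul]
    split_ifs <;> ring
  simp only [frobSq, h1, Finset.sum_add_distrib, Finset.sum_sub_distrib, ← Finset.mul_sum]
  simp [Matrix.trace]

lemma frobInner_smul_sub_one {d : ℕ} (M N : Matrix (Fin d) (Fin d) ℝ) (g : ℝ) :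
    frobInner (g • M - 1) N = g * frobInner M N - N.trace := by
  have h1 : ∀ i j, (g • M - 1) i j * N i j =
      g * (M i j * N i j) - if i = j then N i j else 0 := by
    intro i j
    simp only [Matrix.sub_apply, Matrix.smul_apply, Matrix.one_apply, smul_eq_mul]
    split_ifs <;> ring
  simp only [frobInner, h1, Finset.sum_sub_distrib, ← Finset.mul_sum]
  simp [Matrix.trace]

lemma dot_sq_le {d : ℕ} (x y : E d) : (dot x y) ^ 2 ≤ ‖x‖ ^ 2 * ‖y‖ ^ 2 := by
  rw [dot_eq_inner, ← mul_pow, ← sq_abs]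
  gcongr
  exact abs_real_inner_le_norm x y

/-- The Cordes inequality in the absence of lower-order terms. -/
lemma cordes_pure {d : ℕ} {ν : ℝ} (a M : Matrix (Fin d) (Fin d) ℝ) (ha : 0 < frobSq a)
    (hc : (d - 1 + ν) * frobSq a ≤ a.trace ^ 2) :
    (a.trace / frobSq a * frobInner a M - M.trace) ^ 2 ≤ (1 - ν) * frobSq M := by
  rw [← frobInner_smul_sub_one]
  refine (frobInner_sq_le _ _).trans (mul_le_mul_of_nonneg_right ?_ (frobSq_nonneg _))
  rw [frobSq_smul_sub_one]
  have h1 : (d - 1 + ν) ≤ a.trace ^ 2 / frobSq a := (le_div_iff₀ ha).2 hc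
  -- The choice of γ minimizes |γa - I|², with minimum d - (Tr a)²/|a|².
  have h2 : (a.trace / frobSq a) ^ 2 * frobSq a - 2 * (a.trace / frobSq a) * a.trace =
      -(a.trace ^ 2 / frobSq a) := by field_simp; ring
  linarith

/-- The Cordes inequality in the presence of lower-order terms. -/
lemma cordes_general {d : ℕ} {ν lam : ℝ} (hlam : 0 < lam) (a M : Matrix (Fin d) (Fin d) ℝ)
    (b g : E d) (c r : ℝ) {N t γ : ℝ}
    (hN : N = frobSq a + ‖b‖ ^ 2 / (2 * lam) + |c| ^ 2 / lam ^ 2) (ht : t = a.trace + c / lam)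
    (hγ : γ = t / N) (hN0 : 0 < N) (hc : (d + ν) * N ≤ t ^ 2) :
    (γ * (frobInner a M + dot b g - c * r) - (M.trace - lam * r)) ^ 2 ≤
      (1 - ν) * (frobSq M + 2 * lam * ‖g‖ ^ 2 + lam ^ 2 * r ^ 2) := by
  -- The difference is the pairing of (γa - I, γb, λ - γc) with (M, g, r). With the weights 1, 2λ,
  -- λ² on the second factor, the dual squared norm of the first is d + 1 - 2γt + γ²N = d + 1 - t²/N
  -- ≤ 1 - ν.
  have h1 : γ * (frobInner a M + dot b g - c * r) - (M.trace - lam * r) =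
      frobInner (γ • a - 1) M + γ * dot b g + (lam - γ * c) * r := by
    rw [frobInner_smul_sub_one]; ring
  have hA := frobInner_sq_le (γ • a - 1) M
  have hB : (γ * dot b g) ^ 2 ≤ (γ ^ 2 * (‖b‖ ^ 2 / (2 * lam))) * (2 * lam * ‖g‖ ^ 2) := by
    have e : (γ ^ 2 * (‖b‖ ^ 2 / (2 * lam))) * (2 * lam * ‖g‖ ^ 2) =
        γ ^ 2 * (‖b‖ ^ 2 * ‖g‖ ^ 2) := by field_simp
    rw [e, mul_pow]
    gcongr
    exact dot_sq_le b g
  have hR : ((lam - γ * c) * r) ^ 2 ≤ ((lam - γ * c) ^ 2 / lam ^ 2) * (lam ^ 2 * r ^ 2) := by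
    apply le_of_eq; field_simp
  have hS := sq_add_le_of_sq_le (by have := frobSq_nonneg (γ • a - 1); positivity) (by positivity)
    (by have := frobSq_nonneg M; positivity) (by positivity)
    (sq_add_le_of_sq_le (frobSq_nonneg _) (by positivity) (frobSq_nonneg _) (by positivity) hA hB)
    hR
  rw [h1]
  refine hS.trans (mul_le_mul_of_nonneg_right ?_ (by have := frobSq_nonneg M; positivity))
  rw [frobSq_smul_sub_one]
  have e1 : (lam - γ * c) ^ 2 / lam ^ 2 = 1 - 2 * γ * (c / lam) + γ ^ 2 * (c ^ 2 / lam ^ 2) := by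
    field_simp; ring
  have e2 : γ ^ 2 * N - 2 * γ * t = -(t ^ 2 / N) := by rw [hγ]; field_simp; ring
  have e3 : (d + ν) ≤ t ^ 2 / N := (le_div_iff₀ hN0).2 hc
  rw [e1]
  rw [hN, ht, sq_abs] at e2
  rw [ht, hN, sq_abs] at e3
  rw [hN, ht, sq_abs] at *
  linarith

/-- Inf-sup is monotone and commutes with adding constants. The uniform bounds rule out the default
values of real infima and suprema. -/
lemma iInf_iSup_le_add {𝒜 ℬ : Type*} [Nonempty 𝒜] [Nonempty ℬ] {f g : 𝒜 → ℬ → ℝ} {B δ : ℝ}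
    (hf : ∀ α β, |f α β| ≤ B) (hg : ∀ α β, |g α β| ≤ B) (h : ∀ α β, f α β ≤ g α β + δ) :
    ⨅ α, ⨆ β, f α β ≤ (⨅ α, ⨆ β, g α β) + δ := by
  have hbf : ∀ α, BddAbove (Set.range (f α)) := fun α =>
    ⟨B, by rintro _ ⟨β, rfl⟩; exact (abs_le.1 (hf α β)).2⟩
  have hbg : ∀ α, BddAbove (Set.range (g α)) := fun α =>
    ⟨B, by rintro _ ⟨β, rfl⟩; exact (abs_le.1 (hg α β)).2⟩
  have hbelow : BddBelow (Set.range fun α => ⨆ β, f α β) := by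
    refine ⟨-B, ?_⟩
    rintro _ ⟨α, rfl⟩
    obtain ⟨β⟩ := ‹Nonempty ℬ›
    exact (abs_le.1 (hf α β)).1.trans (le_ciSup (hbf α) β)
  rw [← sub_le_iff_le_add]
  refine le_ciInf fun α => ?_
  rw [sub_le_iff_le_add]
  refine (ciInf_le hbelow α).trans (ciSup_le fun β => (h α β).trans ?_)
  gcongr
  exact le_ciSup (hbg α) β

/-- Extrema of a jointly continuous function over a compact parameter set are continuous. This makes
the nonlinear integrands integrable, without which differences of integrals could not be combined.
-/
lemma continuous_iInf_iSup {X 𝒜 ℬ : Type*} [TopologicalSpace X] [TopologicalSpace 𝒜]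
    [TopologicalSpace ℬ] [CompactSpace 𝒜] [CompactSpace ℬ] {f : X × 𝒜 × ℬ → ℝ}
    (hf : Continuous f) : Continuous fun x => ⨅ α, ⨆ β, f (x, α, β) := by
  have h1 : Continuous fun z : X × 𝒜 => ⨆ β, f (z.1, z.2, β) := by
    have := isCompact_univ.continuous_sSup (K := (Set.univ : Set ℬ))
      (f := fun (z : X × 𝒜) β => f (z.1, z.2, β)) (by fun_prop)
    simpa only [Set.image_univ, sSup_range] using this
  have := isCompact_univ.continuous_sInf (K := (Set.univ : Set 𝒜))
      (f := fun (x : X) α => ⨆ β, f (x, α, β)) h1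
  simpa only [Set.image_univ, sInf_range] using this

lemma continuousOn_slice {d : ℕ} {𝒜 ℬ Y : Type*} [TopologicalSpace 𝒜]
    [TopologicalSpace ℬ] [TopologicalSpace Y] {Ω : Set (E d)} {φ : E d × 𝒜 × ℬ → Y}
    (hφ : ContinuousOn φ (closure Ω ×ˢ Set.univ)) (α : 𝒜) (β : ℬ) :
    ContinuousOn (fun x => φ (x, α, β)) (closure Ω) :=
  hφ.comp (by fun_prop) fun x hx => ⟨hx, trivial⟩

end Cordes

/-! ### The renormalized Isaacs operator under the standing assumptions. -/

namespace Coefficients.Admissible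

variable {d : ℕ} {𝒜 ℬ : Type*} [TopologicalSpace 𝒜] [TopologicalSpace ℬ]
  {D : Coefficients d 𝒜 ℬ} {Ω : Set (E d)} {lam ν : ℝ}

/-- The denominator in the renormalization. -/
def normN (D : Coefficients d 𝒜 ℬ) (lam : ℝ) (x : E d) (α : 𝒜) (β : ℬ) : ℝ :=
  frobSq (D.a x α β) + ‖D.b x α β‖ ^ 2 / (2 * lam) + |D.c x α β| ^ 2 / lam ^ 2

variable (h : D.Admissible Ω lam ν)
include h

/-- Testing ellipticity with unit vectors gives the uniform bound Tr a ≥ d · lo in Ω, which survives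
passage to the closure. The closure matters because the closed elements cover it. -/
lemma trace_pos (hd : 1 ≤ d) {x : E d} (hx : x ∈ closure Ω) (α : 𝒜) (β : ℬ) :
    0 < (D.a x α β).trace := by
  obtain ⟨lo, hi, hlo, -, hell⟩ := h.elliptic
  have h1 : ∀ y ∈ Ω, d * lo ≤ (D.a y α β).trace := by
    intro y hy
    have h2 : ∀ i, lo ≤ D.a y α β i i := by
      intro i
      have := (hell y hy α β (EuclideanSpace.single i 1)).1
      simpa using this
    have := Finset.sum_le_sum fun i (_ : i ∈ Finset.univ) => h2 i
    simpa [Matrix.trace] using this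
  have h3 := le_on_closure h1 continuousOn_const (by
    have := continuousOn_slice h.continuous_a α β
    exact (continuous_id.matrix_trace).comp_continuousOn this) hx
  have : (0 : ℝ) < d := by exact_mod_cast hd
  have : 0 < d * lo := by positivity
  linarith

lemma frobSq_pos (hd : 1 ≤ d) {x : E d} (hx : x ∈ closure Ω) (α : 𝒜) (β : ℬ) :
    0 < frobSq (D.a x α β) := by
  have h1 := trace_sq_le (D.a x α β)
  have h2 := h.trace_pos hd hx α β
  have h3 : 0 < d * frobSq (D.a x α β) := (pow_pos h2 2).trans_le h1
  exact (pos_iff_pos_of_mul_pos h3).1 (by exact_mod_cast hd)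

lemma lam_nonneg : 0 ≤ lam := by
  rcases h.cordes with h1 | h1
  · exact h1.2.1.ge
  · exact h1.2.1.le

lemma normN_pos (hd : 1 ≤ d) {x : E d} (hx : x ∈ closure Ω) (α : 𝒜) (β : ℬ) :
    0 < normN D lam x α β := by
  have h1 := h.frobSq_pos hd hx α β
  have := h.lam_nonneg
  unfold normN
  positivity

lemma continuousOn_frobSq : ContinuousOn (fun z : E d × 𝒜 × ℬ => frobSq (D.a z.1 z.2.1 z.2.2))
    (closure Ω ×ˢ Set.univ) := by
  have : Continuous (frobSq (d := d)) := by
    unfold frobSq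
    fun_prop
  exact this.comp_continuousOn h.continuous_a

lemma continuousOn_normN : ContinuousOn (fun z : E d × 𝒜 × ℬ => normN D lam z.1 z.2.1 z.2.2)
    (closure Ω ×ˢ Set.univ) := by
  have h1 := h.continuousOn_frobSq
  have h2 := h.continuous_b
  have h3 := h.continuous_c
  unfold normN
  fun_prop

lemma continuousOn_trace : ContinuousOn (fun z : E d × 𝒜 × ℬ => (D.a z.1 z.2.1 z.2.2).trace)
    (closure Ω ×ˢ Set.univ) :=
  (continuous_id.matrix_trace).comp_continuousOn h.continuous_a

lemma continuousOn_gamma (hd : 1 ≤ d) :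
    ContinuousOn (fun z : E d × 𝒜 × ℬ => D.gamma lam z.1 z.2.1 z.2.2)
      (closure Ω ×ˢ Set.univ) := by
  unfold gamma
  split_ifs
  · exact h.continuousOn_trace.div h.continuousOn_frobSq
      fun z hz => (h.frobSq_pos hd hz.1 _ _).ne'
  · have h3 := h.continuous_c
    exact (h.continuousOn_trace.add (by fun_prop)).div h.continuousOn_normN
      fun z hz => (h.normN_pos hd hz.1 _ _).ne'

/-- The Cordes inequality, on the closure of the domain. -/
lemma cordes_ineq (hd : 1 ≤ d) {x : E d} (hx : x ∈ closure Ω) (α : 𝒜) (β : ℬ)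
    (M : Matrix (Fin d) (Fin d) ℝ) (g : E d) (r : ℝ) :
    (D.gamma lam x α β * (frobInner (D.a x α β) M + dot (D.b x α β) g - D.c x α β * r) -
      (M.trace - lam * r)) ^ 2 ≤
      (1 - ν) * (frobSq M + 2 * lam * ‖g‖ ^ 2 + lam ^ 2 * r ^ 2) := by
  have hd' : (1 : ℝ) ≤ d := by exact_mod_cast hd
  have hν := h.nu_pos
  rcases h.cordes with ⟨hvan, hl, hc⟩ | ⟨-, hl, hc⟩
  · subst hl
    have hF := h.frobSq_pos hd hx α β
    -- The Cordes condition with cleared denominators is a closed condition, so it extends to the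
    -- closure.
    have h1 : ∀ y ∈ Ω, (d - 1 + ν) * frobSq (D.a y α β) ≤ (D.a y α β).trace ^ 2 := by
      intro y hy
      have h2 := hc y hy α β
      have h3 := h.trace_pos hd (subset_closure hy) α β
      rw [div_le_div_iff₀ (by positivity) (by linarith)] at h2
      linarith
    have h2 := le_on_closure h1
      (continuousOn_const.mul (continuousOn_slice h.continuousOn_frobSq α β))
      ((continuousOn_slice h.continuousOn_trace α β).pow 2) hx
    obtain ⟨hb, hcc⟩ := hvan x hx α β
    have h3 := cordes_pure (D.a x α β) M hF h2
    have hdot : dot (0 : E d) g = 0 := by simp [dot]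
    simpa [gamma, hb, hcc, hdot] using h3
  · have h1 : ∀ y ∈ Ω, (d + ν) * normN D lam y α β ≤ ((D.a y α β).trace + D.c y α β / lam) ^ 2 := by
      intro y hy
      have h2 := hc y hy α β
      have h3 := h.trace_pos hd (subset_closure hy) α β
      have h4 := h.c_nonneg y hy α β
      have h5 : 0 < (D.a y α β).trace + D.c y α β / lam := by positivity
      rw [div_le_div_iff₀ (by positivity) (by linarith), div_pow] at h2
      unfold normN
      rw [sq_abs]
      linarith
    have h2 := le_on_closure h1
      (continuousOn_const.mul (continuousOn_slice h.continuousOn_normN α β))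
      (((continuousOn_slice h.continuousOn_trace α β).add
        ((continuousOn_slice h.continuous_c α β).div_const lam)).pow 2) hx
    refine cordes_general hl (D.a x α β) M (D.b x α β) g (D.c x α β) r rfl rfl ?_
      (h.normN_pos hd hx α β) h2
    simp [gamma, hl.ne']

lemma continuousOn_integrand (hd : 1 ≤ d) {M : E d → Matrix (Fin d) (Fin d) ℝ} {g : E d → E d}
    {r : E d → ℝ} (hM : Continuous M) (hg : Continuous g) (hr : Continuous r) :
    ContinuousOn (fun z : E d × 𝒜 × ℬ => D.gamma lam z.1 z.2.1 z.2.2 *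
      (frobInner (D.a z.1 z.2.1 z.2.2) (M z.1) + dot (D.b z.1 z.2.1 z.2.2) (g z.1) -
        D.c z.1 z.2.1 z.2.2 * r z.1 - D.f z.1 z.2.1 z.2.2)) (closure Ω ×ˢ Set.univ) := by
  have hfrob : Continuous fun z : Matrix (Fin d) (Fin d) ℝ × Matrix (Fin d) (Fin d) ℝ =>
      frobInner z.1 z.2 := by
    unfold frobInner; fun_prop
  have hdot : Continuous fun z : E d × E d => dot z.1 z.2 := by
    unfold dot; fun_prop
  have hM' : ContinuousOn (fun z : E d × 𝒜 × ℬ => M z.1) (closure Ω ×ˢ Set.univ) := by fun_prop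
  have hg' : ContinuousOn (fun z : E d × 𝒜 × ℬ => g z.1) (closure Ω ×ˢ Set.univ) := by fun_prop
  have hr' : ContinuousOn (fun z : E d × 𝒜 × ℬ => r z.1) (closure Ω ×ˢ Set.univ) := by fun_prop
  have h1' := h.continuous_a.prodMk hM'
  have h1 := hfrob.comp_continuousOn h1'
  have h2' := h.continuous_b.prodMk hg'
  have h2 := hdot.comp_continuousOn h2'
  exact (h.continuousOn_gamma hd).mul
    (((h1.add h2).sub (h.continuous_c.mul hr')).sub h.continuous_f)

variable [CompactSpace 𝒜] [CompactSpace ℬ]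

lemma continuousOn_Fgamma (hd : 1 ≤ d) {M : E d → Matrix (Fin d) (Fin d) ℝ} {g : E d → E d}
    {r : E d → ℝ} (hM : Continuous M) (hg : Continuous g) (hr : Continuous r) :
    ContinuousOn (fun x => D.Fgamma lam x (M x) (g x) (r x)) (closure Ω) := by
  rw [continuousOn_iff_continuous_domRestrict]
  have h1 := h.continuousOn_integrand hd hM hg hr
  have h2 : Continuous fun z : closure Ω × 𝒜 × ℬ => ((z.1 : E d), z.2.1, z.2.2) := by fun_prop
  have h3 := h1.comp_continuous h2 (fun z => ⟨z.1.2, trivial⟩)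
  exact continuous_iInf_iSup h3

lemma exists_bound_integrand (hd : 1 ≤ d) {x : E d} (hx : x ∈ closure Ω)
    (M : Matrix (Fin d) (Fin d) ℝ) (g : E d) (r : ℝ) :
    ∃ B : ℝ, ∀ α β, |D.gamma lam x α β * (frobInner (D.a x α β) M + dot (D.b x α β) g -
      D.c x α β * r - D.f x α β)| ≤ B := by
  have h1 := h.continuousOn_integrand hd (continuous_const (y := M)) (continuous_const (y := g))
    (continuous_const (y := r))
  have h2 : Continuous fun z : 𝒜 × ℬ => (x, z.1, z.2) := by fun_prop
  have h3 := h1.comp_continuous h2 (fun z => ⟨hx, trivial⟩)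
  obtain ⟨B, hB⟩ := isCompact_univ.exists_bound_of_continuousOn h3.continuousOn
  exact ⟨B, fun α β => hB (α, β) trivial⟩

/-- Under the Cordes condition, differences of the renormalized operator are close to
`Δ - λ`. -/
lemma sq_Fgamma_sub_le [Nonempty 𝒜] [Nonempty ℬ] (hd : 1 ≤ d) {x : E d} (hx : x ∈ closure Ω)
    (M M' : Matrix (Fin d) (Fin d) ℝ) (g g' : E d) (r r' : ℝ) :
    (D.Fgamma lam x M g r - D.Fgamma lam x M' g' r' -
      ((M - M').trace - lam * (r - r'))) ^ 2 ≤
      (1 - ν) * (frobSq (M - M') + 2 * lam * ‖g - g'‖ ^ 2 + lam ^ 2 * (r - r') ^ 2) := by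
  obtain ⟨B, hB⟩ := h.exists_bound_integrand hd hx M g r
  obtain ⟨B', hB'⟩ := h.exists_bound_integrand hd hx M' g' r'
  set Q := (1 - ν) * (frobSq (M - M') + 2 * lam * ‖g - g'‖ ^ 2 + lam ^ 2 * (r - r') ^ 2) with hQ
  set ℓ := (M - M').trace - lam * (r - r') with hℓ
  have hQ0 : 0 ≤ Q := by
    have h1 := frobSq_nonneg (M - M')
    have h2 := h.lam_nonneg
    have h3 : 0 ≤ 1 - ν := by linarith [h.nu_le_one]
    positivity
  -- The source term f cancels in the difference, and the remaining expression is linear in (M - M',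
  -- g - g', r - r').
  have hdiff : ∀ α β, |D.gamma lam x α β * (frobInner (D.a x α β) M + dot (D.b x α β) g -
      D.c x α β * r - D.f x α β) - D.gamma lam x α β * (frobInner (D.a x α β) M' +
      dot (D.b x α β) g' - D.c x α β * r' - D.f x α β) - ℓ| ≤ Real.sqrt Q := by
    intro α β
    refine Real.abs_le_sqrt ?_
    have h1 := h.cordes_ineq hd hx α β (M - M') (g - g') (r - r')
    have h2 : frobInner (D.a x α β) (M - M') =
        frobInner (D.a x α β) M - frobInner (D.a x α β) M' := by
      simp [frobInner, mul_sub]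
    rw [h2, dot_sub_right] at h1
    refine le_trans (le_of_eq ?_) h1
    ring
  have h1 : D.Fgamma lam x M g r ≤ D.Fgamma lam x M' g' r' + (ℓ + Real.sqrt Q) :=
    iInf_iSup_le_add (B := max B B') (fun α β => (hB α β).trans (le_max_left _ _))
      (fun α β => (hB' α β).trans (le_max_right _ _))
      fun α β => by linarith [(abs_le.1 (hdiff α β)).2]
  have h2 : D.Fgamma lam x M' g' r' ≤ D.Fgamma lam x M g r + (-ℓ + Real.sqrt Q) :=
    iInf_iSup_le_add (B := max B B') (fun α β => (hB' α β).trans (le_max_right _ _))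
      (fun α β => (hB α β).trans (le_max_left _ _))
      fun α β => by linarith [(abs_le.1 (hdiff α β)).1]
  rw [← Real.sq_sqrt hQ0]
  exact sq_le_sq' (by linarith) (by linarith)

end Coefficients.Admissible

namespace Mesh

variable {d : ℕ} {Ω : Set (E d)} {T : Mesh Ω} {n : Finset (E d) → E d} {p : ℕ} {C D : ℝ}

/-! ### The lifting operator -/

lemma V0_sum_mem {ι : Type*} (s : Finset ι) {v : ι → T.PwPoly} {q : ℕ}
    (h : ∀ i ∈ s, v i ∈ T.V0 q) : (∑ i ∈ s, v i) ∈ T.V0 q := by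
  intro K
  rw [Finset.sum_apply]
  exact MvPolynomial.totalDegree_finsetSum_le fun i hi => h i hi K

lemma V0_sub_mem {v w : T.PwPoly} {q : ℕ} (hv : v ∈ T.V0 q) (hw : w ∈ T.V0 q) :
    v - w ∈ T.V0 q := fun K =>
  (MvPolynomial.totalDegree_sub _ _).trans (max_le (hv K) (hw K))

/-- Either the lifting is characterized by its defining identity, or it is zero. -/
lemma lift_spec_or (q : ℕ) (F : Finset (E d)) (w : E d → ℝ) :
    (T.lift q F w ∈ T.V0 q ∧ ∀ φ ∈ T.V0 q,
      T.elemInt (fun K x => ev (T.lift q F w K) x * ev (φ K) x) =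
        faceInt F (fun x => w x * ev (T.avg F φ) x)) ∨ T.lift q F w = 0 := by
  classical
  by_cases h : ∃ r ∈ T.V0 q, ∀ φ ∈ T.V0 q,
      T.elemInt (fun K x => ev (r K) x * ev (φ K) x) =
        faceInt F (fun x => w x * ev (T.avg F φ) x)
  · left
    rw [lift, dif_pos h]
    exact h.choose_spec
  · right
    rw [lift, dif_neg h]

/-- The `L²` stability of the lifting of the jumps of the normal derivative. -/
lemma HasFaceBounds.l2Sq_liftTotal_le {q : ℕ} (hb : T.HasFaceBounds q D C)
    (hn : T.IsNormalField n) (hd : 1 ≤ d) (hC : 0 < C) (v : T.PwPoly) :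
    T.l2Sq (T.liftTotal n q v) ≤ (d + 1) * C * T.jumpGradSq n v := by
  classical
  set w : Finset (E d) → Poly d := fun F => T.jump n F (fun K => normalD (n F) (v K)) with hw
  set r : Finset (E d) → T.PwPoly := fun F => T.lift q F (ev (w F)) with hr
  set R := T.liftTotal n q v with hR
  have hRr : R = ∑ F ∈ T.facetsI, r F := rfl
  have hrV : ∀ F, r F ∈ T.V0 q := by
    intro F
    rcases lift_spec_or (T := T) q F (ev (w F)) with h | h
    · exact h.1
    · rw [hr]; beta_reduce; rw [h]
      intro K; simp
  have hRV : R ∈ T.V0 q := by rw [hRr]; exact V0_sum_mem _ fun F _ => hrV F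
  -- Test the definition of each lifting with the total lifting R itself.
  have h1 : T.l2Sq R = ∑ F ∈ T.facetsI, T.elemInt (fun K x => ev (r F K) x * ev (R K) x) := by
    rw [← elemInt_sum _ fun F K => integrableOn_hull _ (by fun_prop), l2Sq]
    congr 1
    ext K x
    rw [sq, ← Finset.sum_mul, ← ev_sum, hRr, Finset.sum_apply]
  have h2 : T.l2Sq R ≤ facesInt T.facetsI (fun F x => |ev (T.avg F R) x * ev (w F) x|) := by
    rw [h1]
    refine Finset.sum_le_sum fun F hF => ?_
    -- The bound is one-sided: in the default case r_F = 0 the left-hand side vanishes, so no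
    -- existence statement for the lifting is required.
    rcases lift_spec_or (T := T) q F (ev (w F)) with h | h
    · rw [show T.elemInt (fun K x => ev (r F K) x * ev (R K) x) = _ from h.2 R hRV]
      refine hn.faceInt_mono hd (facetsI_subset hF) (by fun_prop) (by fun_prop) fun x _ => ?_
      rw [mul_comm]; exact le_abs_self _
    · rw [hr]; beta_reduce; rw [h]
      refine le_trans (le_of_eq ?_) (faceInt_nonneg fun x => abs_nonneg _)
      simp [elemInt]
  -- Chosen so that the averages of R cost half of ∫R².
  have hε : 0 < (2 * ((d + 1) * C))⁻¹ := by positivity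
  have h3 := hn.abs_facesInt_mul_le hd (facetsI_subset (T := T)) (w := hFace)
    (fun F hF => hb.hFace_pos (facetsI_subset hF)) (f := fun F => ev (T.avg F R))
    (g := fun F => ev (w F)) (fun F => by fun_prop) (fun F => by fun_prop) hε
  have h4 : facesInt T.facetsI (fun F x => hFace F * (ev (T.avg F R) x) ^ 2) ≤
      (d + 1) * (C * T.l2Sq R) :=
    (facesInt_mono_set facetsI_subset fun F hF x => by
      have := hb.hFace_pos hF
      positivity).trans (hb.facesInt_avg_sq_le hn hd hC.le hRV)
  have h5 := hb.facesInt_jump_normalD_le hn hd v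
  have h6 := mul_le_mul_of_nonneg_left h4 hε.le
  have h7 := mul_le_mul_of_nonneg_left h5
    (by positivity : 0 ≤ (4 * (2 * ((d + 1) * C))⁻¹)⁻¹)
  have e1 : (2 * ((d + 1) * C))⁻¹ * ((d + 1) * (C * T.l2Sq R)) = T.l2Sq R / 2 := by field_simp
  have e2 : (4 * (2 * ((d + 1) * C))⁻¹)⁻¹ = (d + 1) * C / 2 := by field_simp; ring
  rw [e1] at h6
  rw [e2] at h7 h3
  linarith

/-! ### The stabilization form -/

/-- The trace inequality for each second derivative, whose degree is still at most p, summed over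
the indices. -/
lemma HasFaceBounds.facesInt_avg_hess_le (hb : T.HasFaceBounds p D C) (hn : T.IsNormalField n)
    (hd : 1 ≤ d) (hC : 0 ≤ C) {v : T.PwPoly} (hv : v ∈ T.V0 p) :
    facesInt T.facets (fun F x => hFace F *
      ∑ i, ∑ j, (ev (T.avg F (fun K => hessP (v K) i j)) x) ^ 2) ≤
      (d + 1) * (C * T.hessSq v) := by
  have h1 : ∀ i j, facesInt T.facets (fun F x => hFace F *
      (ev (T.avg F (fun K => hessP (v K) i j)) x) ^ 2) ≤
      (d + 1) * (C * T.l2Sq (fun K => hessP (v K) i j)) := fun i j =>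
    hb.facesInt_avg_sq_le hn hd hC fun K => (totalDegree_pd_le j _).trans
      ((totalDegree_pd_le i _).trans (hv K))
  have h2 := Finset.sum_le_sum fun i (_ : i ∈ Finset.univ) =>
    Finset.sum_le_sum fun j (_ : j ∈ Finset.univ) => h1 i j
  simp only [← Finset.mul_sum] at h2
  have h3 : ∑ i, ∑ j, T.l2Sq (fun K => hessP (v K) i j) = T.hessSq v := by
    rw [hessSq, elemInt_sum _ fun i K => integrableOn_hull _ (by fun_prop)]
    refine Finset.sum_congr rfl fun i _ => ?_
    rw [elemInt_sum _ fun j K => integrableOn_hull _ (by fun_prop)]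
    rfl
  rw [h3] at h2
  refine le_trans (le_of_eq ?_) h2
  have h4 : ∀ i, ∑ j, facesInt T.facets (fun F x => hFace F *
      (ev (T.avg F (fun K => hessP (v K) i j)) x) ^ 2) = facesInt T.facets (fun F x => ∑ j,
        hFace F * (ev (T.avg F (fun K => hessP (v K) i j)) x) ^ 2) := by
    intro i
    unfold facesInt
    rw [Finset.sum_comm]
    exact Finset.sum_congr rfl fun F hF => (hn.faceInt_sum hd hF _ fun j => by fun_prop).symm
  rw [Finset.sum_congr rfl fun i _ => h4 i]
  unfold facesInt
  rw [Finset.sum_comm]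
  refine Finset.sum_congr rfl fun F hF => ?_
  rw [← hn.faceInt_sum hd hF _ fun i => by fun_prop]
  simp only [Finset.mul_sum]

/-- Projections to a hyperplane do not increase the Euclidean norm. -/
lemma IsNormalField.sum_sq_tangential_le (hn : T.IsNormalField n) {F : Finset (E d)}
    (hF : F ∈ T.facets) (g : Fin d → ℝ) :
    ∑ i, (g i - n F i * ∑ k, n F k * g k) ^ 2 ≤ ∑ i, (g i) ^ 2 := by
  set s := ∑ k, n F k * g k with hs
  have h1 : ∀ i, (g i - n F i * s) ^ 2 = (g i) ^ 2 - 2 * s * (n F i * g i) + s ^ 2 * (n F i) ^ 2 :=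
    fun i => by ring
  simp only [h1, Finset.sum_add_distrib, Finset.sum_sub_distrib, ← Finset.mul_sum, ← hs,
    hn.sum_normal_sq hF]
  nlinarith [sq_nonneg s]

lemma ev_gradT (e : E d) (P : Poly d) (i : Fin d) (x : E d) :
    ev (gradT e P i) x = ev (pd i P) x - e i * ∑ k, e k * ev (pd k P) x := by
  simp [gradT, normalD]

lemma ev_jump_gradT (F : Finset (E d)) (v : T.PwPoly) (e : E d) (i : Fin d) (x : E d) :
    ev (T.jump n F (fun K => gradT e (v K) i)) x =
      ev (T.jump n F (fun K => gradP (v K) i)) x -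
        e i * ∑ k, e k * ev (T.jump n F (fun K => gradP (v K) k)) x := by
  simp only [ev_jump, ev_gradT, gradP, mul_sub, Finset.sum_sub_distrib, Finset.mul_sum]
  congr 1
  rw [Finset.sum_comm]
  exact Finset.sum_congr rfl fun k _ => Finset.sum_congr rfl fun K _ => by ring

lemma pd_avg (F : Finset (E d)) (v : T.PwPoly) (i : Fin d) :
    pd i (T.avg F v) = T.avg F (fun K => pd i (v K)) := by
  simp [avg]

/-- Since n is constant on the face, ∇_T{∇v·n} is the tangential projection of the averaged Hessian
applied to n; neither operation increases norms. -/
lemma IsNormalField.sum_sq_gradT_avg_le (hn : T.IsNormalField n) {F : Finset (E d)}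
    (hF : F ∈ T.facets) (v : T.PwPoly) (x : E d) :
    ∑ i, (ev (gradT (n F) (T.avg F (fun K => normalD (n F) (v K))) i) x) ^ 2 ≤
      ∑ i, ∑ j, (ev (T.avg F (fun K => hessP (v K) i j)) x) ^ 2 := by
  simp only [ev_gradT]
  refine (hn.sum_sq_tangential_le hF _).trans ?_
  rw [Finset.sum_comm]
  refine Finset.sum_le_sum fun i _ => ?_
  have h1 : ev (pd i (T.avg F (fun K => normalD (n F) (v K)))) x =
      ∑ j, n F j * ev (T.avg F (fun K => hessP (v K) j i)) x := by
    simp only [pd_avg, normalD, pd_sum, pd_C_mul, ev_avg, ev_sum, ev_mul, ev_C, hessP]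
    rw [Finset.sum_comm, Finset.mul_sum]
    refine Finset.sum_congr rfl fun j _ => ?_
    rw [← Finset.mul_sum]; ring
  rw [h1]
  exact hn.sq_sum_normal_le hF _

/-- The normal-normal second derivative occurs twice with a minus sign, and once with a plus sign
because |e| = 1. -/
lemma ev_lapT {e : E d} (he : ∑ i, (e i) ^ 2 = 1) (P : Poly d) (x : E d) :
    ev (lapT e P) x = ∑ i, ev (hessP P i i) x - ∑ i, e i * ∑ j, e j * ev (hessP P i j) x := by
  simp only [lapT, ev_sum, ev_gradT]
  have h1 : ∀ i k, ev (pd k (gradT e P i)) x =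
      ev (hessP P i k) x - e i * ∑ j, e j * ev (hessP P j k) x := by
    intro i k
    simp only [gradT, normalD, pd_sub, pd_C_mul, pd_sum, ev_sub, ev_mul, ev_C, ev_sum, hessP]
  simp only [h1]
  have h2 : ∑ i, ∑ k, e i * (e k * (e i * ∑ j, e j * ev (hessP P j k) x)) =
      ∑ k, e k * ∑ j, e j * ev (hessP P j k) x := by
    rw [Finset.sum_comm]
    refine Finset.sum_congr rfl fun k _ => ?_
    have : ∀ i, e i * (e k * (e i * ∑ j, e j * ev (hessP P j k) x)) =
      (e i) ^ 2 * (e k * ∑ j, e j * ev (hessP P j k) x) := fun i => by ring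
    rw [Finset.sum_congr rfl fun i _ => this i, ← Finset.sum_mul, he, one_mul]
  simp only [Finset.sum_sub_distrib, Finset.mul_sum, mul_sub] at h2 ⊢
  rw [h2]
  have h3 : ∑ i, ∑ j, e i * (e j * ev (hessP P j i) x) =
      ∑ i, ∑ j, e i * (e j * ev (hessP P i j) x) := by
    rw [Finset.sum_comm]
    exact Finset.sum_congr rfl fun i _ => Finset.sum_congr rfl fun j _ => by ring
  rw [h3]
  ring

/-- By the formula for Δ_T, the average is Tr A - n·An with A the averaged Hessian. The squares of
the two terms are at most d|A|² and |A|², whence 2(d + 1). -/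
lemma IsNormalField.sq_avg_lapT_le (hn : T.IsNormalField n) {F : Finset (E d)}
    (hF : F ∈ T.facets) (v : T.PwPoly) (x : E d) :
    (ev (T.avg F (fun K => lapT (n F) (v K))) x) ^ 2 ≤
      2 * (d + 1) * ∑ i, ∑ j, (ev (T.avg F (fun K => hessP (v K) i j)) x) ^ 2 := by
  have hnF := hn.sum_normal_sq hF
  set A : Fin d → Fin d → ℝ := fun i j => ev (T.avg F (fun K => hessP (v K) i j)) x with hA
  have h1 : ev (T.avg F (fun K => lapT (n F) (v K))) x =
      ∑ i, A i i - ∑ i, n F i * ∑ j, n F j * A i j := by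
    have h2 : ∀ i j, A i j = ((T.adj F).card : ℝ)⁻¹ * ∑ K ∈ T.adj F, ev (hessP (v K) i j) x :=
      fun i j => ev_avg _ _ _
    simp only [h2]
    rw [ev_avg]
    simp only [ev_lapT hnF, Finset.sum_sub_distrib, Finset.mul_sum, mul_sub]
    congr 1
    · rw [Finset.sum_comm]
    · rw [Finset.sum_comm]
      refine Finset.sum_congr rfl fun i _ => ?_
      rw [Finset.sum_comm]
      exact Finset.sum_congr rfl fun j _ => Finset.sum_congr rfl fun K _ => by ring
  have h3 : (∑ i, A i i) ^ 2 ≤ d * ∑ i, ∑ j, (A i j) ^ 2 := by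
    simpa [Matrix.trace, frobSq] using trace_sq_le (Matrix.of A)
  have h4 : (∑ i, n F i * ∑ j, n F j * A i j) ^ 2 ≤ ∑ i, ∑ j, (A i j) ^ 2 :=
    (hn.sq_sum_normal_le hF _).trans (Finset.sum_le_sum fun i _ => hn.sq_sum_normal_le hF _)
  rw [h1]
  nlinarith [sq_nonneg (∑ i, A i i + ∑ i, n F i * ∑ j, n F j * A i j)]

/-- The tangential jumps on the boundary, which are controlled by the penalization. -/
def jumpTanSq (T : Mesh Ω) (n : Finset (E d) → E d) (v : T.PwPoly) : ℝ :=
  facesInt T.facetsB (fun F x => (hFace F)⁻¹ *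
    ∑ i, (ev (T.jump n F (fun K => gradT (n F) (v K) i)) x) ^ 2)

lemma HasFaceBounds.jumpTanSq_nonneg (hb : T.HasFaceBounds p D C) (v : T.PwPoly) :
    0 ≤ T.jumpTanSq n v :=
  facesInt_nonneg fun F hF x => by
    have := hb.hFace_pos (facetsB_subset hF)
    positivity

lemma HasFaceBounds.facesInt_jump_gradT_le (hb : T.HasFaceBounds p D C)
    (hn : T.IsNormalField n) (hd : 1 ≤ d) (v : T.PwPoly) :
    facesInt T.facets (fun F x => (hFace F)⁻¹ *
      ∑ i, (ev (T.jump n F (fun K => gradT (n F) (v K) i)) x) ^ 2) ≤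
      T.jumpGradSq n v + T.jumpTanSq n v := by
  rw [hn.facesInt_facets hd]
  refine add_le_add ?_ le_rfl
  refine hn.facesInt_mono hd facetsI_subset (fun F => by fun_prop) (fun F => by fun_prop)
    fun F hF x _ => ?_
  have := hb.hFace_pos (facetsI_subset hF)
  simp only [ev_jump_gradT]
  exact mul_le_mul_of_nonneg_left (hn.sum_sq_tangential_le (facetsI_subset hF) _) (by positivity)

lemma sum_mul_le_young {a b : Fin d → ℝ} {w ε : ℝ} (hw : 0 < w) (hε : 0 < ε) :
    |∑ i, a i * b i| ≤ ε * (w * ∑ i, (a i) ^ 2) + (4 * ε)⁻¹ * (w⁻¹ * ∑ i, (b i) ^ 2) := by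
  refine (Finset.abs_sum_le_sum_abs _ _).trans ?_
  rw [Finset.mul_sum, Finset.mul_sum, Finset.mul_sum, Finset.mul_sum, ← Finset.sum_add_distrib]
  refine Finset.sum_le_sum fun i _ => ?_
  rw [abs_mul]
  have h1 : ε * (w * (a i) ^ 2) + (4 * ε)⁻¹ * (w⁻¹ * (b i) ^ 2) - |a i| * |b i| =
      (4 * ε * w)⁻¹ * (2 * ε * w * |a i| - |b i|) ^ 2 := by
    rw [← sq_abs (a i), ← sq_abs (b i)]
    field_simp; ring
  have h2 : 0 ≤ (4 * ε * w)⁻¹ * (2 * ε * w * |a i| - |b i|) ^ 2 := by positivity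
  linarith

@[fun_prop] lemma continuous_sum_ev {ι : Type*} (s : Finset ι) (P Q : ι → Poly d) :
    Continuous fun x => ∑ i ∈ s, ev (P i) x * ev (Q i) x := by fun_prop

/-- Lower bound for the stabilization form. -/
lemma HasFaceBounds.le_stab_self (hb : T.HasFaceBounds p D C)
    (hn : T.IsNormalField n) (hd : 1 ≤ d) (hC : 0 ≤ C) {v : T.PwPoly} (hv : v ∈ T.V0 p)
    {ε : ℝ} (hε : 0 < ε) :
    T.hessSq v - T.elemInt (fun K x => (ev (lapP (v K)) x) ^ 2) -
      (ε * ((4 * d + 6) * (d + 1) * C * T.hessSq v) +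
        ε⁻¹ * (T.jumpGradSq n v + T.jumpTanSq n v)) ≤ T.stab n v v := by
  set W := facesInt T.facets (fun F x => hFace F *
      ∑ i, ∑ j, (ev (T.avg F (fun K => hessP (v K) i j)) x) ^ 2) with hW
  have hWle := hb.facesInt_avg_hess_le hn hd hC hv
  rw [← hW] at hWle
  set A : Finset (E d) → E d → ℝ := fun F x =>
    ∑ i, ev (gradT (n F) (T.avg F (fun K => normalD (n F) (v K))) i) x *
        ev (T.jump n F (fun K => gradT (n F) (v K) i)) x with hA
  set B : Finset (E d) → E d → ℝ := fun F x =>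
    ev (T.avg F (fun K => lapT (n F) (v K))) x *
        ev (T.jump n F (fun K => normalD (n F) (v K))) x with hB
  have hAc : ∀ F, Continuous (A F) := fun F => by rw [hA]; fun_prop
  have hBc : ∀ F, Continuous (B F) := fun F => by rw [hB]; fun_prop
  -- On the diagonal the two symmetric halves of each face term coincide.
  have hstab : T.stab n v v = T.hessSq v - T.elemInt (fun K x => (ev (lapP (v K)) x) ^ 2) -
      2 * facesInt T.facets A + 2 * facesInt T.facetsI B := by
    rw [stab, hessSq, ← elemInt_sub (fun K => integrableOn_hull _ (by fun_prop))
      (fun K => integrableOn_hull _ (by fun_prop)), ← facesInt_const_mul, ← facesInt_const_mul]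
    simp only [sq, two_mul]
    rfl
  have h1 : facesInt T.facets (fun F x => |A F x|) ≤
      ε * W + (4 * ε)⁻¹ * (T.jumpGradSq n v + T.jumpTanSq n v) := by
    refine le_trans ?_ (add_le_add le_rfl (mul_le_mul_of_nonneg_left
      (hb.facesInt_jump_gradT_le hn hd v) (by positivity)))
    rw [hW, ← facesInt_const_mul, ← facesInt_const_mul, ← hn.facesInt_add hd (subset_refl _)
      (fun F => by fun_prop) (fun F => by fun_prop)]
    refine hn.facesInt_mono hd (subset_refl _) (fun F => (hAc F).abs) (fun F => by fun_prop)
      fun F hF x _ => ?_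
    have hh := hb.hFace_pos hF
    refine (sum_mul_le_young hh hε).trans (add_le_add ?_ le_rfl)
    have := hn.sum_sq_gradT_avg_le hF v x
    gcongr
  have h2 : facesInt T.facetsI (fun F x => |B F x|) ≤
      ε * (2 * (d + 1) * W) + (4 * ε)⁻¹ * T.jumpGradSq n v := by
    have h3 := hn.abs_facesInt_mul_le hd (facetsI_subset (T := T)) (w := hFace)
      (fun F hF => hb.hFace_pos (facetsI_subset hF))
      (f := fun F => ev (T.avg F (fun K => lapT (n F) (v K))))
      (g := fun F => ev (T.jump n F (fun K => normalD (n F) (v K))))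
      (fun F => by fun_prop) (fun F => by fun_prop) hε
    refine h3.trans (add_le_add (mul_le_mul_of_nonneg_left ?_ hε.le)
      (mul_le_mul_of_nonneg_left (hb.facesInt_jump_normalD_le hn hd v) (by positivity)))
    refine (facesInt_mono_set facetsI_subset fun F hF x => by
      have := hb.hFace_pos hF
      positivity).trans ?_
    rw [hW, ← facesInt_const_mul]
    refine hn.facesInt_mono hd (subset_refl _) (fun F => by fun_prop) (fun F => by fun_prop)
      fun F hF x _ => ?_
    have hh := hb.hFace_pos hF
    have := mul_le_mul_of_nonneg_left (hn.sq_avg_lapT_le hF v x) hh.le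
    linarith
  have h3 := (abs_facesInt_le T.facets A).trans h1
  have h4 := (abs_facesInt_le T.facetsI B).trans h2
  have h5 := (abs_le.1 h3).2
  have h6 := (abs_le.1 h4).1
  -- The doubled face terms contribute 2W from the gradients and 4(d + 1)W from the Laplacians,
  -- together (4d + 6)W.
  have h7 : ε * ((2 * (2 * (d + 1)) + 2) * W) ≤
      ε * ((2 * (2 * (d + 1)) + 2) * ((d + 1) * (C * T.hessSq v))) := by gcongr
  have h8 : (4 * ε)⁻¹ = ε⁻¹ / 4 := by field_simp
  have hJ := hb.jumpTanSq_nonneg (n := n) v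
  have h9 : 0 ≤ ε⁻¹ * T.jumpTanSq n v := by positivity
  rw [hstab]
  rw [h8] at h5 h6
  nlinarith

lemma penal_self (σ ρ : ℝ) (v : T.PwPoly) :
    T.penal n σ ρ v v =
      σ * T.jumpGradSq n v + σ * T.jumpTanSq n v + ρ * T.jumpValSq n v := by
  rw [penal, jumpGradSq, jumpTanSq, jumpValSq, ← facesInt_const_mul, ← facesInt_const_mul,
    ← facesInt_const_mul]
  simp only [mul_assoc, sq]

end Mesh

/-! ### Linearity of the differential operators and of the bilinear forms. -/

section Linearity
variable {d : ℕ}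

lemma hessP_sub (P Q : Poly d) (i j : Fin d) : hessP (P - Q) i j = hessP P i j - hessP Q i j := by
  simp [hessP]

lemma lapP_sub (P Q : Poly d) : lapP (P - Q) = lapP P - lapP Q := by
  simp [lapP, hessP_sub]

lemma gradP_sub (P Q : Poly d) (i : Fin d) : gradP (P - Q) i = gradP P i - gradP Q i := by
  simp [gradP]

lemma normalD_sub (e : E d) (P Q : Poly d) : normalD e (P - Q) = normalD e P - normalD e Q := by
  simp [normalD, mul_sub]

lemma gradT_sub (e : E d) (P Q : Poly d) (i : Fin d) :
    gradT e (P - Q) i = gradT e P i - gradT e Q i := by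
  simp only [gradT, normalD_sub, pd_sub]; ring

lemma lapT_sub (e : E d) (P Q : Poly d) : lapT e (P - Q) = lapT e P - lapT e Q := by
  have h : ∀ i, gradT e (P - Q) i = gradT e P i - gradT e Q i := gradT_sub e P Q
  simp only [lapT, h, gradT_sub, Finset.sum_sub_distrib]

end Linearity

namespace Mesh

variable {d : ℕ} {Ω : Set (E d)} {T : Mesh Ω} {n : Finset (E d) → E d} {p : ℕ} {C D : ℝ}

lemma jump_sub (F : Finset (E d)) (u v : T.PwPoly) :
    T.jump n F (fun K => u K - v K) = T.jump n F u - T.jump n F v := by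
  simp [jump, mul_sub]

lemma avg_sub (F : Finset (E d)) (u v : T.PwPoly) :
    T.avg F (fun K => u K - v K) = T.avg F u - T.avg F v := by
  simp [avg, mul_sub]

lemma jump_sub' (F : Finset (E d)) (u v : T.PwPoly) :
    T.jump n F (u - v) = T.jump n F u - T.jump n F v := jump_sub F u v

lemma IsNormalField.facesInt_sub (hn : T.IsNormalField n) (hd : 1 ≤ d)
    {G : Finset (Finset (E d))} (hG : G ⊆ T.facets) {f g : Finset (E d) → E d → ℝ}
    (hf : ∀ F, Continuous (f F)) (hg : ∀ F, Continuous (g F)) :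
    facesInt G (fun F x => f F x - g F x) = facesInt G f - facesInt G g := by
  rw [eq_sub_iff_add_eq, ← hn.facesInt_add hd hG
    (fun F => by have := hf F; have := hg F; fun_prop) hg]
  simp

lemma IsNormalField.stab_sub (hn : T.IsNormalField n) (hd : 1 ≤ d) (w v z : T.PwPoly) :
    T.stab n w z - T.stab n v z = T.stab n (w - v) z := by
  have e1 := elemInt_sub (T := T)
    (f := fun K x => (∑ i, ∑ j, ev (hessP (w K) i j) x * ev (hessP (z K) i j) x) -
      ev (lapP (w K)) x * ev (lapP (z K)) x)
    (g := fun K x => (∑ i, ∑ j, ev (hessP (v K) i j) x * ev (hessP (z K) i j) x) -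
      ev (lapP (v K)) x * ev (lapP (z K)) x)
    (fun K => integrableOn_hull _ (by fun_prop)) (fun K => integrableOn_hull _ (by fun_prop))
  have e2 := hn.facesInt_sub hd (subset_refl T.facets)
    (f := fun F x => (∑ i, ev (gradT (n F) (T.avg F (fun K => normalD (n F) (w K))) i) x *
        ev (T.jump n F (fun K => gradT (n F) (z K) i)) x) +
      (∑ i, ev (gradT (n F) (T.avg F (fun K => normalD (n F) (z K))) i) x *
        ev (T.jump n F (fun K => gradT (n F) (w K) i)) x))
    (g := fun F x => (∑ i, ev (gradT (n F) (T.avg F (fun K => normalD (n F) (v K))) i) x *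
        ev (T.jump n F (fun K => gradT (n F) (z K) i)) x) +
      (∑ i, ev (gradT (n F) (T.avg F (fun K => normalD (n F) (z K))) i) x *
        ev (T.jump n F (fun K => gradT (n F) (v K) i)) x))
    (fun F => by fun_prop) (fun F => by fun_prop)
  have e3 := hn.facesInt_sub hd (facetsI_subset (T := T))
    (f := fun F x => ev (T.avg F (fun K => lapT (n F) (w K))) x *
        ev (T.jump n F (fun K => normalD (n F) (z K))) x +
      ev (T.avg F (fun K => lapT (n F) (z K))) x *
        ev (T.jump n F (fun K => normalD (n F) (w K))) x)
    (g := fun F x => ev (T.avg F (fun K => lapT (n F) (v K))) x *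
        ev (T.jump n F (fun K => normalD (n F) (z K))) x +
      ev (T.avg F (fun K => lapT (n F) (z K))) x *
        ev (T.jump n F (fun K => normalD (n F) (v K))) x)
    (fun F => by fun_prop) (fun F => by fun_prop)
  unfold stab
  have e : ∀ a b c a' b' c' : ℝ, a - b + c - (a' - b' + c') = (a - a') - (b - b') + (c - c') :=
    fun _ _ _ _ _ _ => by ring
  rw [e, ← e1, ← e2, ← e3]
  refine congrArg₂ (· + ·) (congrArg₂ (· - ·) (congrArg T.elemInt (funext₂ fun K x => ?_)) ?_) ?_
  · simp only [Pi.sub_apply, hessP_sub, lapP_sub, ev_sub, sub_mul, Finset.sum_sub_distrib]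
    ring
  · refine facesInt_congr fun F _ x => ?_
    simp only [Pi.sub_apply, gradT_sub, normalD_sub, jump_sub, avg_sub, ev_sub, sub_mul,
      mul_sub, Finset.sum_sub_distrib]
    ring
  · refine facesInt_congr fun F _ x => ?_
    simp only [Pi.sub_apply, lapT_sub, normalD_sub, jump_sub, avg_sub, ev_sub]
    ring

lemma IsNormalField.penal_sub (hn : T.IsNormalField n) (hd : 1 ≤ d) (σ ρ : ℝ) (w v z : T.PwPoly) :
    T.penal n σ ρ w z - T.penal n σ ρ v z = T.penal n σ ρ (w - v) z := by
  have e1 := hn.facesInt_sub hd (facetsI_subset (T := T))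
    (f := fun F x => σ * (hFace F)⁻¹ *
      ∑ i, ev (T.jump n F (fun K => gradP (w K) i)) x *
        ev (T.jump n F (fun K => gradP (z K) i)) x)
    (g := fun F x => σ * (hFace F)⁻¹ *
      ∑ i, ev (T.jump n F (fun K => gradP (v K) i)) x *
        ev (T.jump n F (fun K => gradP (z K) i)) x)
    (fun F => by fun_prop) (fun F => by fun_prop)
  have e2 := hn.facesInt_sub hd (facetsB_subset (T := T))
    (f := fun F x => σ * (hFace F)⁻¹ *
      ∑ i, ev (T.jump n F (fun K => gradT (n F) (w K) i)) x *
        ev (T.jump n F (fun K => gradT (n F) (z K) i)) x)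
    (g := fun F x => σ * (hFace F)⁻¹ *
      ∑ i, ev (T.jump n F (fun K => gradT (n F) (v K) i)) x *
        ev (T.jump n F (fun K => gradT (n F) (z K) i)) x)
    (fun F => by fun_prop) (fun F => by fun_prop)
  have e3 := hn.facesInt_sub hd (subset_refl T.facets)
    (f := fun F x => ρ * (hFace F ^ 3)⁻¹ * (ev (T.jump n F w) x * ev (T.jump n F z) x))
    (g := fun F x => ρ * (hFace F ^ 3)⁻¹ * (ev (T.jump n F v) x * ev (T.jump n F z) x))
    (fun F => by fun_prop) (fun F => by fun_prop)
  unfold penal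
  rw [add_sub_add_comm, add_sub_add_comm, ← e1, ← e2, ← e3]
  refine congrArg₂ (· + ·) (congrArg₂ (· + ·) ?_ ?_) ?_
  · refine facesInt_congr fun F _ x => ?_
    simp only [Pi.sub_apply, gradP_sub, jump_sub, ev_sub, sub_mul, Finset.sum_sub_distrib]
    ring
  · refine facesInt_congr fun F _ x => ?_
    simp only [Pi.sub_apply, gradT_sub, jump_sub, ev_sub, sub_mul, Finset.sum_sub_distrib]
    ring
  · refine facesInt_congr fun F _ x => ?_
    simp only [jump_sub', ev_sub]
    ring

/-! ### Strong monotonicity -/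

section Monotone

variable {𝒜 ℬ : Type*} [TopologicalSpace 𝒜] [TopologicalSpace ℬ]
  {𝒟 : Coefficients d 𝒜 ℬ} {lam ν θ χ μ : ℝ}

/-- The integrand of `∫_Ω (|∇²v|² + 2λ |∇v|² + λ² |v|²)`. -/
def energyDensity (T : Mesh Ω) (lam : ℝ) (v : T.PwPoly) (K : T.elems) (x : E d) : ℝ :=
  (∑ i, ∑ j, (ev (hessP (v K) i j) x) ^ 2) + 2 * lam * ∑ i, (ev (gradP (v K) i) x) ^ 2 +
    lam ^ 2 * (ev (v K) x) ^ 2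

@[fun_prop] lemma continuous_energyDensity (v : T.PwPoly) (K : T.elems) :
    Continuous (T.energyDensity lam v K) := by
  unfold energyDensity; fun_prop

lemma energyDensity_nonneg (hlam : 0 ≤ lam) (v : T.PwPoly) (K : T.elems) (x : E d) :
    0 ≤ T.energyDensity lam v K x := by
  unfold energyDensity; positivity

lemma elemInt_energyDensity (v : T.PwPoly) :
    T.elemInt (T.energyDensity lam v) =
      T.hessSq v + 2 * lam * T.gradSq v + lam ^ 2 * T.l2Sq v := by
  have : T.energyDensity lam v = fun K x => (∑ i, ∑ j, (ev (hessP (v K) i j) x) ^ 2) +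
    2 * lam * ∑ i, (ev (gradP (v K) i) x) ^ 2 + lam ^ 2 * (ev (v K) x) ^ 2 := rfl
  rw [this, elemInt_add (fun K => integrableOn_hull _ (by fun_prop))
      (fun K => integrableOn_hull _ (by fun_prop)),
    elemInt_add (fun K => integrableOn_hull _ (by fun_prop))
      (fun K => integrableOn_hull _ (by fun_prop)), elemInt_const_mul, elemInt_const_mul]
  rfl

/-- Cauchy–Schwarz for (Δv, -λv) with weights d and 1; the gradient part of the energy density is
simply added. -/
lemma sq_lap_sub_le (v : T.PwPoly) (K : T.elems) (x : E d) (hlam : 0 ≤ lam) :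
    (ev (lapP (v K)) x - lam * ev (v K) x) ^ 2 ≤ (d + 1) * T.energyDensity lam v K x := by
  have h1 := sq_lapP_le (v K) x
  have h2 : 0 ≤ 2 * lam * ∑ i, (ev (gradP (v K) i) x) ^ 2 := by positivity
  have h3 := sq_add_le_of_sq_le (A := ev (lapP (v K)) x) (B := -(lam * ev (v K) x)) (p := d)
    (q := 1) (P := ∑ i, ∑ j, (ev (hessP (v K) i j) x) ^ 2) (Q := lam ^ 2 * (ev (v K) x) ^ 2)
    (by positivity) zero_le_one (by positivity) (by positivity) h1 (by apply le_of_eq; ring)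
  rw [← sub_eq_add_neg] at h3
  refine h3.trans (mul_le_mul_of_nonneg_left ?_ (by positivity))
  unfold energyDensity
  linarith

/-- The pointwise inequality behind strong monotonicity: `δ` is the difference of the nonlinear
operators, `ℓ` the linear operator, `R` the lifting, and `Q` the energy density. -/
lemma le_mul_sub_of_sq_le {δ ℓ R Q m : ℝ} (hθ1 : θ < 1) (hμ : 0 < μ) (hm : 0 < m) (hν0 : 0 < ν)
    (hμθ : μ = θ - (1 - ν) / (4 * (1 - θ))) (hχ : χ = 0 ∨ χ = 1) (hQ : 0 ≤ Q)
    (hδ : (δ - ℓ) ^ 2 ≤ (1 - ν) * Q) (hℓ : ℓ ^ 2 ≤ m * Q) :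
    θ * ℓ ^ 2 - (θ - μ) * Q - μ / 8 * Q - 4 * (m + 1) / μ * R ^ 2 ≤ δ * (ℓ - χ * R) := by
  have h1θ : 0 < 1 - θ := by linarith
  have h1 : θ * ℓ ^ 2 - (θ - μ) * Q ≤ δ * ℓ := by
    -- Write δℓ = ℓ² + (δ - ℓ)ℓ and spend (1 - θ)ℓ² on the cross term; this fixes the constant
    -- 1/(4(1 - θ)) in μ.
    have e1 : δ * ℓ - θ * ℓ ^ 2 + (δ - ℓ) ^ 2 / (4 * (1 - θ)) =
        (4 * (1 - θ))⁻¹ * (2 * (1 - θ) * ℓ + (δ - ℓ)) ^ 2 := by field_simp; ring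
    have e2 : 0 ≤ (4 * (1 - θ))⁻¹ * (2 * (1 - θ) * ℓ + (δ - ℓ)) ^ 2 := by positivity
    have e3 : (δ - ℓ) ^ 2 / (4 * (1 - θ)) ≤ (1 - ν) * Q / (4 * (1 - θ)) := by gcongr
    have e4 : (1 - ν) * Q / (4 * (1 - θ)) = (θ - μ) * Q := by rw [hμθ]; ring
    linarith
  -- From δ² ≤ 2(δ - ℓ)² + 2ℓ².
  have h2 : δ ^ 2 ≤ 2 * (m + 1) * Q := by
    have : 0 ≤ ν * Q := by positivity
    nlinarith [sq_nonneg (δ - 2 * ℓ)]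
  have h3 : δ * (χ * R) ≤ μ / 8 * Q + 4 * (m + 1) / μ * R ^ 2 := by
    have h4 : δ * R ≤ μ / 8 * Q + 4 * (m + 1) / μ * R ^ 2 := by
      have e1 : μ / (16 * (m + 1)) * δ ^ 2 + 4 * (m + 1) / μ * R ^ 2 - δ * R =
          (16 * μ * (m + 1))⁻¹ * (μ * δ - 8 * (m + 1) * R) ^ 2 := by field_simp; ring
      have e2 : 0 ≤ (16 * μ * (m + 1))⁻¹ * (μ * δ - 8 * (m + 1) * R) ^ 2 := by positivity
      have e3 : μ / (16 * (m + 1)) * δ ^ 2 ≤ μ / (16 * (m + 1)) * (2 * (m + 1) * Q) := by gcongr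
      have e4 : μ / (16 * (m + 1)) * (2 * (m + 1) * Q) = μ / 8 * Q := by field_simp; ring
      linarith
    rcases hχ with rfl | rfl
    · have : 0 ≤ μ / 8 * Q + 4 * (m + 1) / μ * R ^ 2 := by positivity
      simpa using this
    · simpa using h4
  linarith

variable [CompactSpace 𝒜] [CompactSpace ℬ]

lemma continuousOn_FgammaPw (h : 𝒟.Admissible Ω lam ν) (hd : 1 ≤ d) (w : T.PwPoly) (K : T.elems) :
    ContinuousOn (T.FgammaPw 𝒟 lam w K) (hull K.1) := by
  have hM : Continuous fun x => Matrix.of fun i j => ev (hessP (w K) i j) x :=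
    continuous_matrix fun i j => by simpa using continuous_ev _
  have hg : Continuous fun x => (WithLp.toLp 2 fun i => ev (gradP (w K) i) x : E d) := by fun_prop
  exact (h.continuousOn_Fgamma hd hM hg (continuous_ev (w K))).mono (T.hull_subset_closure K)

@[fun_prop] lemma continuous_discreteL (q : ℕ) (v : T.PwPoly) (K : T.elems) :
    Continuous (T.discreteL n q χ lam v K) := by
  unfold discreteL; fun_prop

lemma sq_FgammaPw_sub_le [Nonempty 𝒜] [Nonempty ℬ] (h : 𝒟.Admissible Ω lam ν) (hd : 1 ≤ d)
    (w v : T.PwPoly) (K : T.elems) {x : E d} (hx : x ∈ hull K.1) :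
    (T.FgammaPw 𝒟 lam w K x - T.FgammaPw 𝒟 lam v K x -
      (ev (lapP ((w - v) K)) x - lam * ev ((w - v) K) x)) ^ 2 ≤
      (1 - ν) * T.energyDensity lam (w - v) K x := by
  have h1 := h.sq_Fgamma_sub_le hd (T.hull_subset_closure K hx)
    (Matrix.of fun i j => ev (hessP (w K) i j) x) (Matrix.of fun i j => ev (hessP (v K) i j) x)
    (WithLp.toLp 2 fun i => ev (gradP (w K) i) x) (WithLp.toLp 2 fun i => ev (gradP (v K) i) x)
    (ev (w K) x) (ev (v K) x)
  have e1 : Matrix.trace ((Matrix.of fun i j => ev (hessP (w K) i j) x) -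
      (Matrix.of fun i j => ev (hessP (v K) i j) x)) = ev (lapP ((w - v) K)) x := by
    simp [Matrix.trace, lapP, hessP_sub]
  have e2 : frobSq ((Matrix.of fun i j => ev (hessP (w K) i j) x) -
      (Matrix.of fun i j => ev (hessP (v K) i j) x)) =
      ∑ i, ∑ j, (ev (hessP ((w - v) K) i j) x) ^ 2 := by
    simp [frobSq, hessP_sub]
  have e3 : ‖(WithLp.toLp 2 (fun i => ev (gradP (w K) i) x) : E d) -
      WithLp.toLp 2 (fun i => ev (gradP (v K) i) x)‖ ^ 2 =
      ∑ i, (ev (gradP ((w - v) K) i) x) ^ 2 := by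
    rw [EuclideanSpace.real_norm_sq_eq]
    simp [gradP_sub]
  rw [e1, e2, e3] at h1
  have e4 : ev ((w - v) K) x = ev (w K) x - ev (v K) x := by simp
  rw [energyDensity, e4]
  exact h1

/-- Lower bound for the difference of the nonlinear terms. -/
lemma HasFaceBounds.le_elemInt_Fgamma_sub [Nonempty 𝒜] [Nonempty ℬ] {q : ℕ}
    (hb : T.HasFaceBounds q D C) (hn : T.IsNormalField n) (h : 𝒟.Admissible Ω lam ν) (hd : 1 ≤ d)
    (hC : 0 < C) (hθ1 : θ < 1) (hμ : 0 < μ) (hμθ : μ = θ - (1 - ν) / (4 * (1 - θ)))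
    (hχ : χ = 0 ∨ χ = 1) (w v : T.PwPoly) :
    θ * T.elemInt (fun K x => (ev (lapP ((w - v) K)) x - lam * ev ((w - v) K) x) ^ 2) -
      (θ - μ) * T.elemInt (T.energyDensity lam (w - v)) -
      μ / 8 * T.elemInt (T.energyDensity lam (w - v)) -
      4 * (d + 2) / μ * ((d + 1) * C * T.jumpGradSq n (w - v)) ≤
      T.elemInt (fun K x => T.FgammaPw 𝒟 lam w K x * T.discreteL n q χ lam (w - v) K x) -
      T.elemInt (fun K x => T.FgammaPw 𝒟 lam v K x * T.discreteL n q χ lam (w - v) K x) := by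
  set z := w - v with hz
  set R := T.liftTotal n q z with hR
  have hint : ∀ u : T.PwPoly, ∀ K : T.elems, IntegrableOn (fun x => T.FgammaPw 𝒟 lam u K x *
      T.discreteL n q χ lam z K x) (hull K.1) := fun u K =>
    ((continuousOn_FgammaPw h hd u K).mul
      (continuous_discreteL q z K).continuousOn).integrableOn_compact (isCompact_hull _)
  have hlift := hb.l2Sq_liftTotal_le hn hd hC z
  rw [← hR] at hlift
  have h1 : T.elemInt (fun K x =>
      (θ * (ev (lapP (z K)) x - lam * ev (z K) x) ^ 2 + (-(θ - μ) - μ / 8) *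
        T.energyDensity lam z K x) + -(4 * (d + 2) / μ) * (ev (R K) x) ^ 2) ≤
      T.elemInt (fun K x => T.FgammaPw 𝒟 lam w K x * T.discreteL n q χ lam z K x -
        T.FgammaPw 𝒟 lam v K x * T.discreteL n q χ lam z K x) := by
    refine elemInt_mono (fun K => integrableOn_hull _ (by fun_prop))
      (fun K => (hint w K).sub (hint v K)) fun K x hx => ?_
    -- The value m = d + 1 bounds (Δz - λz)² by mQ and accounts for the factor d + 2 in front of the
    -- lifting.
    have h2 := le_mul_sub_of_sq_le (R := ev (R K) x) (m := d + 1) hθ1 hμ (by positivity) h.nu_pos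
      hμθ hχ (energyDensity_nonneg h.lam_nonneg z K x) (sq_FgammaPw_sub_le h hd w v K hx)
      (sq_lap_sub_le z K x h.lam_nonneg)
    have e1 : T.discreteL n q χ lam z K x =
        (ev (lapP (z K)) x - lam * ev (z K) x) - χ * ev (R K) x := by
      rw [discreteL, hR]; ring
    rw [← sub_mul, e1]
    refine le_trans (le_of_eq ?_) h2
    ring
  rw [elemInt_add (fun K => integrableOn_hull _ (by fun_prop))
      (fun K => integrableOn_hull _ (by fun_prop)),
    elemInt_add (fun K => integrableOn_hull _ (by fun_prop))
      (fun K => integrableOn_hull _ (by fun_prop)), elemInt_const_mul, elemInt_const_mul,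
    elemInt_const_mul, elemInt_sub (hint w) (hint v)] at h1
  have h3 : 4 * (d + 2) / μ * T.l2Sq R ≤ 4 * (d + 2) / μ * ((d + 1) * C * T.jumpGradSq n z) := by
    gcongr
  change _ + _ + -(4 * (d + 2) / μ) * T.l2Sq R ≤ _ at h1
  have e5 : T.elemInt (fun K x => T.energyDensity lam z K x) = T.elemInt (T.energyDensity lam z) :=
    rfl
  rw [e5] at h1
  linarith

/-- The sum of the linear terms, by integration by parts. -/
lemma elemInt_lap_sub_sq (v : T.PwPoly) :
    T.elemInt (fun K x => (ev (lapP (v K)) x - lam * ev (v K) x) ^ 2) + T.hessSq v -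
      T.elemInt (fun K x => (ev (lapP (v K)) x) ^ 2) =
      T.elemInt (T.energyDensity lam v) - 2 * lam * T.elemInt (fun K x =>
        ∑ i, (ev (gradP (v K) i) x) ^ 2 + ev (v K) x * ev (lapP (v K)) x) := by
  rw [hessSq, ← elemInt_add (fun K => integrableOn_hull _ (by fun_prop))
      (fun K => integrableOn_hull _ (by fun_prop)),
    ← elemInt_sub (fun K => integrableOn_hull _ (by fun_prop))
      (fun K => integrableOn_hull _ (by fun_prop)), ← elemInt_const_mul,
    ← elemInt_sub (fun K => integrableOn_hull _ (by fun_prop))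
      (fun K => integrableOn_hull _ (by fun_prop))]
  congr 1
  ext K x
  unfold energyDensity
  ring

lemma normSq_nonneg (hb : T.HasFaceBounds p D C) (v : T.PwPoly) : 0 ≤ T.normSq n v := by
  rw [normSq_eq]
  have := hessSq_nonneg v
  have := gradSq_nonneg v
  have := l2Sq_nonneg v
  have := hb.jumpSq_nonneg (n := n) v
  positivity

/-- The threshold for the penalization of the jumps of the gradients. -/
def sigmaMin (d : ℕ) (C μ : ℝ) : ℝ :=
  4 * (d + 2) / μ * ((d + 1) * C) +
    8 * ((d + 1) * (C + d * C ^ 2) + (4 * d + 6) * (d + 1) * C) / μ + μ / 2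

/-- The threshold for the penalization of the jumps of the values. -/
def rhoMin (d : ℕ) (C μ : ℝ) : ℝ := 8 * ((d + 1) * (C + d * C ^ 2)) / μ + μ / 2

/-- The absorption of the error terms in the proof of coercivity. -/
lemma coercivity_arith {μ θ σ ρ M₁ M₂ A N S H G L2 Jg Jt Jv L La X Q : ℝ}
    (hμ : 0 < μ) (hθ0 : 0 ≤ θ) (hθ1 : θ ≤ 1) (hM₁ : 0 < M₁) (hM₂ : 0 < M₂) (hA : 0 ≤ A)
    (hH : 0 ≤ H) (hJg : 0 ≤ Jg) (hJt : 0 ≤ Jt) (hJv : 0 ≤ Jv) (hG : 0 ≤ G) (hL2 : 0 ≤ L2)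
    (hQ : Q = H + G + L2) (hE : L + H - La = Q - X)
    (hN : θ * L - (θ - μ) * Q - μ / 8 * Q - A * Jg ≤ N)
    (hS : H - La - (μ / (8 * M₂) * (M₂ * H) + (μ / (8 * M₂))⁻¹ * (Jg + Jt)) ≤ S)
    (hX : |X| ≤ μ / 8 * L2 + 8 * M₁ / μ * (Jg + Jv))
    (hσ : A + 8 * M₁ / μ + 8 * M₂ / μ + μ / 2 ≤ σ) (hρ : 8 * M₁ / μ + μ / 2 ≤ ρ) :
    μ / 2 * (H + (Jg + Jv)) ≤ N + θ * S + (σ * Jg + σ * Jt + ρ * Jv) := by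
  have e1 : μ / (8 * M₂) * (M₂ * H) = μ / 8 * H := by field_simp
  have e2 : (μ / (8 * M₂))⁻¹ = 8 * M₂ / μ := by field_simp
  rw [e1, e2] at hS
  have hbad0 : 0 ≤ μ / 8 * H + 8 * M₂ / μ * (Jg + Jt) := by positivity
  have h1 := mul_le_mul_of_nonneg_left hS hθ0
  have h1' := mul_le_of_le_one_left hbad0 hθ1
  have h2 : θ * X ≤ μ / 8 * L2 + 8 * M₁ / μ * (Jg + Jv) := by
    refine le_trans ?_ hX
    calc θ * X ≤ θ * |X| := mul_le_mul_of_nonneg_left (le_abs_self _) hθ0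
      _ ≤ |X| := mul_le_of_le_one_left (abs_nonneg _) hθ1
  have h3 : θ * L + θ * (H - La) = θ * Q - θ * X := by linear_combination θ * hE
  -- Lifting, stabilization and integration by parts each cost at most μQ/8, so 5μQ/8 is left, more
  -- than the required μH/2.
  have h4 : μ / 8 * L2 ≤ μ / 8 * Q := mul_le_mul_of_nonneg_left (by linarith) (by positivity)
  have h5 : μ / 8 * H ≤ μ / 8 * Q := mul_le_mul_of_nonneg_left (by linarith) (by positivity)
  have h9 : 0 ≤ μ / 8 * Q := h5.trans' (by positivity)
  have h6 := mul_le_mul_of_nonneg_right hσ hJg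
  have h7 := mul_le_mul_of_nonneg_right hσ hJt
  have h8 := mul_le_mul_of_nonneg_right hρ hJv
  have h11 : 0 ≤ (A + 8 * M₁ / μ + μ / 2) * Jt := by positivity
  linarith

/-- The lower bound for the nonlinear form that precedes the use of the Poincaré--Friedrichs
inequality. -/
lemma HasFaceBounds.le_form_sub [Nonempty 𝒜] [Nonempty ℬ] {q : ℕ} {σ ρ : ℝ}
    (hbp : T.HasFaceBounds p D C) (hbq : T.HasFaceBounds q D C) (hn : T.IsNormalField n)
    (h : 𝒟.Admissible Ω lam ν) (hd : 1 ≤ d)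
    (hC : 0 < C) (hθ0 : 0 < θ) (hθ1 : θ < 1) (hμ : 0 < μ)
    (hμθ : μ = θ - (1 - ν) / (4 * (1 - θ)))
    (hχ : χ = 0 ∨ χ = 1) (hσ : sigmaMin d C μ ≤ σ) (hρ : rhoMin d C μ ≤ ρ) {w v : T.PwPoly}
    (hw : w ∈ T.V0 p) (hv : v ∈ T.V0 p) :
    μ / 2 * (T.hessSq (w - v) + T.jumpSq n (w - v)) ≤
      T.form n 𝒟 lam θ χ σ ρ q w (w - v) - T.form n 𝒟 lam θ χ σ ρ q v (w - v) := by
  set z := w - v with hz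
  have hzV : z ∈ T.V0 p := V0_sub_mem hw hv
  set M₁ : ℝ := (d + 1) * (C + d * C ^ 2) with hM₁
  set M₂ : ℝ := (4 * d + 6) * (d + 1) * C with hM₂
  have hM₁0 : 0 < M₁ := by positivity
  have hM₂0 : 0 < M₂ := by positivity
  have hlam := h.lam_nonneg
  have hF := hbq.le_elemInt_Fgamma_sub hn h hd hC hθ1 hμ hμθ hχ w v
  have hS := hbp.le_stab_self hn hd hC.le hzV (ε := μ / (8 * M₂)) (by positivity)
  have hX : |2 * lam * T.elemInt (fun K x =>
      ∑ i, (ev (gradP (z K) i) x) ^ 2 + ev (z K) x * ev (lapP (z K)) x)| ≤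
      μ / 8 * (lam ^ 2 * T.l2Sq z) + 8 * M₁ / μ * T.jumpSq n z := by
    -- For λ = 0 the term vanishes. Otherwise ε proportional to λ yields λ² in front of ∫v², as in
    -- the energy, and a jump coefficient free of λ.
    rcases hlam.eq_or_lt with h0 | h0
    · rw [← h0]
      have := hbp.jumpSq_nonneg (n := n) z
      simpa using (by positivity : 0 ≤ 8 * M₁ / μ * T.jumpSq n z)
    · have h1 := hbp.abs_elemInt_grad_add_le hn hd hC.le hzV (ε := lam * μ / (16 * M₁))
        (by positivity)
      rw [abs_mul, abs_of_pos (by positivity : 0 < 2 * lam)]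
      refine (mul_le_mul_of_nonneg_left h1 (by positivity)).trans (le_of_eq ?_)
      rw [← hM₁]
      field_simp
      ring
  have hE := elemInt_lap_sub_sq (lam := lam) z
  have hEn := elemInt_energyDensity (lam := lam) z
  have hH := hessSq_nonneg z
  have hG := gradSq_nonneg z
  have hL := l2Sq_nonneg z
  have hform : T.form n 𝒟 lam θ χ σ ρ q w z - T.form n 𝒟 lam θ χ σ ρ q v z =
      (T.elemInt (fun K x => T.FgammaPw 𝒟 lam w K x * T.discreteL n q χ lam z K x) -
      T.elemInt (fun K x => T.FgammaPw 𝒟 lam v K x * T.discreteL n q χ lam z K x)) +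
      θ * T.stab n z z + T.penal n σ ρ z z := by
    rw [form, form, ← hn.stab_sub hd w v z, ← hn.penal_sub hd σ ρ w v z]
    ring
  rw [hform, penal_self]
  refine coercivity_arith hμ hθ0.le hθ1.le hM₁0 hM₂0
    (by positivity : (0 : ℝ) ≤ 4 * (d + 2) / μ * ((d + 1) * C)) hH
    (hbp.jumpGradSq_nonneg z) (hbp.jumpTanSq_nonneg z) (hbp.jumpValSq_nonneg z)
    (G := 2 * lam * T.gradSq z) (L2 := lam ^ 2 * T.l2Sq z) (by positivity) (by positivity)
    hEn hE ?_ hS hX ?_ ?_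
  · rw [mul_assoc (4 * (d + 2) / μ)]; exact hF
  · refine (le_of_eq ?_).trans hσ
    rw [sigmaMin, ← hM₁, ← hM₂]; ring
  · refine (le_of_eq ?_).trans hρ
    rw [rhoMin, ← hM₁]

end Monotone

end Mesh

/-! ### Assembly: admissible θ, thresholds and the monotonicity constant. -/

lemma muConst_pos {ν θ : ℝ} (hν0 : 0 < ν) (hν1 : ν ≤ 1)
    (hθ : θ ∈ Set.Ioo ((1 - Real.sqrt ν) / 2) ((1 + Real.sqrt ν) / 2)) :
    0 < θ ∧ θ < 1 ∧ 0 < muConst ν θ := by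
  obtain ⟨h1, h2⟩ := hθ
  have hs : Real.sqrt ν ≤ 1 := Real.sqrt_le_one.2 hν1
  have hsq := Real.sq_sqrt hν0.le
  have h0 : 0 < θ := by linarith
  have h3 : θ < 1 := by linarith
  refine ⟨h0, h3, ?_⟩
  rw [muConst, sub_pos, div_lt_iff₀ (by linarith)]
  -- Positivity of μ means 4θ(1 - θ) > 1 - ν, that is (2θ - 1)² < ν.
  nlinarith

open Classical in
/-- The thresholds for the penalization parameters and the constant of strong monotonicity. -/
theorem exists_stronglyMonotone :
    ∃ (Cmon : ℝ → ℝ → ℝ) (σmin ρmin : ℕ → ℝ → ℝ → ℕ → ℕ → ℝ → ℝ → ℝ),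
      ∀ (d : ℕ), 2 ≤ d →
      ∀ (Ω : Set (E d)), Bornology.IsBounded Ω →
      ∀ (T : Mesh Ω) (n : Finset (E d) → E d), T.IsNormalField n →
      ∀ (p q : ℕ) (s : Fin 2) (χ : ℝ), χ = 0 ∨ χ = 1 →
      ∀ (𝒜 ℬ : Type*) [TopologicalSpace 𝒜] [CompactSpace 𝒜] [Nonempty 𝒜]
        [TopologicalSpace ℬ] [CompactSpace ℬ] [Nonempty ℬ]
        (D : Coefficients d 𝒜 ℬ) (lam ν : ℝ), D.Admissible Ω lam ν →
      ∀ θ ∈ Set.Ioo ((1 - Real.sqrt ν) / 2) ((1 + Real.sqrt ν) / 2),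
        0 < muConst ν θ ∧
        0 < σmin d T.shapeReg lam p q θ (muConst ν θ) ∧
        0 < ρmin d T.shapeReg lam p q θ (muConst ν θ) ∧
        ∀ C : ℝ, T.IsPoincareConst n p C →
        ∀ σ ρ : ℝ, σmin d T.shapeReg lam p q θ (muConst ν θ) ≤ σ →
          ρmin d T.shapeReg lam p q θ (muConst ν θ) ≤ ρ →
          T.StronglyMonotone n p s (T.form n D lam θ χ σ ρ q) (Cmon (muConst ν θ) C) := by
  have hex : ∀ (d : ℕ) (ϑ : ℝ) (p q : ℕ), ∃ C > 0, 2 ≤ d → ∀ (Ω : Set (E d)),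
      Bornology.IsBounded Ω → ∀ (T : Mesh Ω) (n : Finset (E d) → E d), T.IsNormalField n →
      T.shapeReg = ϑ → T.HasFaceBounds p (Metric.diam Ω) C ∧
        T.HasFaceBounds q (Metric.diam Ω) C := by
    intro d ϑ p q
    by_cases hd : 2 ≤ d
    -- A single constant serves both degrees: p for the discrete functions, q for the liftings.
    · obtain ⟨C, hC, h⟩ := Mesh.exists_faceBounds d (max p q) hd ϑ
      refine ⟨C, hC, fun _ Ω hΩ T n hn hT => ⟨fun F hF K hK => ?_, fun F hF K hK => ?_⟩⟩
      · have hB := h Ω hΩ T n hn hT F hF K hK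
        exact ⟨hB.pos, fun P hP => hB.trace P (hP.trans (le_max_left _ _)),
          fun P hP => hB.inverse P (hP.trans (le_max_left _ _)), hB.le_diam⟩
      · have hB := h Ω hΩ T n hn hT F hF K hK
        exact ⟨hB.pos, fun P hP => hB.trace P (hP.trans (le_max_right _ _)),
          fun P hP => hB.inverse P (hP.trans (le_max_right _ _)), hB.le_diam⟩
    · exact ⟨1, one_pos, fun h => absurd h hd⟩
  choose C₀ hC₀ hb using hex
  -- A Poincaré–Friedrichs constant C ≤ 0 forces the norm to vanish on the space, and then any
  -- positive value will do.
  refine ⟨fun μ C => if 0 < C then 2 * C ^ 2 / μ else 1,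
    fun d ϑ _ p q _ μ => Mesh.sigmaMin d (C₀ d ϑ p q) μ,
    fun d ϑ _ p q _ μ => Mesh.rhoMin d (C₀ d ϑ p q) μ, ?_⟩
  intro d hd Ω hΩ T n hn p q s χ hχ 𝒜 ℬ _ _ _ _ _ _ D lam ν h θ hθ
  obtain ⟨hθ0, hθ1, hμ⟩ := muConst_pos h.nu_pos h.nu_le_one hθ
  have hC₀' := hC₀ d T.shapeReg p q
  obtain ⟨hbp, hbq⟩ := hb d T.shapeReg p q hd Ω hΩ T n hn rfl
  refine ⟨hμ, by unfold Mesh.sigmaMin; positivity, by unfold Mesh.rhoMin; positivity, ?_⟩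
  intro C hC σ ρ hσ hρ
  refine ⟨by beta_reduce; split_ifs <;> positivity, ?_⟩
  rintro w ⟨hw, -⟩ v ⟨hv, -⟩
  have key := hbp.le_form_sub hbq hn h (by omega) hC₀' hθ0 hθ1 hμ rfl hχ hσ hρ hw hv
  refine le_trans ?_ key
  -- The spaces are nested, so the Poincaré–Friedrichs inequality on the discontinuous space serves
  -- both values of s.
  have hzV : w - v ∈ T.V p 0 := ⟨Mesh.V0_sub_mem hw hv, fun h0 => absurd h0 (by decide)⟩
  have hP := hC 0 (w - v) hzV
  have hN := Mesh.normSq_nonneg (n := n) hbp (w - v)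
  set X := T.hessSq (w - v) + T.jumpSq n (w - v) with hX
  have hX0 : 0 ≤ X := add_nonneg (Mesh.hessSq_nonneg _) (hbp.jumpSq_nonneg _)
  by_cases hC0 : 0 < C
  · beta_reduce
    rw [if_pos hC0]
    have h1 : T.normSq n (w - v) ≤ C ^ 2 * X := by
      rw [← Real.sq_sqrt hN, ← Real.sq_sqrt hX0, ← mul_pow]
      gcongr
    calc (2 * C ^ 2 / muConst ν θ)⁻¹ * T.normSq n (w - v)
        ≤ (2 * C ^ 2 / muConst ν θ)⁻¹ * (C ^ 2 * X) := by gcongr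
      _ = muConst ν θ / 2 * X := by field_simp
  · beta_reduce
    rw [if_neg hC0]
    have h1 : Real.sqrt (T.normSq n (w - v)) ≤ 0 :=
      hP.trans (mul_nonpos_of_nonpos_of_nonneg (not_lt.1 hC0) (Real.sqrt_nonneg _))
    have h2 : T.normSq n (w - v) ≤ 0 := Real.sqrt_eq_zero'.1 (le_antisymm h1 (Real.sqrt_nonneg _))
    have h3 : 0 ≤ muConst ν θ / 2 * X := by positivity
    linarith

end IsaacsDG

end

/-- The constant of the discrete Poincaré--Friedrichs inequality can be chosen to depend only on
`d`, the shape-regularity, `p` and `diam Ω`. The constant `Cmon` of strong monotonicity is a function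
of `μ` and of the Poincaré--Friedrichs constant only; the thresholds `σmin`, `ρmin` are functions of
`d`, the shape-regularity, `λ`, `p`, `q`, `θ`, `μ` only. -/
theorem theorem5p4 :
    (∃ CPF : ℕ → ℝ → ℕ → ℝ → ℝ,
      ∀ (d : ℕ), d = 2 ∨ d = 3 →
      ∀ (Ω : Set (IsaacsDG.E d)), IsaacsDG.IsConvexPolytopalDomain Ω →
      ∀ (T : IsaacsDG.Mesh Ω) (n : Finset (IsaacsDG.E d) → IsaacsDG.E d), T.IsNormalField n →
      ∀ p : ℕ, 2 ≤ p →
        T.IsPoincareConst n p (CPF d T.shapeReg p (Metric.diam Ω))) ∧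
    ∃ (Cmon : ℝ → ℝ → ℝ) (σmin ρmin : ℕ → ℝ → ℝ → ℕ → ℕ → ℝ → ℝ → ℝ),
      ∀ (d : ℕ), d = 2 ∨ d = 3 →
      ∀ (Ω : Set (IsaacsDG.E d)), IsaacsDG.IsConvexPolytopalDomain Ω →
      ∀ (T : IsaacsDG.Mesh Ω) (n : Finset (IsaacsDG.E d) → IsaacsDG.E d), T.IsNormalField n →
      ∀ (p q : ℕ), 2 ≤ p → p ≤ q + 2 →
      ∀ (s : Fin 2) (χ : ℝ), χ = 0 ∨ χ = 1 →
      ∀ (𝒜 ℬ : Type*) [MetricSpace 𝒜] [CompactSpace 𝒜] [Nonempty 𝒜]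
        [MetricSpace ℬ] [CompactSpace ℬ] [Nonempty ℬ]
        (D : IsaacsDG.Coefficients d 𝒜 ℬ) (lam ν : ℝ), D.Admissible Ω lam ν →
      ∀ θ ∈ Set.Ioo ((1 - Real.sqrt ν) / 2) ((1 + Real.sqrt ν) / 2),
        0 < IsaacsDG.muConst ν θ ∧
        0 < σmin d T.shapeReg lam p q θ (IsaacsDG.muConst ν θ) ∧
        0 < ρmin d T.shapeReg lam p q θ (IsaacsDG.muConst ν θ) ∧
        ∀ C : ℝ, T.IsPoincareConst n p C →
        ∀ σ ρ : ℝ, σmin d T.shapeReg lam p q θ (IsaacsDG.muConst ν θ) ≤ σ →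
          ρmin d T.shapeReg lam p q θ (IsaacsDG.muConst ν θ) ≤ ρ →
          T.StronglyMonotone n p s (T.form n D lam θ χ σ ρ q)
            (Cmon (IsaacsDG.muConst ν θ) C) := by
  refine ⟨?_, ?_⟩
  · obtain ⟨CPF, h⟩ := IsaacsDG.Mesh.exists_poincareConst
    exact ⟨CPF, fun d hd Ω hΩ T n hn p _ =>
      h d (by omega) Ω hΩ.isBounded hΩ.nonempty T n hn p⟩
  · obtain ⟨Cmon, σ, ρ, h⟩ := IsaacsDG.exists_stronglyMonotone
    exact ⟨Cmon, σ, ρ, fun d hd Ω hΩ T n hn p q _ _ s χ hχ 𝒜 ℬ _ _ _ _ _ _ =>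
      h d (by omega) Ω hΩ.isBounded T n hn p q s χ hχ 𝒜 ℬ⟩
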